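/- **Setting.** Let $G$ be a connected Lie group with Lie algebra $\mathfrak g$, $F\in\mathfrak g^*$, $K(g)y=y\circ \mathrm{Ad}(g^{-1})$ the coadjoint action, $\Omega=K(G)F$ the orbit, $G_F$ the stabilizer and $\mathfrak g_F$ its Lie algebra; $\Omega$ is identified with $G_F\backslash G$ by $G_Fx\mapsto K(x^{-1})F$. Let $\chi_F$ be a unitary character of $G_F$ with $\chi_F(\exp X)=e^{2\pi i\langle F,X\rangle}$ for $X\in\mathfrak g_F$, and $\tilde\sigma$ a unitary representation of $G_F$ (strongly continuous, as are all unitary representations below) that is trivial on $(G_F)_0$. Let $(\mathfrak p,\rho,\sigma_0)$ be a $(\tilde\sigma,F)$-polarization: a) $\mathfrak p\subseteq\mathfrak g_{\mathbb C}$ is a complex subalgebra containing $\mathfrak g_F$; b) $\mathfrak p$ is $\mathrm{Ad}(G_F)$-invariant; c) $\mathfrak p+\overline{\mathfrak p}$ is the complexification of a real subalgebra $\mathfrak m=(\mathfrak p+\overline{\mathfrak p})\cap\mathfrak g$; d) with $M_0,H_0$ the connected subgroups with Lie algebras $\mathfrak m$ and $\mathfrak h=\mathfrak p\cap\mathfrak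 g$, the groups $M_0$, $H_0$, $M=G_FM_0$, $H=G_FH_0$ are closed; e) $\sigma_0$ is an irreducible unitary representation of $H_0$ in a Hilbert space $V$, its restriction to $G_F\cap H_0$ is a multiple of that of $\chi_F\tilde\sigma$, and its equivalence class is fixed by $G_F$; f) $\rho$ is a representation of $\mathfrak p$ by operators on a dense invariant domain $D\subseteq V$ with $\rho|_{\mathfrak h}=D\sigma_0$ that satisfies Nelson's condition for $H_0$: for some basis $(b_j)$ of $\mathfrak h$, $\sum_j\rho(b_j)^2$ is essentially self-adjoint on $D$. Let $\sigma$ be an irreducible unitary representation of $H$ in $V$ that extends $\sigma_0$ and whose restriction to $G_F$ is a multiple of $\chi_F\tilde\sigma$. The smooth sections of $\mathcal E=G\times_{G_F}V\to\Omega$ are the smooth $\varphi:G\to V$ with $\varphi(kx)=\sigma(k)\varphi(x)$ for $k\in G_F$. The representation $\mathrm{Ind}=\mathrm{Ind}(G;\mathfrak p,F,\rho,\sigma_0)$ acts by right translations, $(\mathrm{Ind}(g)\varphi)(x)=\varphi(xg)$, in the space $C^\infty(G;\mathfrak p,\rho,F,\sigma_0)$ of smooth $\varphi:G\to V$ with $\varphi(kx)=\sigma(k)\varphi(x)$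 for $k\in H$ and $L_Z\varphi+\rho(Z)\varphi=0$ for $Z\in\overline{\mathfrak p}$. Here $(L_X\varphi)(x)=\frac{d}{dt}\big|_0\varphi(\exp(-tX)x)$ for $X\in\mathfrak g$, extended complex linearly, and $\rho(\overline Z):=-\rho(Z)^*$ for $Z\in\mathfrak p$, so that the equation means $\langle v,L_{\overline Z}\varphi\rangle=\langle\rho(Z)v,\varphi\rangle$ for all $Z\in\mathfrak p$, $v\in D$. Let $h>0$ and $\hbar=h/2\pi$. For $X\in\mathfrak g$ let $\xi_X$ be the vector field on $\Omega$ with $(\xi_Xu)(y)=\frac d{dt}\big|_0u(K(\exp(-tX))y)$. Equip $\Omega$ with $h$ times the Kirillov form, $\omega_y(\xi_X,\xi_Y)=h\langle y,[X,Y]\rangle$, and put $f_X(y)=h\langle y,X\rangle$ (for $h=1$ these are the Kirillov form and the coordinate functions). The Hamiltonian field of $u\in C^\infty(\Omega)$ is defined by $i(\xi_u)\omega+du=0$, the bracket by $\{u,v\}=\xi_uv$, and for a connection $\nabla$ on $\mathcal E$ put $Q(u)=u+\frac{\hbar}{i}\nabla_{\xi_u}$. **Theorem.** Every $u\in C^\infty(\Omega)$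 has exactly one Hamiltonian field, and $\xi_{f_X}=\xi_X$. There is a connection $\nabla$ on $\mathcal E$ that preserves the Hilbert structure of the fibres, has curvature $[\nabla_\xi,\nabla_\eta]-\nabla_{[\xi,\eta]}=-\frac i\hbar\omega(\xi,\eta)\,\mathrm{Id}$, and for which $Q$ is linear with $Q(1)=\mathrm{Id}$ and $Q(\{u,v\})=\frac i\hbar[Q(u),Q(v)]$, such that for every $X\in\mathfrak g$ $$\mathrm{Lie}_X(\mathrm{Ind})=\frac i\hbar\,Q(f_X).$$ That is: for every smooth section $\varphi$ of $\mathcal E$ and every $x\in G$, $\frac d{dt}\big|_0\varphi(x\exp tX)=\frac i\hbar(Q(f_X)\varphi)(x)$; and if $\varphi\in C^\infty(G;\mathfrak p,\rho,F,\sigma_0)$, then $\psi:=\frac i\hbar Q(f_X)\varphi$ lies in this space too and $\frac d{dt}\big|_0(\mathrm{Ind}(\exp tX)\varphi)(x)=\psi(x)$ for all $x\in G$. The same holds for the unitarized representation. Let $G_F\subseteq K\subseteq H$ be a subgroup, $\nu$ a $\sigma$-finite Borel measure on $K\backslash G$ invariant under right translations, $\|\varphi\|_\nu^2=\int_{K\backslash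 G}\|\varphi\|_V^2\,d\nu$, and $\varphi\in C^\infty(G;\mathfrak p,\rho,F,\sigma_0)$ with $\|\varphi\|_\nu<\infty$. Then the difference quotients $t^{-1}(\mathrm{Ind}(\exp tX)\varphi-\varphi)$ are Cauchy for $\|\cdot\|_\nu$ as $t\to0$ if and only if $\|\frac i\hbar Q(f_X)\varphi\|_\nu<\infty$, and in this case they converge to $\frac i\hbar Q(f_X)\varphi$ in this norm. -/

import Mathlib

open scoped Manifold ContDiff TensorProduct Topology

noncomputable section

namespace OrbitMethod

set_option linter.unusedSectionVars false

universe u v w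

instance leInftyMinSmoothness : ENat.LEInfty (minSmoothness ℝ 3) :=
  ⟨by
    rw [minSmoothness_of_isRCLikeNormedField]
    exact ENat.LEInfty.out⟩

/-- The real Lie algebra `𝔤 = T_e G` of an `n`-dimensional Lie group `G`. -/
abbrev LieAlg (n : ℕ) (G : Type u) [TopologicalSpace G]
    [ChartedSpace (EuclideanSpace ℝ (Fin n)) G] [Group G] : Type :=
  GroupLieAlgebra (𝓡 n) G

/-- The dual space `𝔤*`. -/
abbrev CoAlg (n : ℕ) (G : Type u) [TopologicalSpace G]
    [ChartedSpace (EuclideanSpace ℝ (Fin n)) G] [Group G] : Type :=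
  Module.Dual ℝ (LieAlg n G)

/-- The complexification `𝔤_ℂ = ℂ ⊗ 𝔤`. -/
abbrev LieAlgC (n : ℕ) (G : Type u) [TopologicalSpace G]
    [ChartedSpace (EuclideanSpace ℝ (Fin n)) G] [Group G] : Type :=
  ℂ ⊗[ℝ] LieAlg n G

section Group

variable {n : ℕ} {G : Type u} [TopologicalSpace G]
  [ChartedSpace (EuclideanSpace ℝ (Fin n)) G] [Group G]

/-- `γ` is the one-parameter subgroup `t ↦ exp (t X)` of `G`. -/
structure IsOneParam (γ : ℝ → G) (X : LieAlg n G) : Prop where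
  map_add : ∀ s t, γ (s + t) = γ s * γ t
  smooth : ContMDiff 𝓘(ℝ, ℝ) (𝓡 n) ∞ γ
  velocity : (mfderiv 𝓘(ℝ, ℝ) (𝓡 n) γ 0 : ℝ → EuclideanSpace ℝ (Fin n)) 1 = X

/-- The adjoint action: the derivative at `e` of `y ↦ x y x⁻¹`. -/
def Ad (x : G) : LieAlg n G →ₗ[ℝ] LieAlg n G :=
  (mfderiv (𝓡 n) (𝓡 n) (fun y : G => x * y * x⁻¹) 1 :
    EuclideanSpace ℝ (Fin n) →L[ℝ] EuclideanSpace ℝ (Fin n)).toLinearMap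

/-- The coadjoint action `K(g) y = y ∘ Ad(g⁻¹)`. -/
def coadj (g : G) (y : CoAlg n G) : CoAlg n G := y ∘ₗ Ad g⁻¹

/-- The Lie algebra of a subgroup: the `X` with `exp (t X)` in the subgroup for all `t`. -/
def lieAlgOf (n : ℕ) [ChartedSpace (EuclideanSpace ℝ (Fin n)) G] (K : Subgroup G) :
    Set (LieAlg n G) :=
  {X | ∃ γ : ℝ → G, IsOneParam γ X ∧ ∀ t, γ t ∈ K}

/-- The subgroup generated by `exp S`; for a Lie subalgebra `S` it is the connected
(not necessarily closed) subgroup with Lie algebra `S`. -/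
def analyticSubgroup (S : Submodule ℝ (LieAlg n G)) : Subgroup G :=
  Subgroup.closure {g | ∃ X ∈ S, ∃ γ : ℝ → G, IsOneParam γ X ∧ ∃ t, γ t = g}

theorem IsOneParam.mem_analyticSubgroup {S : Submodule ℝ (LieAlg n G)} {γ : ℝ → G}
    {X : LieAlg n G} (hγ : IsOneParam γ X) (hX : X ∈ S) (t : ℝ) :
    γ t ∈ analyticSubgroup S :=
  Subgroup.subset_closure ⟨X, hX, γ, hγ, t, rfl⟩

theorem Ad_one : Ad (1 : G) = (LinearMap.id : LieAlg n G →ₗ[ℝ] LieAlg n G) := by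
  have h : (fun y : G => (1 : G) * y * (1 : G)⁻¹) = id := by ext y; simp
  unfold Ad
  rw [h]
  have := mfderiv_id (I := 𝓡 n) (x := (1 : G))
  ext1 v
  exact congrArg (fun L => L v) this

theorem coadj_one (y : CoAlg n G) : coadj (1 : G) y = y := by
  unfold coadj; rw [inv_one, Ad_one]; rfl

/-- The coadjoint orbit `Ω_F`. -/
abbrev Orbit (F : CoAlg n G) : Type := {y : CoAlg n G // ∃ g : G, coadj g F = y}

/-- The projection `x ↦ K(x⁻¹) F` of `G` onto `Ω_F`. Its fibres are the cosets `G_F x`, and it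
identifies the manifold `G_F \ G` with the orbit. -/
def orbitMap (F : CoAlg n G) (x : G) : Orbit F := ⟨coadj x⁻¹ F, x⁻¹, rfl⟩

theorem orbitMap_apply (F : CoAlg n G) (x : G) (X : LieAlg n G) :
    (orbitMap F x).1 X = F (Ad x X) := by
  change F (Ad x⁻¹⁻¹ X) = _
  rw [inv_inv]

variable [LieGroup (𝓡 n) ∞ G]

theorem contMDiff_conj (x : G) : ContMDiff (𝓡 n) (𝓡 n) ∞ (fun y : G => x * y * x⁻¹) :=
  (contMDiff_const.mul contMDiff_id).mul contMDiff_const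

theorem Ad_mul (x y : G) : (Ad (x * y) : LieAlg n G →ₗ[ℝ] LieAlg n G) = Ad x ∘ₗ Ad y := by
  have h : (fun z : G => (x * y) * z * (x * y)⁻¹) =
      (fun z : G => x * z * x⁻¹) ∘ (fun z : G => y * z * y⁻¹) := by
    ext z; simp [mul_assoc]
  have hd : ∀ (a z : G), MDifferentiableAt (𝓡 n) (𝓡 n) (fun y : G => a * y * a⁻¹) z :=
    fun a z => (contMDiff_conj a).mdifferentiableAt (by simp)
  have hc := mfderiv_comp (I := 𝓡 n) (I' := 𝓡 n) (I'' := 𝓡 n) (1 : G)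
    (hd x (y * 1 * y⁻¹)) (hd y 1)
  have h1 : y * 1 * y⁻¹ = 1 := by simp
  ext1 v
  have hv := congrArg (fun L => L v) hc
  have h2 : mfderiv (𝓡 n) (𝓡 n) (fun z : G => x * z * x⁻¹) (y * 1 * y⁻¹) =
      (mfderiv (𝓡 n) (𝓡 n) (fun z : G => x * z * x⁻¹) 1 :
        EuclideanSpace ℝ (Fin n) →L[ℝ] EuclideanSpace ℝ (Fin n)) := by rw [h1]
  unfold Ad
  rw [h]
  refine hv.trans ?_
  exact congrArg (fun L : EuclideanSpace ℝ (Fin n) →L[ℝ] EuclideanSpace ℝ (Fin n) =>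
    L ((mfderiv (𝓡 n) (𝓡 n) (fun z : G => y * z * y⁻¹) 1 :
      EuclideanSpace ℝ (Fin n) →L[ℝ] EuclideanSpace ℝ (Fin n)) v)) h2

theorem coadj_mul (g k : G) (y : CoAlg n G) : coadj (g * k) y = coadj g (coadj k y) := by
  unfold coadj; rw [mul_inv_rev, Ad_mul]; rfl

/-- The stabilizer `G_F` of `F` for the coadjoint action. -/
def stab (F : CoAlg n G) : Subgroup G where
  carrier := {g | coadj g F = F}
  one_mem' := coadj_one F
  mul_mem' := by
    intro a b ha hb
    change coadj (a * b) F = F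
    rw [coadj_mul]
    exact (congrArg (coadj a) hb).trans ha
  inv_mem' := by
    intro a ha
    change coadj a⁻¹ F = F
    have h : coadj a⁻¹ (coadj a F) = coadj a⁻¹ F := congrArg (coadj a⁻¹) ha
    rw [← coadj_mul, inv_mul_cancel, coadj_one] at h
    exact h.symm

/-- `y ↦ F (Ad(x) X)` depends smoothly on `x`. -/
theorem contMDiff_Ad_apply (F : CoAlg n G) (X : LieAlg n G) :
    ContMDiff (𝓡 n) 𝓘(ℝ, ℝ) ∞ (fun x : G => F (Ad x X)) := by
  intro x₀
  have hf : ContMDiff ((𝓡 n).prod (𝓡 n)) (𝓡 n) ∞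
      (Function.uncurry (fun x y : G => x * y * x⁻¹)) := by
    change ContMDiff _ _ _ (fun p : G × G => p.1 * p.2 * p.1⁻¹)
    exact (contMDiff_fst.mul contMDiff_snd).mul contMDiff_fst.inv
  have key := ContMDiffAt.mfderiv (m := ∞) (n := ∞) (I := 𝓡 n) (I' := 𝓡 n) (J := 𝓡 n)
    (x₀ := x₀) (fun x y : G => x * y * x⁻¹) (fun _ => (1 : G)) hf.contMDiffAt
    contMDiffAt_const (by simp)
  have h1 : (fun x : G => x * 1 * x⁻¹) = fun _ => 1 := by funext x; simp
  rw [h1] at key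
  have hA : ∀ ϕ : G → EuclideanSpace ℝ (Fin n) →L[ℝ] EuclideanSpace ℝ (Fin n),
      inTangentCoordinates (𝓡 n) (𝓡 n) (fun _ : G => (1 : G)) (fun _ => (1 : G)) ϕ x₀ = ϕ := by
    intro ϕ
    funext x
    rw [inTangentCoordinates_eq (I := 𝓡 n) (I' := 𝓡 n) (M := G) (M' := G) _ _ ϕ
      (mem_chart_source (EuclideanSpace ℝ (Fin n)) (1 : G))
      (mem_chart_source (EuclideanSpace ℝ (Fin n)) (1 : G))]
    ext1 v
    have h := (tangentBundleCore (𝓡 n) G).coordChange_self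
      (achart (EuclideanSpace ℝ (Fin n)) (1 : G)) 1
      (mem_chart_source (EuclideanSpace ℝ (Fin n)) (1 : G))
    exact (h _).trans (congrArg (ϕ x) (h v))
  let A : G → EuclideanSpace ℝ (Fin n) →L[ℝ] EuclideanSpace ℝ (Fin n) :=
    fun x => mfderiv (𝓡 n) (𝓡 n) (fun y : G => x * y * x⁻¹) 1
  have key2 : ContMDiffAt (𝓡 n) 𝓘(ℝ, EuclideanSpace ℝ (Fin n) →L[ℝ] EuclideanSpace ℝ (Fin n)) ∞
      A x₀ := (hA A) ▸ key
  let F' : EuclideanSpace ℝ (Fin n) →ₗ[ℝ] ℝ := F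
  let L : (EuclideanSpace ℝ (Fin n) →L[ℝ] EuclideanSpace ℝ (Fin n)) →L[ℝ] ℝ :=
    (LinearMap.toContinuousLinearMap F').comp
      (ContinuousLinearMap.apply ℝ (EuclideanSpace ℝ (Fin n)) (X : EuclideanSpace ℝ (Fin n)))
  exact L.contMDiff.contMDiffAt.comp x₀ key2


/-- The action of `G` on the orbit. -/
def Orbit.act {F : CoAlg n G} (g : G) (y : Orbit F) : Orbit F :=
  ⟨coadj g y.1, by
    obtain ⟨k, hk⟩ := y.2
    exact ⟨g * k, by rw [coadj_mul, hk]⟩⟩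

theorem orbitMap_mul_left (F : CoAlg n G) {k : G} (hk : k ∈ stab F) (x : G) :
    orbitMap F (k * x) = orbitMap F x := by
  apply Subtype.ext
  change coadj (k * x)⁻¹ F = coadj x⁻¹ F
  rw [mul_inv_rev, coadj_mul]
  exact congrArg _ ((stab F).inv_mem hk)

/-- The algebra `C^∞(Ω_F)`: functions on the orbit that are smooth for the quotient manifold
structure of `G_F \ G`, i.e. whose pullback to `G` is smooth. -/
def smoothFn (F : CoAlg n G) : Subalgebra ℝ (Orbit F → ℝ) where
  carrier := {u | ContMDiff (𝓡 n) 𝓘(ℝ, ℝ) ∞ (fun x : G => u (orbitMap F x))}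
  mul_mem' := fun ha hb => ContMDiff.mul ha hb
  add_mem' := fun ha hb => ContMDiff.add ha hb
  algebraMap_mem' := fun _ => contMDiff_const

/-- The map `X ↦ y ∘ ad X`; its value is the velocity at `t = 0` of `t ↦ K(exp (-t X)) y`. -/
def adStar (y : CoAlg n G) : LieAlg n G →ₗ[ℝ] CoAlg n G where
  toFun X := y ∘ₗ (LieAlgebra.ad ℝ (LieAlg n G) X : LieAlg n G →ₗ[ℝ] LieAlg n G)
  map_add' X Y := by ext Z; simp
  map_smul' c X := by ext Z; simp

/-- The tangent space `T_y Ω ⊆ 𝔤*` of the orbit. -/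
def tangent (y : CoAlg n G) : Submodule ℝ (CoAlg n G) := LinearMap.range (adStar y)

/-- Some `Z` in `𝔤` that induces the tangent vector `η` at `y`. -/
def tangentLift (y η : CoAlg n G) : LieAlg n G := Classical.epsilon fun Z => adStar y Z = η

/-- The smooth vector fields on the orbit. -/
def vecField (F : CoAlg n G) : Submodule ℝ (Orbit F → CoAlg n G) where
  carrier := {ξ | (∀ y, ξ y ∈ tangent y.1) ∧ ∀ Z : LieAlg n G, (fun y => ξ y Z) ∈ smoothFn F}
  add_mem' ha hb := ⟨fun y => (tangent y.1).add_mem (ha.1 y) (hb.1 y),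
    fun Z => (smoothFn F).add_mem (ha.2 Z) (hb.2 Z)⟩
  zero_mem' := ⟨fun y => (tangent y.1).zero_mem, fun _ => (smoothFn F).zero_mem⟩
  smul_mem' c _ ha := ⟨fun y => (tangent y.1).smul_mem c (ha.1 y),
    fun Z => (smoothFn F).smul_mem (ha.2 Z) c⟩

/-- The product of a smooth function and a vector field. -/
def mulField {F : CoAlg n G} (u : smoothFn F) (ξ : vecField F) : vecField F :=
  ⟨fun y => u.1 y • ξ.1 y, fun y => (tangent y.1).smul_mem _ (ξ.2.1 y),
    fun Z => (smoothFn F).mul_mem u.2 (ξ.2.2 Z)⟩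

/-- The differential `(du)_y (η)` for a tangent vector `η` at `y`. -/
def dOrbit {F : CoAlg n G} (u : Orbit F → ℝ) (y : Orbit F) (η : CoAlg n G) : ℝ :=
  (mfderiv (𝓡 n) 𝓘(ℝ, ℝ) (fun g : G => u (y.act g⁻¹)) 1 : LieAlg n G → ℝ) (tangentLift y.1 η)

/-- The derivative `ξ u` of a function along a vector field. -/
def derivAlong {F : CoAlg n G} (ξ : vecField F) (u : Orbit F → ℝ) (y : Orbit F) : ℝ :=
  dOrbit u y (ξ.1 y)

/-- `ζ = [ξ, η]`, the commutator of derivations of `C^∞(Ω)`. -/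
def IsFieldBracket {F : CoAlg n G} (ξ η ζ : vecField F) : Prop :=
  ∀ u ∈ smoothFn F, ∀ y, derivAlong ζ u y =
    derivAlong ξ (derivAlong η u) y - derivAlong η (derivAlong ξ u) y

/-- The vector field `ξ_X` of the one-parameter group `exp (t X)`: it differentiates functions by
`(ξ_X u)(y) = d/dt u(K(exp (-t X)) y)` at `t = 0`. -/
def fundField (F : CoAlg n G) (X : LieAlg n G) : vecField F :=
  ⟨fun y => adStar y.1 X, fun y => ⟨X, rfl⟩, fun Z => by
    change ContMDiff _ _ _ (fun x : G => (orbitMap F x).1 ⁅X, Z⁆)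
    simp only [orbitMap_apply]
    exact contMDiff_Ad_apply F _⟩

/-- The symplectic form of the orbit, `h` times the Kirillov form:
`ω_y (ξ_X, ξ_Y) = h ⟨y, [X, Y]⟩`. -/
def omega {F : CoAlg n G} (h : ℝ) (y : Orbit F) (a b : CoAlg n G) : ℝ :=
  h * y.1 ⁅tangentLift y.1 a, tangentLift y.1 b⁆

/-- The function `f_X (y) = h ⟨y, X⟩` on the orbit. -/
def momentFn (F : CoAlg n G) (h : ℝ) (X : LieAlg n G) : smoothFn F :=
  ⟨fun y => h * y.1 X, by
    change ContMDiff _ _ _ (fun x : G => h * (orbitMap F x).1 X)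
    simp only [orbitMap_apply]
    exact contMDiff_const.mul (contMDiff_Ad_apply F X)⟩

/-- `ξ` is the Hamiltonian field of `u`: `i(ξ) ω + du = 0`. -/
def IsHamiltonianField {F : CoAlg n G} (h : ℝ) (u : Orbit F → ℝ) (ξ : vecField F) : Prop :=
  ∀ y, ∀ η ∈ tangent y.1, omega h y (ξ.1 y) η + dOrbit u y η = 0

/-- The Hamiltonian vector field `ξ_u`. -/
def hamField {F : CoAlg n G} (h : ℝ) (u : Orbit F → ℝ) : vecField F :=
  Classical.epsilon fun ξ => IsHamiltonianField h u ξ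

/-- The Poisson bracket `{u, v} = ξ_u v`. -/
def poisson {F : CoAlg n G} (h : ℝ) (u v : Orbit F → ℝ) : Orbit F → ℝ :=
  derivAlong (hamField h u) v

/-- `ħ = h / 2π`. -/
def hbar (h : ℝ) : ℝ := h / (2 * Real.pi)

/-! ### The bundle `G ×_{G_F} V`, connections and quantized operators -/

variable {V : Type v} [NormedAddCommGroup V] [InnerProductSpace ℂ V]

/-- The smooth sections of the bundle over `Ω_F` associated with a representation `τ` of `G_F`,
as the equivariant smooth functions on `G`. -/
def sections (F : CoAlg n G) (τ : stab F →* (V ≃ₗᵢ[ℂ] V)) : Submodule ℂ (G → V) where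
  carrier := {φ | ContMDiff (𝓡 n) 𝓘(ℝ, V) ∞ φ ∧ ∀ (k : stab F) (x : G), φ (k * x) = τ k (φ x)}
  add_mem' ha hb := ⟨ha.1.add hb.1, fun k x => by simp [ha.2 k x, hb.2 k x]⟩
  zero_mem' := ⟨contMDiff_const, fun k x => by simp⟩
  smul_mem' c φ ha :=
    ⟨((c • ContinuousLinearMap.id ℝ V : V →L[ℝ] V)).contMDiff.comp ha.1,
      fun k x => by simp [ha.2 k x]⟩

/-- Multiplication of sections by a smooth function on the orbit. -/
def mulSec {F : CoAlg n G} (τ : stab F →* (V ≃ₗᵢ[ℂ] V)) (u : smoothFn F) :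
    sections F τ →ₗ[ℂ] sections F τ where
  toFun φ := ⟨fun x => (u.1 (orbitMap F x) : ℂ) • φ.1 x, by
    refine ⟨?_, fun k x => ?_⟩
    · have hu : ContMDiff (𝓡 n) 𝓘(ℝ, ℝ) ∞ (fun x : G => u.1 (orbitMap F x)) := u.2
      refine (hu.smul φ.2.1).congr fun x => ?_
      exact (RCLike.real_smul_eq_coe_smul (K := ℂ) (u.1 (orbitMap F x)) (φ.1 x)).symm
    · change (u.1 (orbitMap F (k * x)) : ℂ) • φ.1 (k * x) = _
      rw [orbitMap_mul_left F k.2, φ.2.2 k x]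
      exact (map_smul (τ k) _ _).symm⟩
  map_add' a b := by ext x; simp
  map_smul' c a := by ext x; simp [smul_comm c]

/-- An affine connection (covariant derivative) on the bundle. -/
structure Connection (F : CoAlg n G) (τ : stab F →* (V ≃ₗᵢ[ℂ] V)) where
  cov : vecField F → sections F τ →ₗ[ℂ] sections F τ
  cov_add : ∀ ξ η φ, cov (ξ + η) φ = cov ξ φ + cov η φ
  cov_mul : ∀ (u : smoothFn F) ξ φ, cov (mulField u ξ) φ = mulSec τ u (cov ξ φ)
  leibniz : ∀ (u : smoothFn F) ξ (φ : sections F τ) (x : G),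
    (cov ξ (mulSec τ u φ)).1 x =
      (derivAlong ξ u.1 (orbitMap F x) : ℂ) • φ.1 x + (u.1 (orbitMap F x) : ℂ) • (cov ξ φ).1 x

/-- The connection preserves the Hilbert structure of the fibres:
`ξ ⟨φ, ψ⟩ = ⟨∇_ξ φ, ψ⟩ + ⟨φ, ∇_ξ ψ⟩`. -/
def Connection.IsHermitian {F : CoAlg n G} {τ : stab F →* (V ≃ₗᵢ[ℂ] V)}
    (C : Connection F τ) : Prop :=
  ∀ (ξ : vecField F) (φ ψ : sections F τ) (x : G) (Z : LieAlg n G),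
    ξ.1 (orbitMap F x) = adStar (orbitMap F x).1 Z →
    (mfderiv (𝓡 n) 𝓘(ℝ, ℂ) (fun g : G => inner ℂ (φ.1 (x * g)) (ψ.1 (x * g))) 1 :
        LieAlg n G → ℂ) Z =
      inner ℂ ((C.cov ξ φ).1 x) (ψ.1 x) + inner ℂ (φ.1 x) ((C.cov ξ ψ).1 x)

/-- The curvature of the connection is `-(i/ħ) ω ⊗ Id`. -/
def Connection.HasCurvature {F : CoAlg n G} {τ : stab F →* (V ≃ₗᵢ[ℂ] V)} (h : ℝ)
    (C : Connection F τ) : Prop :=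
  ∀ ξ η ζ : vecField F, IsFieldBracket ξ η ζ → ∀ (φ : sections F τ) (x : G),
    (C.cov ξ (C.cov η φ)).1 x - (C.cov η (C.cov ξ φ)).1 x - (C.cov ζ φ).1 x =
      (-(Complex.I / hbar h) *
        omega h (orbitMap F x) (ξ.1 (orbitMap F x)) (η.1 (orbitMap F x))) • φ.1 x

/-- The geometrically quantized operator `Q(u) = u + (ħ/i) ∇_{ξ_u}`. -/
def Connection.Q {F : CoAlg n G} {τ : stab F →* (V ≃ₗᵢ[ℂ] V)} (C : Connection F τ) (h : ℝ)
    (u : smoothFn F) : sections F τ →ₗ[ℂ] sections F τ :=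
  mulSec τ u + ((hbar h : ℂ) / Complex.I) • C.cov (hamField h u.1)

/-- `u ↦ Q(u)` is linear and satisfies the quantization rules
`Q(1) = Id` and `Q({u, v}) = (i/ħ) [Q(u), Q(v)]`. -/
def Connection.IsQuantization {F : CoAlg n G} {τ : stab F →* (V ≃ₗᵢ[ℂ] V)} (C : Connection F τ)
    (h : ℝ) : Prop :=
  (∀ u v, C.Q h (u + v) = C.Q h u + C.Q h v) ∧
  (∀ (c : ℝ) u, C.Q h (c • u) = (c : ℂ) • C.Q h u) ∧ C.Q h 1 = LinearMap.id ∧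
  ∀ u v w : smoothFn F, w.1 = poisson h u.1 v.1 →
    C.Q h w = (Complex.I / hbar h) • (C.Q h u ∘ₗ C.Q h v - C.Q h v ∘ₗ C.Q h u)

/-! ### Unitary representations and polarizations -/

/-- Irreducibility of a unitary representation. -/
def IsIrreducibleRep {K : Type*} [Group K] (τ : K →* (V ≃ₗᵢ[ℂ] V)) : Prop :=
  Nontrivial V ∧ ∀ S : Submodule ℂ V, IsClosed (S : Set V) → (∀ k, ∀ v ∈ S, τ k v ∈ S) →
    S = ⊥ ∨ S = ⊤

/-- `τ` is unitarily equivalent to a multiple (a Hilbert sum of copies) of `χ · σ`. -/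
def IsMultipleOf {K : Type*} [Group K] {W : Type w} [NormedAddCommGroup W] [InnerProductSpace ℂ W]
    (τ : K →* (V ≃ₗᵢ[ℂ] V)) (χ : K →* Circle) (σ : K →* (W ≃ₗᵢ[ℂ] W)) : Prop :=
  ∃ (ι : Type v) (U : V ≃ₗᵢ[ℂ] lp (fun _ : ι => W) 2),
    ∀ k v i, U (τ k v) i = (χ k : ℂ) • σ k (U v i)

/-- `χ` is a unitary character of `G_F` with `χ (exp X) = exp (2πi ⟨F, X⟩)` on `𝔤_F`. -/
def IsOrbitCharacter (F : CoAlg n G) (χ : stab F →* Circle) : Prop :=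
  Continuous χ ∧ ∀ (X : LieAlg n G) (γ : ℝ → G), IsOneParam γ X → ∀ hγ : ∀ t, γ t ∈ stab F,
    ∀ t, χ ⟨γ t, hγ t⟩ = Circle.exp (2 * Real.pi * (t * F X))

/-- A strongly continuous unitary representation of `G_F` that is trivial on the identity
component. -/
def IsTypicalRep (F : CoAlg n G) {W : Type w} [NormedAddCommGroup W] [InnerProductSpace ℂ W]
    (σ : stab F →* (W ≃ₗᵢ[ℂ] W)) : Prop :=
  (∀ w, Continuous fun k => σ k w) ∧ ∀ k ∈ connectedComponent (1 : stab F), σ k = 1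

/-- Complex conjugation of `𝔤_ℂ`. -/
def conjC : LieAlgC n G →ₗ[ℝ] LieAlgC n G :=
  TensorProduct.map Complex.conjAe.toLinearMap LinearMap.id

/-- The real points `S ∩ 𝔤` of a real subspace `S` of `𝔤_ℂ`. -/
def realPoints (S : Submodule ℝ (LieAlgC n G)) : Submodule ℝ (LieAlg n G) :=
  S.comap (TensorProduct.mk ℝ ℂ (LieAlg n G) 1)

/-- `𝔥 = 𝔭 ∩ 𝔤`. -/
def hReal (p : LieSubalgebra ℂ (LieAlgC n G)) : Submodule ℝ (LieAlg n G) :=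
  realPoints (p.toSubmodule.restrictScalars ℝ)

/-- `𝔭 + 𝔭̄`. -/
def pSum (p : LieSubalgebra ℂ (LieAlgC n G)) : Submodule ℝ (LieAlgC n G) :=
  p.toSubmodule.restrictScalars ℝ ⊔ (p.toSubmodule.restrictScalars ℝ).map conjC

/-- `𝔪 = (𝔭 + 𝔭̄) ∩ 𝔤`. -/
def mReal (p : LieSubalgebra ℂ (LieAlgC n G)) : Submodule ℝ (LieAlg n G) := realPoints (pSum p)

/-- The real element `1 ⊗ X` of `𝔭`, for `X` in `𝔥`. -/
def hToP (p : LieSubalgebra ℂ (LieAlgC n G)) (X : hReal p) : p :=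
  ⟨(1 : ℂ) ⊗ₜ[ℝ] (X : LieAlg n G), X.2⟩

/-- The Nelson Laplacian `∑ ρ(b_j)²` on the domain `D`. -/
def nelsonLaplacian (p : LieSubalgebra ℂ (LieAlgC n G)) {D : Submodule ℂ V}
    (ρ : p →ₗ[ℂ] Module.End ℂ D) {ι : Type} [Fintype ι] (b : Module.Basis ι ℝ (hReal p)) :
    V →ₗ.[ℂ] V where
  domain := D
  toFun := D.subtype ∘ₗ ∑ j, ρ (hToP p (b j)) * ρ (hToP p (b j))

/-- A `(σ, F)`-polarization `(𝔭, ρ, σ₀)`. The representation `ρ` of `𝔭` acts on a common dense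
invariant domain `D` of the Hilbert space `V`. -/
structure Polarization (F : CoAlg n G) (χ : stab F →* Circle) {W : Type w}
    [NormedAddCommGroup W] [InnerProductSpace ℂ W] (σ : stab F →* (W ≃ₗᵢ[ℂ] W))
    (V : Type v) [NormedAddCommGroup V] [InnerProductSpace ℂ V] [CompleteSpace V] where
  /-- a) a complex subalgebra containing `𝔤_F` -/
  p : LieSubalgebra ℂ (LieAlgC n G)
  contains : ∀ X ∈ lieAlgOf n (stab F), (1 : ℂ) ⊗ₜ[ℝ] X ∈ p
  /-- b) invariant under `Ad G_F` -/
  ad_mem : ∀ x ∈ stab F, ∀ Z ∈ p, (Ad x).baseChange ℂ Z ∈ p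
  /-- c) `𝔭 + 𝔭̄` is the complexification of a real subalgebra -/
  m_lie : ∀ X ∈ mReal p, ∀ Y ∈ mReal p, ⁅X, Y⁆ ∈ mReal p
  m_span : (Submodule.span ℂ ((fun X : LieAlg n G => (1 : ℂ) ⊗ₜ[ℝ] X) '' mReal p)).restrictScalars ℝ
    = pSum p
  /-- d) the groups `M₀`, `H₀`, `M = G_F M₀`, `H = G_F H₀` are closed -/
  closed_M0 : IsClosed (analyticSubgroup (mReal p) : Set G)
  closed_H0 : IsClosed (analyticSubgroup (hReal p) : Set G)
  closed_M : IsClosed ((stab F ⊔ analyticSubgroup (mReal p) : Subgroup G) : Set G)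
  closed_H : IsClosed ((stab F ⊔ analyticSubgroup (hReal p) : Subgroup G) : Set G)
  /-- e) an irreducible unitary representation of `H₀` -/
  σ₀ : analyticSubgroup (hReal p) →* (V ≃ₗᵢ[ℂ] V)
  σ₀_cont : ∀ v, Continuous fun k => σ₀ k v
  σ₀_irred : IsIrreducibleRep σ₀
  σ₀_multiple : IsMultipleOf
    (σ₀.comp (Subgroup.inclusion
      (inf_le_right : stab F ⊓ analyticSubgroup (hReal p) ≤ analyticSubgroup (hReal p))))
    (χ.comp (Subgroup.inclusion
      (inf_le_left : stab F ⊓ analyticSubgroup (hReal p) ≤ stab F)))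
    (σ.comp (Subgroup.inclusion
      (inf_le_left : stab F ⊓ analyticSubgroup (hReal p) ≤ stab F)))
  σ₀_fixed : ∀ g ∈ stab F, ∃ U : V ≃ₗᵢ[ℂ] V, ∀ k k' : analyticSubgroup (hReal p),
    (k' : G) = g * k * g⁻¹ → ∀ v, U (σ₀ k v) = σ₀ k' (U v)
  /-- f) a representation of `𝔭` that integrates to `σ₀` on `𝔥`, with Nelson's condition -/
  D : Submodule ℂ V
  D_dense : Dense (D : Set V)
  ρ : p →ₗ[ℂ] Module.End ℂ D
  ρ_lie : ∀ Z Z', ρ ⁅Z, Z'⁆ = ρ Z * ρ Z' - ρ Z' * ρ Z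
  nelson : ∃ (ι : Type) (_ : Fintype ι) (b : Module.Basis ι ℝ (hReal p)),
    IsSelfAdjoint (nelsonLaplacian p ρ b).closure
  ρ_eq : ∀ (X : hReal p) (γ : ℝ → G) (hγ : IsOneParam γ (X : LieAlg n G)) (v : D),
    HasDerivAt (fun t => σ₀ ⟨γ t, hγ.mem_analyticSubgroup X.2 t⟩ (v : V))
      (ρ (hToP p X) v : V) 0

section Ind

variable {F : CoAlg n G} {χ : stab F →* Circle} {W : Type w}
  [NormedAddCommGroup W] [InnerProductSpace ℂ W] {σt : stab F →* (W ≃ₗᵢ[ℂ] W)} [CompleteSpace V]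

/-- `H₀`, the connected subgroup with Lie algebra `𝔥`. -/
abbrev Polarization.H₀ (P : Polarization F χ σt V) : Subgroup G := analyticSubgroup (hReal P.p)

/-- `H = G_F H₀`. -/
abbrev Polarization.H (P : Polarization F χ σt V) : Subgroup G := stab F ⊔ P.H₀

/-- The irreducible unitary representation `σ` of `H` that extends `σ₀` and is a multiple of
`χ · σt` on `G_F`. -/
structure Extension (P : Polarization F χ σt V) where
  rep : P.H →* (V ≃ₗᵢ[ℂ] V)
  cont : ∀ v, Continuous fun k => rep k v
  irred : IsIrreducibleRep rep
  extends_σ₀ : ∀ k : P.H₀, rep (Subgroup.inclusion le_sup_right k) = P.σ₀ k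
  multiple : IsMultipleOf
    (rep.comp (Subgroup.inclusion (le_sup_left : stab F ≤ P.H))) χ σt

variable {P : Polarization F χ σt V}

/-- `σ` restricted to `G_F`. -/
def Extension.onStab (σ : Extension P) : stab F →* (V ≃ₗᵢ[ℂ] V) :=
  σ.rep.comp (Subgroup.inclusion (le_sup_left : stab F ≤ P.H))

/-- The Lie derivative `(L_X φ)(x) = d/dt φ (exp (-t X) x)` at `t = 0`. -/
def lieLeft (φ : G → V) (x : G) : LieAlg n G →ₗ[ℝ] V :=
  -((mfderiv (𝓡 n) 𝓘(ℝ, V) (fun y : G => φ (y * x)) 1 :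
    EuclideanSpace ℝ (Fin n) →L[ℝ] V).toLinearMap)

/-- The complex linear extension of `X ↦ L_X φ` to `𝔤_ℂ`. -/
def lieLeftC (φ : G → V) (x : G) : LieAlgC n G →ₗ[ℂ] V := (lieLeft φ x).liftBaseChange ℂ

theorem mdiff_right {φ : G → V} (hφ : ContMDiff (𝓡 n) 𝓘(ℝ, V) ∞ φ) (x : G) :
    MDifferentiableAt (𝓡 n) 𝓘(ℝ, V) (fun y : G => φ (y * x)) 1 :=
  (hφ.comp (contMDiff_id.mul contMDiff_const)).mdifferentiableAt (by simp)

theorem lieLeft_add {φ ψ : G → V} (hφ : ContMDiff (𝓡 n) 𝓘(ℝ, V) ∞ φ)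
    (hψ : ContMDiff (𝓡 n) 𝓘(ℝ, V) ∞ ψ) (x : G) :
    lieLeft (n := n) (φ + ψ) x = lieLeft φ x + lieLeft ψ x := by
  have h := mfderiv_add (mdiff_right hφ x) (mdiff_right hψ x)
  ext X
  have h2 := congrArg (fun L : EuclideanSpace ℝ (Fin n) →L[ℝ] V => -(L X)) h
  exact h2.trans (neg_add _ _)

theorem lieLeft_smul (c : ℂ) {φ : G → V} (hφ : ContMDiff (𝓡 n) 𝓘(ℝ, V) ∞ φ) (x : G)
    (X : LieAlg n G) : lieLeft (c • φ) x X = c • lieLeft φ x X := by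
  let L : V →L[ℝ] V := c • ContinuousLinearMap.id ℝ V
  have h := mfderiv_comp (I := 𝓡 n) (I' := 𝓘(ℝ, V)) (I'' := 𝓘(ℝ, V)) (1 : G)
    (L.contMDiff.mdifferentiableAt (n := ∞) (by simp)) (mdiff_right hφ x)
  rw [L.mfderiv_eq] at h
  have h2 := congrArg (fun L : EuclideanSpace ℝ (Fin n) →L[ℝ] V => -(L X)) h
  exact h2.trans (smul_neg _ _).symm

theorem lieLeftC_add {φ ψ : G → V} (hφ : ContMDiff (𝓡 n) 𝓘(ℝ, V) ∞ φ)
    (hψ : ContMDiff (𝓡 n) 𝓘(ℝ, V) ∞ ψ) (x : G) (Z : LieAlgC n G) :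
    lieLeftC (φ + ψ) x Z = lieLeftC φ x Z + lieLeftC ψ x Z := by
  unfold lieLeftC
  rw [lieLeft_add hφ hψ]
  induction Z using TensorProduct.induction_on with
  | zero => simp
  | tmul z X => simp
  | add a b ha hb => rw [map_add, map_add, map_add, ha, hb]; abel

theorem lieLeftC_smul (c : ℂ) {φ : G → V} (hφ : ContMDiff (𝓡 n) 𝓘(ℝ, V) ∞ φ) (x : G)
    (Z : LieAlgC n G) : lieLeftC (c • φ) x Z = c • lieLeftC φ x Z := by
  unfold lieLeftC
  induction Z using TensorProduct.induction_on with
  | zero => simp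
  | tmul z X => simp [lieLeft_smul c hφ, smul_comm c]
  | add a b ha hb => rw [map_add, map_add, ha, hb, smul_add]

theorem contMDiff_smul_section (c : ℂ) {φ : G → V} (hφ : ContMDiff (𝓡 n) 𝓘(ℝ, V) ∞ φ) :
    ContMDiff (𝓡 n) 𝓘(ℝ, V) ∞ (c • φ) :=
  ((c • ContinuousLinearMap.id ℝ V : V →L[ℝ] V)).contMDiff.comp hφ

theorem lieLeft_comp_mul_right (φ : G → V) (g x : G) :
    lieLeft (n := n) (fun z => φ (z * g)) x = lieLeft φ (x * g) := by
  have h : (fun y : G => φ (y * x * g)) = fun y => φ (y * (x * g)) := by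
    funext y; rw [mul_assoc]
  let B : (G → V) → EuclideanSpace ℝ (Fin n) →L[ℝ] V := fun f => mfderiv (𝓡 n) 𝓘(ℝ, V) f 1
  exact congrArg (fun f : G → V => -(B f).toLinearMap) h

/-- The space `C^∞(G; 𝔭, ρ, F, σ₀)` of smooth functions `φ : G → V` with `φ(kx) = σ(k) φ(x)` for
`k` in `H` and `L_Z φ + ρ(Z) φ = 0` for `Z` in `𝔭̄`. Here `ρ` is extended from `𝔭` to `𝔭̄` by
`ρ(Z̄) = -ρ(Z)^*`, so that the equation reads `⟨v, L_{Z̄} φ⟩ = ⟨ρ(Z) v, φ⟩` for `Z` in `𝔭` and `v`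
in the domain of `ρ`. -/
def indSpace (σ : Extension P) : Submodule ℂ (G → V) where
  carrier := {φ | ContMDiff (𝓡 n) 𝓘(ℝ, V) ∞ φ ∧
    (∀ (k : P.H) (x : G), φ (k * x) = σ.rep k (φ x)) ∧
    ∀ (Z : P.p) (v : P.D) (x : G),
      inner ℂ (v : V) (lieLeftC φ x (conjC (Z : LieAlgC n G))) = inner ℂ (P.ρ Z v : V) (φ x)}
  add_mem' ha hb := ⟨ha.1.add hb.1, fun k x => by simp [ha.2.1 k x, hb.2.1 k x],
    fun Z v x => by
      rw [lieLeftC_add ha.1 hb.1, inner_add_right, ha.2.2 Z v x, hb.2.2 Z v x, Pi.add_apply,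
        inner_add_right]⟩
  zero_mem' := ⟨contMDiff_const, fun k x => by simp, fun Z v x => by
    have h := lieLeftC_smul (0 : ℂ) (φ := (0 : G → V)) contMDiff_const x
      (conjC (Z : LieAlgC n G))
    rw [zero_smul, zero_smul] at h
    rw [h]; simp⟩
  smul_mem' c _ ha := ⟨contMDiff_smul_section c ha.1, fun k x => by simp [ha.2.1 k x],
    fun Z v x => by
      rw [lieLeftC_smul c ha.1, inner_smul_right, ha.2.2 Z v x, Pi.smul_apply, inner_smul_right]⟩

/-- The representation `Ind(G; 𝔭, F, ρ, σ₀)` of `G` by right translations. -/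
def Ind (σ : Extension P) : Representation ℂ G (indSpace σ) where
  toFun g :=
    { toFun := fun φ => ⟨fun x => φ.1 (x * g),
        φ.2.1.comp (contMDiff_id.mul contMDiff_const),
        fun k x => by
          change φ.1 (k * x * g) = _
          rw [mul_assoc]
          exact φ.2.2.1 k (x * g),
        fun Z v x => by
          have h : lieLeftC (fun x => φ.1 (x * g)) x = lieLeftC (n := n) φ.1 (x * g) := by
            unfold lieLeftC
            rw [lieLeft_comp_mul_right]
          rw [h]
          exact φ.2.2.2 Z v (x * g)⟩
      map_add' := fun _ _ => rfl
      map_smul' := fun _ _ => rfl }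
  map_one' := by ext φ x; simp
  map_mul' a b := by ext φ x; simp [mul_assoc]

/-- An element of the induced space is a section of the bundle over the orbit. -/
def indToSections (σ : Extension P) : indSpace σ →ₗ[ℂ] sections F σ.onStab where
  toFun φ := ⟨φ.1, φ.2.1, fun k x => φ.2.2.1 (Subgroup.inclusion le_sup_left k) x⟩
  map_add' _ _ := rfl
  map_smul' _ _ := rfl

/-! ### The Hilbert norm of the induced space -/

/-- The homogeneous space `K \ G` of cosets `K x`. -/
def CosetSpace (K : Subgroup G) : Type u := Quotient (QuotientGroup.rightRel K)

instance (K : Subgroup G) : TopologicalSpace (CosetSpace K) :=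
  inferInstanceAs (TopologicalSpace (Quotient (QuotientGroup.rightRel K)))

instance (K : Subgroup G) : MeasurableSpace (CosetSpace K) := borel _

instance (K : Subgroup G) : BorelSpace (CosetSpace K) := ⟨rfl⟩

/-- The right action `K x ↦ K x g`. -/
def CosetSpace.mulRight (K : Subgroup G) (g : G) : CosetSpace K → CosetSpace K :=
  Quotient.map (fun x => x * g) fun a b hab => by
    have h := QuotientGroup.rightRel_apply.1 hab
    refine QuotientGroup.rightRel_apply.2 ?_
    simpa [mul_assoc] using h

/-- The function `‖φ‖²` of an element of the induced space, as a function on `K \ G` for a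
subgroup `K` of `H`. -/
def fibreNormSq (σ : Extension P) {K : Subgroup G} (hK : K ≤ P.H) (φ : indSpace σ) :
    CosetSpace K → ENNReal :=
  Quotient.lift (fun x => ‖φ.1 x‖ₑ ^ 2) fun a b hab => by
    have h : b * a⁻¹ ∈ K := QuotientGroup.rightRel_apply.1 hab
    have h2 := φ.2.2.1 ⟨b * a⁻¹, hK h⟩ a
    simp only [inv_mul_cancel_right] at h2
    rw [h2]
    simp only [← ofReal_norm, LinearIsometryEquiv.norm_map]

/-- The square of the norm of `φ` in `L²(K \ G, ν)`. -/
def l2Sq (σ : Extension P) {K : Subgroup G} (hK : K ≤ P.H)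
    (ν : MeasureTheory.Measure (CosetSpace K)) (φ : indSpace σ) : ENNReal :=
  ∫⁻ q, fibreNormSq σ hK φ q ∂ν

/-- The difference quotient `(Ind(γ(t)) φ - φ) / t`. -/
def diffQuot (σ : Extension P) (γ : ℝ → G) (t : ℝ) (φ : indSpace σ) : indSpace σ :=
  ((t⁻¹ : ℝ) : ℂ) • (Ind σ (γ t) φ - φ)

end Ind

end Group

end OrbitMethod

end

open OrbitMethod

/-!
Sections of the bundle over the orbit are equivariant functions on `G`, and the whole argument takes
place on `G`. The projection `x ↦ K(x⁻¹) F` maps the left-invariant vector field of `Z`, which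
differentiates along `t ↦ x exp (t Z)`, to the field `ξ_Z` of the orbit. So a tangent vector of the
orbit at the image `y` of `x` is an element `Z` of `𝔤` modulo the kernel of `Z ↦ y ∘ ad Z`. This
kernel is the Lie algebra of the stabilizer of `y`: its elements generate one-parameter groups that
fix `y` (`IsOneParam.mem_stab`). A function on the orbit has the derivative `Z u` along such a
vector, where `u` is identified with its pullback to `G` (`leftDeriv`).

*Hamiltonian fields.* As a covector on `𝔤`, the Hamiltonian field of `u` at `y` must be
`W ↦ -h⁻¹ (W u)`. This covector kills the stabilizer algebra of `y`, hence lies in the range of the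
skew map `Z ↦ y ∘ ad Z` and is tangent to the orbit (`existsUnique_isHamiltonianField`). For
`u = f_X` it is `y ∘ ad X`, because `Ad` has the derivative `X ↦ Ad x ∘ ad X` along left-invariant
fields (`leftDeriv_Ad`).

*The connection.* In the direction of `Z` put `∇ φ = Z φ - 2πi ⟨y, Z⟩ φ` (`covAt`). Since `χ_F` is
`exp X ↦ e^{2πi⟨F, X⟩}` and the other factor is trivial on the identity component, an equivariant
function satisfies `Z φ = 2πi ⟨y, Z⟩ φ` for `Z` in the stabilizer algebra of `y`
(`Extension.hasOrbitCharacter`, `rightDeriv_section`); hence `∇ φ` depends only on the tangent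
vector. The correction term is skew-adjoint, so `∇` is Hermitian. Vector fields on the orbit lift to
smooth `𝔤`-valued functions on `G` (`exists_lift`), and the curvature follows from `XY - YX = [X, Y]`
for left-invariant fields (`leftDeriv_leftDeriv_sub`) and from the derivative of `x ↦ ⟨y, Z⟩`. The
rule for `Q({u, v})` is formal once `[ξ_u, ξ_v] = ξ_{{u, v}}`, which is the Jacobi identity
(`isFieldBracket_hamField`). Finally `Q(f_X) φ = h ⟨y, X⟩ φ + (ħ/i) (X φ - 2πi ⟨y, X⟩ φ)`, where the
multiples of `φ` cancel, so that `(i/ħ) Q(f_X) φ = X φ` (`orbitConnection_Q_momentFn`).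

*The induced representation.* Differentiation along the left-invariant field of `X` commutes with
the operators `L_Z`, which come from right-invariant fields (`leftDeriv_rightDeriv_comm`), and so
preserves the space of the induced representation (`indDeriv`).

*The unitarized representation.* The difference quotients of `φ` are averages of right translates
of `ψ = X φ`, and `ν` is invariant, so that their norms are at most that of `ψ`
(`l2Sq_diffQuot_le`). Together with pointwise convergence to `ψ` this gives convergence in norm when
`ψ` has finite norm (`tendsto_lintegral_zero_of_le`). Conversely the pointwise limit of a Cauchy net
has finite norm by Fatou's lemma (`l2Sq_indDeriv_lt_top`).
-/

noncomputable section

namespace OrbitMethod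

open Set Filter MeasureTheory

universe u v w

set_option linter.unusedSectionVars false

variable {n : ℕ} {G : Type u} [TopologicalSpace G]
  [ChartedSpace (EuclideanSpace ℝ (Fin n)) G] [Group G] [LieGroup (𝓡 n) ∞ G]
  {B : Type v} [NormedAddCommGroup B] [NormedSpace ℝ B]

local notation "𝔼" => EuclideanSpace ℝ (Fin n)

/-! ### Left-invariant derivatives -/

variable (n) in
theorem t2Space_of_lieGroup (G : Type u) [TopologicalSpace G]
    [ChartedSpace (EuclideanSpace ℝ (Fin n)) G] [Group G] [LieGroup (𝓡 n) ∞ G] : T2Space G := by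
  have : T1Space G := (𝓡 n).t1Space G
  have : IsTopologicalGroup G := topologicalGroup_of_lieGroup (𝓡 n) ∞
  infer_instance

variable (n) in
/-- The derivative of `φ` at `x` along left-invariant vector fields, as a linear function of the
generator: `X ↦ d/dt φ (x exp (t X))` at `t = 0`. -/
def leftDeriv (φ : G → B) (x : G) : 𝔼 →L[ℝ] B :=
  mfderiv (𝓡 n) 𝓘(ℝ, B) (fun g : G => φ (x * g)) 1

theorem contMDiff_mul_left' (x : G) : ContMDiff (𝓡 n) (𝓡 n) ∞ (fun g : G => x * g) :=
  contMDiff_const.mul contMDiff_id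

theorem contMDiff_mul_right' (x : G) : ContMDiff (𝓡 n) (𝓡 n) ∞ (fun g : G => g * x) :=
  contMDiff_id.mul contMDiff_const

theorem mdifferentiableAt_translate {φ : G → B} (hφ : ContMDiff (𝓡 n) 𝓘(ℝ, B) ∞ φ) (x g : G) :
    MDifferentiableAt (𝓡 n) 𝓘(ℝ, B) (fun g : G => φ (x * g)) g :=
  (hφ.comp (contMDiff_mul_left' x)).mdifferentiableAt (by simp)

/-- The derivative is that of a smooth family of maps at the fixed point `1`, where the tangent
spaces are the model spaces, so that the coordinate changes of the tangent bundle are trivial. -/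
theorem contMDiff_leftDeriv {φ : G → B} (hφ : ContMDiff (𝓡 n) 𝓘(ℝ, B) ∞ φ) :
    ContMDiff (𝓡 n) 𝓘(ℝ, 𝔼 →L[ℝ] B) ∞ (leftDeriv n φ) := by
  intro x₀
  have hf : ContMDiff ((𝓡 n).prod (𝓡 n)) 𝓘(ℝ, B) ∞
      (Function.uncurry (fun x y : G => φ (x * y))) :=
    hφ.comp (contMDiff_fst.mul contMDiff_snd)
  have key := ContMDiffAt.mfderiv (m := ∞) (n := ∞) (I := 𝓡 n) (I' := 𝓘(ℝ, B)) (J := 𝓡 n)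
    (x₀ := x₀) (fun x y : G => φ (x * y)) (fun _ => (1 : G)) hf.contMDiffAt
    contMDiffAt_const (by simp)
  have hB : ∀ x : G, φ (x * 1) ∈ (chartAt B (φ (x₀ * 1))).source := fun x => by
    rw [chartAt_self_eq]; exact mem_univ _
  have hA : ∀ ϕ : G → 𝔼 →L[ℝ] B,
      inTangentCoordinates (𝓡 n) 𝓘(ℝ, B) (fun _ : G => (1 : G)) (fun x => φ (x * 1)) ϕ x₀ = ϕ := by
    intro ϕ
    funext x
    rw [inTangentCoordinates_eq (I := 𝓡 n) (I' := 𝓘(ℝ, B)) (M := G) (M' := B)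
      (fun _ : G => (1 : G)) (fun x => φ (x * 1)) ϕ (x := x) (x₀ := x₀)
      (mem_chart_source (EuclideanSpace ℝ (Fin n)) (1 : G)) (hB x)]
    ext1 v
    have h := (tangentBundleCore (𝓡 n) G).coordChange_self
      (achart (EuclideanSpace ℝ (Fin n)) (1 : G)) 1
      (mem_chart_source (EuclideanSpace ℝ (Fin n)) (1 : G))
    have h2 := (tangentBundleCore 𝓘(ℝ, B) B).coordChange_self
      (achart B (φ (x₀ * 1))) (φ (x * 1)) (hB x)
    exact (h2 _).trans (congrArg (ϕ x) (h v))
  exact (hA (leftDeriv n φ)) ▸ key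

theorem mfderiv_mulInvariantVectorField {φ : G → B} (hφ : ContMDiff (𝓡 n) 𝓘(ℝ, B) ∞ φ) (x : G)
    (X : LieAlg n G) :
    (mfderiv (𝓡 n) 𝓘(ℝ, B) φ x : 𝔼 →L[ℝ] B) (mulInvariantVectorField X x) = leftDeriv n φ x X := by
  have h := mfderiv_comp (I := 𝓡 n) (I' := 𝓡 n) (I'' := 𝓘(ℝ, B)) (1 : G) (g := φ)
    (f := fun g : G => x * g)
    (hφ.mdifferentiableAt (by simp)) ((contMDiff_mul_left' x).mdifferentiableAt (by simp))
  have h1 : mfderiv (𝓡 n) 𝓘(ℝ, B) φ (x * 1) = (mfderiv (𝓡 n) 𝓘(ℝ, B) φ x : 𝔼 →L[ℝ] B) := by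
    rw [mul_one]
  have h2 := congrArg (fun L : 𝔼 →L[ℝ] B => L X) h
  exact (h2.trans (congrArg (fun L : 𝔼 →L[ℝ] B => L (mulInvariantVectorField X x)) h1)).symm

theorem leftDeriv_translate (φ : G → B) (k x : G) :
    leftDeriv n (fun g => φ (k * g)) x = leftDeriv n φ (k * x) := by
  unfold leftDeriv
  congr 1
  funext g
  rw [mul_assoc]

/-- A global smooth function that agrees with the chart at `x` near `x`. -/
theorem exists_smooth_eq_chart (x : G) : ∃ Φ : G → 𝔼, ContMDiff (𝓡 n) 𝓘(ℝ, 𝔼) ∞ Φ ∧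
    Φ =ᶠ[𝓝 x] extChartAt (𝓡 n) x := by
  have := t2Space_of_lieGroup n G
  obtain ⟨f⟩ : Nonempty (SmoothBumpFunction (𝓡 n) x) := inferInstance
  refine ⟨fun y => f y • extChartAt (𝓡 n) x y, f.contMDiff_smul ?_, ?_⟩
  · exact contMDiffOn_extChartAt
  · filter_upwards [f.eventuallyEq_one] with y hy
    rw [hy]; simp

/-- Elements of `𝔤` are separated by the derivatives at `1` of a global smooth function. -/
theorem exists_smooth_leftDeriv_one_injective : ∃ Φ : G → 𝔼, ContMDiff (𝓡 n) 𝓘(ℝ, 𝔼) ∞ Φ ∧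
    Function.Injective (leftDeriv n Φ 1) := by
  obtain ⟨Φ, hΦ, he⟩ := exists_smooth_eq_chart (n := n) (1 : G)
  refine ⟨Φ, hΦ, ?_⟩
  have h1 : (leftDeriv n Φ 1 : 𝔼 →L[ℝ] 𝔼) = mfderiv (𝓡 n) 𝓘(ℝ, 𝔼) (extChartAt (𝓡 n) (1 : G)) 1 := by
    let D : (G → 𝔼) → (𝔼 →L[ℝ] 𝔼) := fun f => mfderiv (𝓡 n) 𝓘(ℝ, 𝔼) f 1
    have h : (fun g : G => Φ (1 * g)) = Φ := by simp
    exact (congrArg D h).trans he.mfderiv_eq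
  rw [h1]
  exact (isInvertible_mfderiv_extChartAt (mem_extChartAt_source (I := 𝓡 n) (1 : G))).injective

/-! ### One-parameter subgroups -/

theorem contMDiff_one_mulInvariantVectorField (X : LieAlg n G) :
    ContMDiff (𝓡 n) (𝓡 n).tangent 1
      (fun g : G => (⟨g, mulInvariantVectorField X g⟩ : TangentBundle (𝓡 n) G)) :=
  (contMDiff_mulInvariantVectorField (𝕜 := ℝ) (I := 𝓡 n) X).of_le
    (le_trans (by norm_num) le_minSmoothness)

theorem mfderiv_mul_left_mulInvariantVectorField (x g : G) (X : LieAlg n G) :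
    (mfderiv (𝓡 n) (𝓡 n) (fun y : G => x * y) g : 𝔼 →L[ℝ] 𝔼) (mulInvariantVectorField X g) =
      mulInvariantVectorField X (x * g) := by
  have h := mfderiv_comp (I := 𝓡 n) (I' := 𝓡 n) (I'' := 𝓡 n) (1 : G) (g := fun y : G => x * y)
    (f := fun y : G => g * y)
    ((contMDiff_mul_left' x).mdifferentiableAt (by simp))
    ((contMDiff_mul_left' g).mdifferentiableAt (by simp))
  have h1 : mfderiv (𝓡 n) (𝓡 n) (fun y : G => x * y) (g * 1) =
      (mfderiv (𝓡 n) (𝓡 n) (fun y : G => x * y) g : 𝔼 →L[ℝ] 𝔼) := by rw [mul_one]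
  have h0 : (fun y : G => x * g * y) = (fun y : G => x * y) ∘ (fun y : G => g * y) := by
    ext y; simp [mul_assoc]
  have h2 := congrArg (fun L : 𝔼 →L[ℝ] 𝔼 => L X) h
  have h3 : mulInvariantVectorField X (x * g) =
      (mfderiv (𝓡 n) (𝓡 n) ((fun y : G => x * y) ∘ (fun y : G => g * y)) 1 : 𝔼 →L[ℝ] 𝔼) X := by
    rw [← h0]; rfl
  exact ((h3.trans h2).trans
    (congrArg (fun L : 𝔼 →L[ℝ] 𝔼 => L (mulInvariantVectorField X g)) h1)).symm

theorem _root_.IsMIntegralCurveOn.mul_left {γ : ℝ → G} {X : LieAlg n G} {s : Set ℝ}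
    (hγ : IsMIntegralCurveOn (I := 𝓡 n) γ (mulInvariantVectorField X) s) (x : G) :
    IsMIntegralCurveOn (I := 𝓡 n) (fun t => x * γ t) (mulInvariantVectorField X) s := by
  intro t ht
  have h := HasMFDerivAt.comp_hasMFDerivWithinAt (I := 𝓘(ℝ, ℝ)) (I' := 𝓡 n) (I'' := 𝓡 n) t
    ((contMDiff_mul_left' x).mdifferentiableAt (x := γ t) (by simp)).hasMFDerivAt (hγ t ht)
  refine h.congr_mfderiv ?_
  have h2 := mfderiv_mul_left_mulInvariantVectorField x (γ t) X
  refine ContinuousLinearMap.ext_ring (?_ : _ = ((1 : ℝ) • _ : 𝔼))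
  change (mfderiv (𝓡 n) (𝓡 n) (fun y : G => x * y) (γ t) : 𝔼 →L[ℝ] 𝔼)
    ((1 : ℝ) • (mulInvariantVectorField X (γ t) : 𝔼)) =
      (1 : ℝ) • (mulInvariantVectorField X (x * γ t) : 𝔼)
  rw [one_smul, one_smul, h2]

/-- A left-invariant field is complete: left translates of a local integral curve through `1` have
the same length of time at every point. -/
theorem exists_isMIntegralCurve_mulInvariantVectorField (X : LieAlg n G) :
    ∃ γ : ℝ → G, γ 0 = 1 ∧ IsMIntegralCurve (I := 𝓡 n) γ (mulInvariantVectorField X) := by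
  have := t2Space_of_lieGroup n G
  have hv := contMDiff_one_mulInvariantVectorField X
  have : IsManifold (𝓡 n) 1 G := IsManifold.of_le (n := ∞) (by simp)
  obtain ⟨γ, h0, hγ⟩ := exists_isMIntegralCurveAt_of_contMDiffAt_boundaryless (I := 𝓡 n)
    (v := mulInvariantVectorField X) (t₀ := 0) (hv.contMDiffAt (x := (1 : G)))
  obtain ⟨ε, hε, hγ⟩ := isMIntegralCurveAt_iff'.1 hγ
  refine exists_isMIntegralCurve_of_isMIntegralCurveOn hv hε (fun x => ⟨fun t => x * γ t, by simp [h0],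
    ?_⟩) 1
  rw [Real.ball_eq_Ioo, zero_sub, zero_add] at hγ
  exact hγ.mul_left x

theorem hasDerivAt_of_hasMFDerivAt {f : ℝ → B} {L : ℝ →L[ℝ] B} {t : ℝ}
    (h : HasMFDerivAt 𝓘(ℝ, ℝ) 𝓘(ℝ, B) f t L) : HasDerivAt f (L 1) t :=
  HasFDerivAt.hasDerivAt (hasMFDerivAt_iff_hasFDerivAt.1 h)

theorem contMDiff_leftDeriv_apply {φ : G → B} (hφ : ContMDiff (𝓡 n) 𝓘(ℝ, B) ∞ φ)
    (X : LieAlg n G) : ContMDiff (𝓡 n) 𝓘(ℝ, B) ∞ (fun x => leftDeriv n φ x X) :=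
  (ContinuousLinearMap.apply ℝ B (E := 𝔼) X).contMDiff.comp (contMDiff_leftDeriv hφ)

theorem _root_.IsMIntegralCurve.hasDerivAt_comp {γ : ℝ → G} {X : LieAlg n G}
    (hγ : IsMIntegralCurve (I := 𝓡 n) γ (mulInvariantVectorField X)) {φ : G → B}
    (hφ : ContMDiff (𝓡 n) 𝓘(ℝ, B) ∞ φ) (t : ℝ) :
    HasDerivAt (fun t => φ (γ t)) (leftDeriv n φ (γ t) X) t := by
  have h := HasMFDerivAt.comp (I := 𝓘(ℝ, ℝ)) (I' := 𝓡 n) (I'' := 𝓘(ℝ, B)) t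
    (hφ.mdifferentiableAt (x := γ t) (by simp)).hasMFDerivAt (hγ t)
  have h3 := hasDerivAt_of_hasMFDerivAt h
  refine h3.congr_deriv ?_
  have h4 := mfderiv_mulInvariantVectorField hφ (γ t) X
  change (mfderiv (𝓡 n) 𝓘(ℝ, B) φ (γ t) : 𝔼 →L[ℝ] B)
    ((1 : ℝ) • (mulInvariantVectorField X (γ t) : 𝔼)) = _
  rw [one_smul, h4]

/-- Integral curves of a left-invariant field are smooth: the derivatives of `φ ∘ γ` are again of
this form. -/
theorem _root_.IsMIntegralCurve.contDiff_comp {γ : ℝ → G} {X : LieAlg n G}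
    (hγ : IsMIntegralCurve (I := 𝓡 n) γ (mulInvariantVectorField X)) {φ : G → B}
    (hφ : ContMDiff (𝓡 n) 𝓘(ℝ, B) ∞ φ) : ContDiff ℝ ∞ (fun t => φ (γ t)) := by
  rw [contDiff_infty]
  intro k
  induction k generalizing φ with
  | zero =>
    rw [Nat.cast_zero, contDiff_zero]
    exact hφ.continuous.comp hγ.continuous
  | succ k ih =>
    rw [Nat.cast_succ, contDiff_succ_iff_deriv]
    refine ⟨fun t => (hγ.hasDerivAt_comp hφ t).differentiableAt, by simp, ?_⟩
    have h : deriv (fun t => φ (γ t)) = fun t => leftDeriv n φ (γ t) X := by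
      funext t; exact (hγ.hasDerivAt_comp hφ t).deriv
    rw [h]
    exact ih (φ := fun x => leftDeriv n φ x X)
      (contMDiff_leftDeriv_apply hφ X)

theorem _root_.IsMIntegralCurve.contMDiff_of_mulInvariant {γ : ℝ → G} {X : LieAlg n G}
    (hγ : IsMIntegralCurve (I := 𝓡 n) γ (mulInvariantVectorField X)) :
    ContMDiff 𝓘(ℝ, ℝ) (𝓡 n) ∞ γ := by
  intro t
  obtain ⟨Φ, hΦ, he⟩ := exists_smooth_eq_chart (n := n) (γ t)
  have h1 : ContMDiffAt 𝓘(ℝ, ℝ) 𝓘(ℝ, 𝔼) ∞ (fun s => Φ (γ s)) t :=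
    (hγ.contDiff_comp hΦ).contMDiff.contMDiffAt
  have h2 : ContMDiffAt 𝓘(ℝ, 𝔼) (𝓡 n) ∞ (extChartAt (𝓡 n) (γ t)).symm (Φ (γ t)) := by
    rw [he.eq_of_nhds]
    exact (contMDiffOn_extChartAt_symm (γ t)).contMDiffAt
      (extChartAt_target_mem_nhds (I := 𝓡 n) (γ t))
  refine (h2.comp t h1).congr_of_eventuallyEq ?_
  have hc := hγ.continuous.continuousAt (x := t)
  filter_upwards [hc.eventually he, hc.eventually (extChartAt_source_mem_nhds (I := 𝓡 n) (γ t))]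
    with s hs hs2
  simp only [Function.comp, hs]
  exact ((extChartAt (𝓡 n) (γ t)).left_inv hs2).symm

/-- The exponential map exists: the integral curve through `1` is multiplicative, because translates
in time and left translates are integral curves with the same initial value. -/
theorem exists_isOneParam (X : LieAlg n G) : ∃ γ : ℝ → G, IsOneParam γ X := by
  have := t2Space_of_lieGroup n G
  have : IsManifold (𝓡 n) 1 G := IsManifold.of_le (n := ∞) (by simp)
  obtain ⟨γ, h0, hγ⟩ := exists_isMIntegralCurve_mulInvariantVectorField X
  refine ⟨γ, fun s t => ?_, hγ.contMDiff_of_mulInvariant, ?_⟩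
  · have h1 : IsMIntegralCurve (I := 𝓡 n) (γ ∘ (· + s)) (mulInvariantVectorField X) :=
      hγ.comp_add s
    have h2 : IsMIntegralCurve (I := 𝓡 n) (fun t => γ s * γ t) (mulInvariantVectorField X) := by
      rw [isMIntegralCurve_iff_isMIntegralCurveOn] at hγ ⊢
      exact hγ.mul_left (γ s)
    have h3 := isMIntegralCurve_Ioo_eq_of_contMDiff_boundaryless (t₀ := 0)
      (contMDiff_one_mulInvariantVectorField X) h1 h2 (by simp [h0])
    have h4 := congrFun h3 t
    simpa [add_comm] using h4
  · have h1 := (hγ 0).mfderiv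
    have h2 : (mulInvariantVectorField X (γ 0) : 𝔼) = X := by
      rw [h0]
      have := mfderiv_id (I := 𝓡 n) (x := (1 : G))
      have h : (fun y : G => (1 : G) * y) = id := by ext y; simp
      unfold mulInvariantVectorField
      rw [h]
      exact congrArg (fun L => L X) this
    have h3 := congrArg (fun L : ℝ →L[ℝ] 𝔼 => L 1) h1
    refine h3.trans ?_
    change (1 : ℝ) • (mulInvariantVectorField X (γ 0) : 𝔼) = X
    rw [one_smul, h2]

namespace IsOneParam

variable {γ : ℝ → G} {X : LieAlg n G}

theorem map_zero (hγ : IsOneParam γ X) : γ 0 = 1 := by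
  have h := hγ.map_add 0 0
  simpa using h

theorem map_neg (hγ : IsOneParam γ X) (t : ℝ) : γ (-t) = (γ t)⁻¹ := by
  have h := hγ.map_add t (-t)
  rw [add_neg_cancel, hγ.map_zero] at h
  exact (inv_eq_of_mul_eq_one_right h.symm).symm

/-- Differentiating along `exp (t X)` is the left-invariant derivative. -/
theorem hasDerivAt_leftDeriv_zero (hγ : IsOneParam γ X) {φ : G → B}
    (hφ : ContMDiff (𝓡 n) 𝓘(ℝ, B) ∞ φ) (x : G) :
    HasDerivAt (fun t => φ (x * γ t)) (leftDeriv n φ x X) 0 := by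
  have h0 := hγ.map_zero
  have h1 : MDifferentiableAt (𝓡 n) 𝓘(ℝ, B) (fun g : G => φ (x * g)) (γ 0) :=
    mdifferentiableAt_translate hφ x _
  have h := HasMFDerivAt.comp (I := 𝓘(ℝ, ℝ)) (I' := 𝓡 n) (I'' := 𝓘(ℝ, B)) 0
    h1.hasMFDerivAt (hγ.smooth.mdifferentiableAt (x := 0) (by simp)).hasMFDerivAt
  refine (hasDerivAt_of_hasMFDerivAt h).congr_deriv ?_
  have h3 : (mfderiv (𝓡 n) 𝓘(ℝ, B) (fun g : G => φ (x * g)) (γ 0) : 𝔼 →L[ℝ] B) =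
      leftDeriv n φ x := by rw [h0]; rfl
  change (mfderiv (𝓡 n) 𝓘(ℝ, B) (fun g : G => φ (x * g)) (γ 0) : 𝔼 →L[ℝ] B)
    ((mfderiv 𝓘(ℝ, ℝ) (𝓡 n) γ 0 : ℝ → 𝔼) 1) = _
  rw [h3]
  exact congrArg (leftDeriv n φ x) hγ.velocity

theorem hasDerivAt_leftDeriv (hγ : IsOneParam γ X) {φ : G → B}
    (hφ : ContMDiff (𝓡 n) 𝓘(ℝ, B) ∞ φ) (x : G) (t : ℝ) :
    HasDerivAt (fun t => φ (x * γ t)) (leftDeriv n φ (x * γ t) X) t := by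
  have h := hγ.hasDerivAt_leftDeriv_zero hφ (x * γ t)
  have h2 : HasDerivAt (fun s => φ (x * γ t * γ s)) (leftDeriv n φ (x * γ t) X) (t - t) := by
    rwa [sub_self]
  have h3 := h2.comp_sub_const t t
  simpa only [mul_assoc, ← hγ.map_add, add_sub_cancel] using h3

end IsOneParam

/-! ### Calculus of left-invariant derivatives -/

theorem leftDeriv_eq_of_hasDerivAt {φ : G → B} (hφ : ContMDiff (𝓡 n) 𝓘(ℝ, B) ∞ φ) {γ : ℝ → G}
    {X : LieAlg n G} (hγ : IsOneParam γ X) {x : G} {v : B}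
    (h : HasDerivAt (fun t => φ (x * γ t)) v 0) : leftDeriv n φ x X = v :=
  (hγ.hasDerivAt_leftDeriv_zero hφ x).unique h

theorem leftDeriv_const (b : B) (x : G) (X : LieAlg n G) :
    leftDeriv n (fun _ : G => b) x X = 0 := by
  obtain ⟨γ, hγ⟩ := exists_isOneParam X
  exact leftDeriv_eq_of_hasDerivAt contMDiff_const hγ (hasDerivAt_const _ _)

theorem leftDeriv_add {φ ψ : G → B} (hφ : ContMDiff (𝓡 n) 𝓘(ℝ, B) ∞ φ)
    (hψ : ContMDiff (𝓡 n) 𝓘(ℝ, B) ∞ ψ) (x : G) (X : LieAlg n G) :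
    leftDeriv n (fun y => φ y + ψ y) x X = leftDeriv n φ x X + leftDeriv n ψ x X := by
  obtain ⟨γ, hγ⟩ := exists_isOneParam X
  exact leftDeriv_eq_of_hasDerivAt (hφ.add hψ) hγ
    ((hγ.hasDerivAt_leftDeriv_zero hφ x).add (hγ.hasDerivAt_leftDeriv_zero hψ x))

theorem leftDeriv_clm {C : Type*} [NormedAddCommGroup C] [NormedSpace ℝ C] (L : B →L[ℝ] C)
    {φ : G → B} (hφ : ContMDiff (𝓡 n) 𝓘(ℝ, B) ∞ φ) (x : G) (X : LieAlg n G) :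
    leftDeriv n (fun y => L (φ y)) x X = L (leftDeriv n φ x X) := by
  obtain ⟨γ, hγ⟩ := exists_isOneParam X
  exact leftDeriv_eq_of_hasDerivAt (L.contMDiff.comp hφ) hγ
    (L.hasFDerivAt.comp_hasDerivAt 0 (hγ.hasDerivAt_leftDeriv_zero hφ x))

theorem leftDeriv_clm_apply {C : Type*} [NormedAddCommGroup C] [NormedSpace ℝ C]
    {A : G → B →L[ℝ] C} (hA : ContMDiff (𝓡 n) 𝓘(ℝ, B →L[ℝ] C) ∞ A)
    {φ : G → B} (hφ : ContMDiff (𝓡 n) 𝓘(ℝ, B) ∞ φ) (x : G) (X : LieAlg n G) :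
    leftDeriv n (fun y => A y (φ y)) x X = leftDeriv n A x X (φ x) + A x (leftDeriv n φ x X) := by
  obtain ⟨γ, hγ⟩ := exists_isOneParam X
  have h := (hγ.hasDerivAt_leftDeriv_zero hA x).clm_apply (hγ.hasDerivAt_leftDeriv_zero hφ x)
  rw [hγ.map_zero, mul_one] at h
  exact leftDeriv_eq_of_hasDerivAt (hA.clm_apply hφ) hγ h

theorem leftDeriv_smul {f : G → ℝ} (hf : ContMDiff (𝓡 n) 𝓘(ℝ, ℝ) ∞ f)
    {φ : G → B} (hφ : ContMDiff (𝓡 n) 𝓘(ℝ, B) ∞ φ) (x : G) (X : LieAlg n G) :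
    leftDeriv n (fun y => f y • φ y) x X = f x • leftDeriv n φ x X + leftDeriv n f x X • φ x := by
  obtain ⟨γ, hγ⟩ := exists_isOneParam X
  have h := (hγ.hasDerivAt_leftDeriv_zero hf x).smul (hγ.hasDerivAt_leftDeriv_zero hφ x)
  rw [hγ.map_zero, mul_one] at h
  exact leftDeriv_eq_of_hasDerivAt (hf.smul hφ) hγ h

/-- The representation of the left-invariant vector field of `X` in the chart at `1`. -/
def chartField (X : LieAlg n G) : 𝔼 → 𝔼 :=
  VectorField.mpullbackWithin 𝓘(ℝ, 𝔼) (𝓡 n) (extChartAt (𝓡 n) (1 : G)).symm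
    (mulInvariantVectorField X) (range (𝓡 n))

theorem fderiv_of_hasMFDerivAt {f : 𝔼 → B} {L : 𝔼 →L[ℝ] B} {q : 𝔼}
    (h : HasMFDerivAt 𝓘(ℝ, 𝔼) 𝓘(ℝ, B) f q L) : fderiv ℝ f q = L :=
  HasFDerivAt.fderiv (hasMFDerivAt_iff_hasFDerivAt.1 h)

theorem apply_inverse_apply {f : 𝔼 →L[ℝ] 𝔼} (hf : f.IsInvertible) (y : 𝔼) : f (f.inverse y) = y :=
  hf.self_apply_inverse y

theorem fderiv_comp_chart_eq {φ : G → B} (hφ : ContMDiff (𝓡 n) 𝓘(ℝ, B) ∞ φ) {q : 𝔼}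
    (hq : q ∈ (extChartAt (𝓡 n) (1 : G)).target) :
    fderiv ℝ (φ ∘ (extChartAt (𝓡 n) (1 : G)).symm) q =
      (mfderiv (𝓡 n) 𝓘(ℝ, B) φ ((extChartAt (𝓡 n) (1 : G)).symm q) : 𝔼 →L[ℝ] B) ∘L
      (mfderivWithin 𝓘(ℝ, 𝔼) (𝓡 n) (extChartAt (𝓡 n) (1 : G)).symm (range (𝓡 n)) q :
        𝔼 →L[ℝ] 𝔼) := by
  have : IsManifold (𝓡 n) 1 G := IsManifold.of_le (n := ∞) (by simp)
  have h1 : MDifferentiableWithinAt 𝓘(ℝ, 𝔼) (𝓡 n) (extChartAt (𝓡 n) (1 : G)).symm (range (𝓡 n)) q :=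
    mdifferentiableWithinAt_extChartAt_symm hq
  rw [ModelWithCorners.range_eq_univ, mdifferentiableWithinAt_univ] at h1
  have h2 := HasMFDerivAt.comp (I := 𝓘(ℝ, 𝔼)) (I' := 𝓡 n) (I'' := 𝓘(ℝ, B)) q
    (hφ.mdifferentiableAt (by simp)).hasMFDerivAt h1.hasMFDerivAt
  have h3 := fderiv_of_hasMFDerivAt h2
  rw [ModelWithCorners.range_eq_univ, mfderivWithin_univ]
  exact h3

/-- In the chart at `1`, `leftDeriv` is the derivative along `chartField`. -/
theorem fderiv_comp_chart_chartField {φ : G → B} (hφ : ContMDiff (𝓡 n) 𝓘(ℝ, B) ∞ φ) {q : 𝔼}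
    (hq : q ∈ (extChartAt (𝓡 n) (1 : G)).target) (X : LieAlg n G) :
    fderiv ℝ (φ ∘ (extChartAt (𝓡 n) (1 : G)).symm) q (chartField X q) =
      leftDeriv n φ ((extChartAt (𝓡 n) (1 : G)).symm q) X := by
  have : IsManifold (𝓡 n) 1 G := IsManifold.of_le (n := ∞) (by simp)
  rw [fderiv_comp_chart_eq hφ hq, ← mfderiv_mulInvariantVectorField hφ]
  have h1 := apply_inverse_apply (isInvertible_mfderivWithin_extChartAt_symm (I := 𝓡 n) hq)
    (mulInvariantVectorField X ((extChartAt (𝓡 n) (1 : G)).symm q))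
  exact congrArg (mfderiv (𝓡 n) 𝓘(ℝ, B) φ ((extChartAt (𝓡 n) (1 : G)).symm q) : 𝔼 →L[ℝ] B) h1

theorem differentiableAt_chartField (X : LieAlg n G) :
    DifferentiableAt ℝ (chartField X) (extChartAt (𝓡 n) (1 : G) 1) := by
  have : IsManifold (𝓡 n) 2 G := IsManifold.of_le (n := ∞) ENat.LEInfty.out
  have h := MDifferentiableWithinAt.differentiableWithinAt_mpullbackWithin_vectorField
    (s := univ) (V := mulInvariantVectorField X) (I := 𝓡 n)
    (mdifferentiableAt_mulInvariantVectorField X (g := (1 : G))).mdifferentiableWithinAt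
  rw [preimage_univ, univ_inter] at h
  have h2 := h.differentiableAt (by rw [ModelWithCorners.range_eq_univ]; exact univ_mem)
  exact h2

theorem contDiffAt_comp_chart {φ : G → B} (hφ : ContMDiff (𝓡 n) 𝓘(ℝ, B) ∞ φ) :
    ContDiffAt ℝ ∞ (φ ∘ (extChartAt (𝓡 n) (1 : G)).symm) (extChartAt (𝓡 n) (1 : G) 1) :=
  ((hφ.contMDiffAt).comp _
    ((contMDiffOn_extChartAt_symm (I := 𝓡 n) (n := ∞) (1 : G)).contMDiffAt
      (extChartAt_target_mem_nhds (I := 𝓡 n) (1 : G)))).contDiffAt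

/-- The bracket of `𝔤`, read off in the chart at `1`. -/
theorem leftDeriv_bracket_eq_fderiv {φ : G → B} (hφ : ContMDiff (𝓡 n) 𝓘(ℝ, B) ∞ φ)
    (X Y : LieAlg n G) :
    leftDeriv n φ 1 (⁅X, Y⁆ : LieAlg n G) = fderiv ℝ (φ ∘ (extChartAt (𝓡 n) (1 : G)).symm)
      (extChartAt (𝓡 n) (1 : G) 1) (VectorField.lieBracket ℝ (chartField X) (chartField Y)
        (extChartAt (𝓡 n) (1 : G) 1)) := by
  have : IsManifold (𝓡 n) 1 G := IsManifold.of_le (n := ∞) (by simp)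
  set e := extChartAt (𝓡 n) (1 : G) with he
  have hp : e 1 ∈ e.target := mem_extChartAt_target 1
  have hb : (⁅X, Y⁆ : LieAlg n G) = (mfderiv (𝓡 n) 𝓘(ℝ, 𝔼) e 1 : 𝔼 →L[ℝ] 𝔼).inverse
      (VectorField.lieBracket ℝ (E := 𝔼) (chartField X) (chartField Y) (e 1)) := by
    rw [GroupLieAlgebra.bracket_def, ← VectorField.mlieBracketWithin_univ,
      VectorField.mlieBracketWithin_apply, ← VectorField.lieBracketWithin_univ, preimage_univ,
      univ_inter]
    have h : range (𝓡 n) = univ := ModelWithCorners.range_eq_univ _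
    unfold chartField
    simp only [h]
    rfl
  have hx : mfderiv (𝓡 n) 𝓘(ℝ, B) φ 1 =
      (fderiv ℝ (φ ∘ e.symm) (e 1)) ∘L (mfderiv (𝓡 n) 𝓘(ℝ, 𝔼) e 1 : 𝔼 →L[ℝ] 𝔼) := by
    have hd : DifferentiableAt ℝ (φ ∘ e.symm) (e 1) :=
      (contDiffAt_comp_chart hφ).differentiableAt (by simp)
    have hd' : HasMFDerivAt 𝓘(ℝ, 𝔼) 𝓘(ℝ, B) (φ ∘ e.symm) (e 1) (fderiv ℝ (φ ∘ e.symm) (e 1)) :=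
      hasMFDerivAt_iff_hasFDerivAt.2 hd.hasFDerivAt
    have h3 := HasMFDerivAt.comp (I := 𝓡 n) (I' := 𝓘(ℝ, 𝔼)) (I'' := 𝓘(ℝ, B)) (1 : G)
      hd' (mdifferentiableAt_extChartAt (I := 𝓡 n)
        (mem_chart_source _ (1 : G))).hasMFDerivAt
    have h4 : φ =ᶠ[𝓝 1] (φ ∘ e.symm) ∘ e := by
      filter_upwards [extChartAt_source_mem_nhds (I := 𝓡 n) (1 : G)] with y hy
      simp [e.left_inv hy]
    exact (h3.congr_of_eventuallyEq h4).mfderiv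
  have h5 : (leftDeriv n φ 1 : 𝔼 →L[ℝ] B) = mfderiv (𝓡 n) 𝓘(ℝ, B) φ 1 := by
    let D : (G → B) → (𝔼 →L[ℝ] B) := fun f => mfderiv (𝓡 n) 𝓘(ℝ, B) f 1
    have h : (fun g : G => φ (1 * g)) = φ := by simp
    exact congrArg D h
  rw [h5, hx, hb]
  exact congrArg (fderiv ℝ (φ ∘ e.symm) (e 1))
    (apply_inverse_apply
      (isInvertible_mfderiv_extChartAt (mem_extChartAt_source (I := 𝓡 n) (1 : G))) _)

/-- The second left-invariant derivative at `1`, in the chart: a symmetric term and the derivative of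
one field along the other. -/
theorem leftDeriv_leftDeriv_one_eq {φ : G → B} (hφ : ContMDiff (𝓡 n) 𝓘(ℝ, B) ∞ φ)
    (X Y : LieAlg n G) :
    leftDeriv n (leftDeriv n φ) 1 X Y =
      fderiv ℝ (fderiv ℝ (φ ∘ (extChartAt (𝓡 n) (1 : G)).symm)) (extChartAt (𝓡 n) (1 : G) 1)
        (chartField X (extChartAt (𝓡 n) (1 : G) 1)) (chartField Y (extChartAt (𝓡 n) (1 : G) 1)) +
      fderiv ℝ (φ ∘ (extChartAt (𝓡 n) (1 : G)).symm) (extChartAt (𝓡 n) (1 : G) 1)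
        (fderiv ℝ (chartField Y) (extChartAt (𝓡 n) (1 : G) 1)
          (chartField X (extChartAt (𝓡 n) (1 : G) 1))) := by
  set e := extChartAt (𝓡 n) (1 : G) with he
  have hp : e 1 ∈ e.target := mem_extChartAt_target 1
  have h1 := fderiv_comp_chart_chartField (contMDiff_leftDeriv_apply hφ Y) hp X
  rw [e.left_inv (mem_extChartAt_source (1 : G))] at h1
  have h2 : leftDeriv n (fun x => leftDeriv n φ x Y) 1 X = leftDeriv n (leftDeriv n φ) 1 X Y :=
    leftDeriv_clm (ContinuousLinearMap.apply ℝ B (E := 𝔼) Y) (contMDiff_leftDeriv hφ) 1 X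
  have h3 : ((fun x => leftDeriv n φ x Y) ∘ e.symm) =ᶠ[𝓝 (e 1)]
      fun q => fderiv ℝ (φ ∘ e.symm) q (chartField Y q) := by
    filter_upwards [extChartAt_target_mem_nhds (I := 𝓡 n) (1 : G)] with q hq
    exact (fderiv_comp_chart_chartField hφ hq Y).symm
  rw [← h2, ← h1, h3.fderiv_eq]
  have h4 : DifferentiableAt ℝ (fderiv ℝ (φ ∘ e.symm)) (e 1) :=
    ((contDiffAt_comp_chart hφ).fderiv_right (m := 1) (le_of_eq_of_le one_add_one_eq_two ENat.LEInfty.out)).differentiableAt (by simp)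
  rw [fderiv_clm_apply h4 (differentiableAt_chartField Y)]
  simp [add_comm]

/-- Left-invariant derivatives satisfy `X Y - Y X = [X, Y]`. -/
theorem leftDeriv_leftDeriv_sub {φ : G → B} (hφ : ContMDiff (𝓡 n) 𝓘(ℝ, B) ∞ φ) (x : G)
    (X Y : LieAlg n G) :
    leftDeriv n (leftDeriv n φ) x X Y - leftDeriv n (leftDeriv n φ) x Y X =
      leftDeriv n φ x (⁅X, Y⁆ : LieAlg n G) := by
  have h1 : ∀ {φ : G → B}, ContMDiff (𝓡 n) 𝓘(ℝ, B) ∞ φ →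
      leftDeriv n (leftDeriv n φ) 1 X Y - leftDeriv n (leftDeriv n φ) 1 Y X =
      leftDeriv n φ 1 (⁅X, Y⁆ : LieAlg n G) := by
    intro φ hφ
    rw [leftDeriv_leftDeriv_one_eq hφ, leftDeriv_leftDeriv_one_eq hφ,
      leftDeriv_bracket_eq_fderiv hφ, VectorField.lieBracket_eq, map_sub]
    have h := ((contDiffAt_comp_chart hφ).isSymmSndFDerivAt (by simpa using ENat.LEInfty.out))
      (chartField X (extChartAt (𝓡 n) (1 : G) 1)) (chartField Y (extChartAt (𝓡 n) (1 : G) 1))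
    rw [h]
    abel
  have h2 := h1 (hφ.comp (contMDiff_mul_left' x))
  have h3 : leftDeriv n (φ ∘ fun g => x * g) = fun g => leftDeriv n φ (x * g) := by
    funext g; exact leftDeriv_translate φ x g
  rw [h3, leftDeriv_translate] at h2
  simpa only [mul_one] using h2

/-! ### The adjoint representation -/

theorem contMDiff_clm_of_apply {A : G → 𝔼 →L[ℝ] B}
    (h : ∀ v : 𝔼, ContMDiff (𝓡 n) 𝓘(ℝ, B) ∞ (fun x => A x v)) :
    ContMDiff (𝓡 n) 𝓘(ℝ, 𝔼 →L[ℝ] B) ∞ A := by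
  have hA : A = fun x => ∑ i : Fin n, ContinuousLinearMap.smulRightL ℝ 𝔼 B
      (EuclideanSpace.proj i : 𝔼 →L[ℝ] ℝ) (A x (EuclideanSpace.single i 1)) := by
    funext x
    ext v
    have hv := (EuclideanSpace.basisFun (Fin n) ℝ).sum_repr v
    conv_lhs => rw [← hv]
    simp
  rw [hA]
  exact contMDiff_finsetSum fun i _ =>
    (ContinuousLinearMap.smulRightL ℝ 𝔼 B (EuclideanSpace.proj i : 𝔼 →L[ℝ] ℝ)).contMDiff.comp (h _)

variable (n) in
/-- `Ad x` as a continuous linear map of the model space. -/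
def AdL (x : G) : 𝔼 →L[ℝ] 𝔼 := mfderiv (𝓡 n) (𝓡 n) (fun y : G => x * y * x⁻¹) 1

theorem AdL_apply (x : G) (X : LieAlg n G) : AdL n x X = Ad x X := rfl

theorem contMDiff_Ad (X : LieAlg n G) :
    ContMDiff (𝓡 n) 𝓘(ℝ, 𝔼) ∞ (fun x : G => AdL n x X) := by
  have h : (fun x : G => AdL n x X) = fun x => ∑ i : Fin n,
      (AdL n x X) i • (EuclideanSpace.single i 1 : 𝔼) := by
    funext x
    have hv := (EuclideanSpace.basisFun (Fin n) ℝ).sum_repr (AdL n x X)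
    simpa using hv.symm
  rw [h]
  refine contMDiff_finsetSum fun i _ => ?_
  have hi : ContMDiff (𝓡 n) 𝓘(ℝ, ℝ) ∞ (fun x : G => (AdL n x X) i) :=
    contMDiff_Ad_apply ((EuclideanSpace.proj i : 𝔼 →L[ℝ] ℝ) : 𝔼 →ₗ[ℝ] ℝ) X
  exact hi.smul contMDiff_const

theorem contMDiff_AdL : ContMDiff (𝓡 n) 𝓘(ℝ, 𝔼 →L[ℝ] 𝔼) ∞ (AdL n : G → 𝔼 →L[ℝ] 𝔼) :=
  contMDiff_clm_of_apply fun v => contMDiff_Ad v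

theorem Ad_inv_Ad (x : G) (X : LieAlg n G) : Ad x⁻¹ (Ad x X) = X := by
  have h := congrArg (fun L : LieAlg n G →ₗ[ℝ] LieAlg n G => L X) (Ad_mul x⁻¹ x)
  rw [inv_mul_cancel, Ad_one] at h
  exact h.symm

theorem Ad_Ad_inv (x : G) (X : LieAlg n G) : Ad x (Ad x⁻¹ X) = X := by
  have h := Ad_inv_Ad x⁻¹ X
  rwa [inv_inv] at h

variable (n) in
/-- The derivative of `φ` at `x` along right-invariant vector fields:
`X ↦ d/dt φ (exp (t X) x)` at `t = 0`. -/
def rightDeriv (φ : G → B) (x : G) : 𝔼 →L[ℝ] B :=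
  mfderiv (𝓡 n) 𝓘(ℝ, B) (fun g : G => φ (g * x)) 1

theorem lieLeft_apply {V : Type v} [NormedAddCommGroup V] [InnerProductSpace ℂ V]
    (φ : G → V) (x : G) (X : LieAlg n G) :
    lieLeft (n := n) φ x X = -rightDeriv n φ x X := rfl

theorem mfderiv_comp_conj {φ : G → B} (hφ : ContMDiff (𝓡 n) 𝓘(ℝ, B) ∞ φ) (x : G)
    (Y : LieAlg n G) :
    mfderiv (𝓡 n) 𝓘(ℝ, B) (fun g : G => φ (x * g * x⁻¹)) 1 Y =
      (mfderiv (𝓡 n) 𝓘(ℝ, B) φ 1 : 𝔼 →L[ℝ] B) (Ad x Y) := by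
  have h1 : x * 1 * x⁻¹ = 1 := by simp
  have h := mfderiv_comp (I := 𝓡 n) (I' := 𝓡 n) (I'' := 𝓘(ℝ, B)) (1 : G) (g := φ)
    (f := fun g : G => x * g * x⁻¹)
    (hφ.mdifferentiableAt (by simp)) ((contMDiff_conj x).mdifferentiableAt (by simp))
  have h2 : mfderiv (𝓡 n) 𝓘(ℝ, B) φ (x * 1 * x⁻¹) = (mfderiv (𝓡 n) 𝓘(ℝ, B) φ 1 : 𝔼 →L[ℝ] B) := by
    rw [h1]
  have h3 := congrArg (fun L : 𝔼 →L[ℝ] B => L Y) h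
  exact h3.trans (congrArg (fun L : 𝔼 →L[ℝ] B => L (Ad x Y)) h2)

theorem leftDeriv_eq_rightDeriv {φ : G → B} (hφ : ContMDiff (𝓡 n) 𝓘(ℝ, B) ∞ φ) (x : G)
    (Y : LieAlg n G) : leftDeriv n φ x Y = rightDeriv n φ x (Ad x Y) := by
  have h := mfderiv_comp_conj (hφ.comp (contMDiff_mul_right' x)) x Y
  have h2 : (fun g : G => (φ ∘ fun g => g * x) (x * g * x⁻¹)) = fun g => φ (x * g) := by
    funext g; simp
  rw [h2] at h
  exact h

theorem rightDeriv_eq_leftDeriv {φ : G → B} (hφ : ContMDiff (𝓡 n) 𝓘(ℝ, B) ∞ φ) (x : G)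
    (Y : LieAlg n G) : rightDeriv n φ x Y = leftDeriv n φ x (Ad x⁻¹ Y) := by
  rw [leftDeriv_eq_rightDeriv hφ, Ad_Ad_inv]

theorem contMDiff_rightDeriv {φ : G → B} (hφ : ContMDiff (𝓡 n) 𝓘(ℝ, B) ∞ φ) :
    ContMDiff (𝓡 n) 𝓘(ℝ, 𝔼 →L[ℝ] B) ∞ (rightDeriv n φ) := by
  refine contMDiff_clm_of_apply fun v => ?_
  have h : (fun x => rightDeriv n φ x v) = fun x => leftDeriv n φ x (AdL n x⁻¹ v) := by
    funext x; exact rightDeriv_eq_leftDeriv hφ x v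
  rw [h]
  exact (contMDiff_leftDeriv hφ).clm_apply
    ((contMDiff_AdL.comp (contMDiff_inv (𝓡 n) ∞)).clm_apply contMDiff_const)

theorem contMDiff_rightDeriv_apply {φ : G → B} (hφ : ContMDiff (𝓡 n) 𝓘(ℝ, B) ∞ φ)
    (X : LieAlg n G) : ContMDiff (𝓡 n) 𝓘(ℝ, B) ∞ (fun x => rightDeriv n φ x X) :=
  (ContinuousLinearMap.apply ℝ B (E := 𝔼) X).contMDiff.comp (contMDiff_rightDeriv hφ)

theorem IsOneParam.hasDerivAt_rightDeriv {γ : ℝ → G} {X : LieAlg n G} (hγ : IsOneParam γ X)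
    {φ : G → B} (hφ : ContMDiff (𝓡 n) 𝓘(ℝ, B) ∞ φ) (x : G) :
    HasDerivAt (fun t => φ (γ t * x)) (rightDeriv n φ x X) 0 := by
  have h := hγ.hasDerivAt_leftDeriv_zero (hφ.comp (contMDiff_mul_right' x)) 1
  have h2 : leftDeriv n (φ ∘ fun g => g * x) 1 = rightDeriv n φ x := by
    let D : (G → B) → (𝔼 →L[ℝ] B) := fun f => mfderiv (𝓡 n) 𝓘(ℝ, B) f 1
    have h3 : (fun g : G => (φ ∘ fun g => g * x) (1 * g)) = fun g => φ (g * x) := by simp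
    exact congrArg D h3
  rw [h2] at h
  simpa using h

/-- Equality of the mixed second derivatives of a smooth function of two real variables, in terms
of one-variable derivatives. -/
theorem mixed_deriv_eq {f : ℝ × ℝ → B} (hf : ContDiff ℝ ∞ f) {p q : ℝ → B} {a b : B}
    (hp : ∀ t, HasDerivAt (fun s => f (s, t)) (p t) 0) (hp' : HasDerivAt p a 0)
    (hq : ∀ s, HasDerivAt (fun t => f (s, t)) (q s) 0) (hq' : HasDerivAt q b 0) : a = b := by
  have hd : ∀ z, HasFDerivAt f (fderiv ℝ f z) z := fun z =>
    (hf.differentiable (by simp) z).hasFDerivAt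
  have hdd : HasFDerivAt (fderiv ℝ f) (fderiv ℝ (fderiv ℝ f) (0, 0)) ((0 : ℝ), (0 : ℝ)) :=
    ((hf.fderiv_right (m := 1) (le_of_eq_of_le one_add_one_eq_two ENat.LEInfty.out)).differentiable
      (by simp) _).hasFDerivAt
  have e1 : p = fun t => fderiv ℝ f (0, t) (1, 0) := by
    funext t
    exact (hp t).unique ((hd (0, t)).comp_hasDerivAt (0 : ℝ)
      ((hasDerivAt_id (0 : ℝ)).prodMk (hasDerivAt_const (0 : ℝ) t)))
  have e2 : q = fun s => fderiv ℝ f (s, 0) (0, 1) := by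
    funext s
    exact (hq s).unique ((hd (s, 0)).comp_hasDerivAt (0 : ℝ)
      ((hasDerivAt_const (0 : ℝ) s).prodMk (hasDerivAt_id (0 : ℝ))))
  have d1 : HasDerivAt (fun t : ℝ => fderiv ℝ f (0, t)) (fderiv ℝ (fderiv ℝ f) (0, 0) (0, 1)) 0 :=
    HasFDerivAt.comp_hasDerivAt (f := fun t : ℝ => ((0 : ℝ), t)) (0 : ℝ) hdd
      ((hasDerivAt_const (0 : ℝ) (0 : ℝ)).prodMk (hasDerivAt_id (0 : ℝ)))
  have d2 : HasDerivAt (fun s : ℝ => fderiv ℝ f (s, 0)) (fderiv ℝ (fderiv ℝ f) (0, 0) (1, 0)) 0 :=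
    HasFDerivAt.comp_hasDerivAt (f := fun s : ℝ => (s, (0 : ℝ))) (0 : ℝ) hdd
      ((hasDerivAt_id (0 : ℝ)).prodMk (hasDerivAt_const (0 : ℝ) (0 : ℝ)))
  have a1 := (e1 ▸ hp').unique (d1.clm_apply (hasDerivAt_const (0 : ℝ) ((1 : ℝ), (0 : ℝ))))
  have a2 := (e2 ▸ hq').unique (d2.clm_apply (hasDerivAt_const (0 : ℝ) ((0 : ℝ), (1 : ℝ))))
  have hs := (hf.contDiffAt (x := ((0 : ℝ), (0 : ℝ)))).isSymmSndFDerivAt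
    (by simpa using ENat.LEInfty.out) ((1 : ℝ), (0 : ℝ)) ((0 : ℝ), (1 : ℝ))
  rw [a1, a2, map_zero, add_zero, add_zero]
  exact hs.symm

/-- Left- and right-invariant vector fields commute. -/
theorem leftDeriv_rightDeriv_comm {φ : G → B} (hφ : ContMDiff (𝓡 n) 𝓘(ℝ, B) ∞ φ) (x : G)
    (X W : LieAlg n G) :
    leftDeriv n (fun y => rightDeriv n φ y W) x X = rightDeriv n (fun y => leftDeriv n φ y X) x W := by
  obtain ⟨γ, hγ⟩ := exists_isOneParam X
  obtain ⟨η, hη⟩ := exists_isOneParam W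
  have hf : ContDiff ℝ ∞ (fun z : ℝ × ℝ => φ (η z.1 * x * γ z.2)) := by
    rw [← contMDiff_iff_contDiff]
    have h1 : ContMDiff 𝓘(ℝ, ℝ × ℝ) (𝓡 n) ∞ (fun z : ℝ × ℝ => η z.1) :=
      hη.smooth.comp contDiff_fst.contMDiff
    have h2 : ContMDiff 𝓘(ℝ, ℝ × ℝ) (𝓡 n) ∞ (fun z : ℝ × ℝ => γ z.2) :=
      hγ.smooth.comp contDiff_snd.contMDiff
    exact hφ.comp ((h1.mul contMDiff_const).mul h2)
  refine mixed_deriv_eq hf (p := fun t => rightDeriv n φ (x * γ t) W)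
    (q := fun s => leftDeriv n φ (η s * x) X) (fun t => ?_) ?_ (fun s => ?_) ?_
  · simpa only [mul_assoc] using hη.hasDerivAt_rightDeriv hφ (x * γ t)
  · exact hγ.hasDerivAt_leftDeriv_zero (contMDiff_rightDeriv_apply hφ W) x
  · exact hγ.hasDerivAt_leftDeriv_zero hφ (η s * x)
  · exact hη.hasDerivAt_rightDeriv (contMDiff_leftDeriv_apply hφ X) x

/-- The derivative of `Ad` at `1` is `ad`: differentiate `R_{Ad x Y} Φ = L_Y Φ` along `X`, where
`L` and `R` denote left- and right-invariant fields, and compare `X R_Y = R_Y X` with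
`XY - YX = [X, Y]`. -/
theorem leftDeriv_Ad_one (X Y : LieAlg n G) :
    leftDeriv n (fun x : G => AdL n x Y) 1 X = (⁅X, Y⁆ : LieAlg n G) := by
  obtain ⟨Φ, hΦ, hinj⟩ := exists_smooth_leftDeriv_one_injective (n := n) (G := G)
  apply hinj
  have e0 : ∀ {ψ : G → 𝔼}, ContMDiff (𝓡 n) 𝓘(ℝ, 𝔼) ∞ ψ → ∀ Z : LieAlg n G,
      leftDeriv n ψ 1 Z = rightDeriv n ψ 1 Z := by
    intro ψ hψ Z
    rw [leftDeriv_eq_rightDeriv hψ, Ad_one]; rfl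
  have e1 : leftDeriv n (fun x => leftDeriv n Φ x Y) 1 X = leftDeriv n (leftDeriv n Φ) 1 X Y :=
    leftDeriv_clm (ContinuousLinearMap.apply ℝ 𝔼 (E := 𝔼) Y) (contMDiff_leftDeriv hΦ) 1 X
  have e2 : leftDeriv n (fun x => leftDeriv n Φ x X) 1 Y = leftDeriv n (leftDeriv n Φ) 1 Y X :=
    leftDeriv_clm (ContinuousLinearMap.apply ℝ 𝔼 (E := 𝔼) X) (contMDiff_leftDeriv hΦ) 1 Y
  have e3 : leftDeriv n (fun x => rightDeriv n Φ x Y) 1 X = leftDeriv n (rightDeriv n Φ) 1 X Y :=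
    leftDeriv_clm (ContinuousLinearMap.apply ℝ 𝔼 (E := 𝔼) Y) (contMDiff_rightDeriv hΦ) 1 X
  have e4 := leftDeriv_clm_apply (contMDiff_rightDeriv hΦ) (contMDiff_Ad Y) 1 X
  have e5 : (fun x => rightDeriv n Φ x (AdL n x Y)) = fun x => leftDeriv n Φ x Y := by
    funext x; exact (leftDeriv_eq_rightDeriv hΦ x Y).symm
  have e6 := leftDeriv_leftDeriv_sub hΦ 1 X Y
  have e7 := leftDeriv_rightDeriv_comm hΦ 1 X Y
  rw [← e0 (contMDiff_leftDeriv_apply hΦ X)] at e7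
  have e8 : AdL n (1 : G) Y = Y := by rw [AdL_apply, Ad_one]; rfl
  rw [e5, e1, e8, ← e3, e7, e2] at e4
  rw [← e6, e4, add_sub_cancel_left]
  exact e0 hΦ _

/-- The derivative of `Ad` along a left-invariant vector field. -/
theorem leftDeriv_Ad (x : G) (X Y : LieAlg n G) :
    leftDeriv n (fun x : G => AdL n x Y) x X = Ad x ⁅X, Y⁆ := by
  have h1 := leftDeriv_translate (n := n) (fun x : G => AdL n x Y) x 1
  have h2 : (fun g : G => AdL n (x * g) Y) = fun g => AdL n x (AdL n g Y) := by
    funext g; rw [AdL_apply, Ad_mul]; rfl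
  rw [mul_one, h2] at h1
  rw [← h1, leftDeriv_clm (AdL n x) (contMDiff_Ad Y), leftDeriv_Ad_one]
  rfl

theorem leftDeriv_functional_Ad (F : CoAlg n G) (x : G) (X Y : LieAlg n G) :
    leftDeriv n (fun x : G => F (Ad x Y)) x X = F (Ad x ⁅X, Y⁆) := by
  let F' : 𝔼 →ₗ[ℝ] ℝ := F
  have h := leftDeriv_clm (LinearMap.toContinuousLinearMap F') (contMDiff_Ad Y) x X
  rw [leftDeriv_Ad] at h
  exact h

theorem leftDeriv_conj {φ : G → B} (hφ : ContMDiff (𝓡 n) 𝓘(ℝ, B) ∞ φ) (x g : G)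
    (Y : LieAlg n G) :
    leftDeriv n (fun g => φ (x * g * x⁻¹)) g Y = leftDeriv n φ (x * g * x⁻¹) (Ad x Y) := by
  have h := mfderiv_comp_conj (hφ.comp (contMDiff_mul_left' (x * g * x⁻¹))) x Y
  have h2 : (fun y : G => (φ ∘ fun y => x * g * x⁻¹ * y) (x * y * x⁻¹)) =
      fun y => φ (x * (g * y) * x⁻¹) := by
    funext y; simp [mul_assoc]
  rw [h2] at h
  exact h

/-- `Ad x` is an automorphism of the Lie algebra. -/
theorem Ad_lie (x : G) (X Y : LieAlg n G) : Ad x ⁅X, Y⁆ = ⁅Ad x X, Ad x Y⁆ := by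
  obtain ⟨Φ, hΦ, hinj⟩ := exists_smooth_leftDeriv_one_injective (n := n) (G := G)
  apply hinj
  have hc : ContMDiff (𝓡 n) 𝓘(ℝ, 𝔼) ∞ (fun g => Φ (x * g * x⁻¹)) := hΦ.comp (contMDiff_conj x)
  have h1 := leftDeriv_leftDeriv_sub hc 1 X Y
  have e : x * 1 * x⁻¹ = 1 := by simp
  have key : ∀ X Y : LieAlg n G, leftDeriv n (leftDeriv n (fun g => Φ (x * g * x⁻¹))) 1 X Y =
      leftDeriv n (leftDeriv n Φ) 1 (Ad x X) (Ad x Y) := by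
    intro X Y
    have a1 : leftDeriv n (fun g => leftDeriv n (fun g => Φ (x * g * x⁻¹)) g Y) 1 X =
        leftDeriv n (leftDeriv n (fun g => Φ (x * g * x⁻¹))) 1 X Y :=
      leftDeriv_clm (ContinuousLinearMap.apply ℝ 𝔼 (E := 𝔼) Y) (contMDiff_leftDeriv hc) 1 X
    have a2 : leftDeriv n (fun g => leftDeriv n Φ g (Ad x Y)) 1 (Ad x X) =
        leftDeriv n (leftDeriv n Φ) 1 (Ad x X) (Ad x Y) :=
      leftDeriv_clm (ContinuousLinearMap.apply ℝ 𝔼 (E := 𝔼) (Ad x Y)) (contMDiff_leftDeriv hΦ) 1 _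
    have a3 := leftDeriv_conj (contMDiff_leftDeriv_apply hΦ (Ad x Y)) x 1 X
    have a4 : (fun g => leftDeriv n (fun g => Φ (x * g * x⁻¹)) g Y) =
        fun g => leftDeriv n Φ (x * g * x⁻¹) (Ad x Y) := by
      funext g; exact leftDeriv_conj hΦ x g Y
    rw [← a1, a4, a3, e, a2]
  rw [key, key, leftDeriv_conj hΦ, e, leftDeriv_leftDeriv_sub hΦ] at h1
  exact h1.symm

/-- An element of the radical of `F ∘ [·, ·]` generates a one-parameter group in the stabilizer. -/
theorem IsOneParam.mem_stab {F : CoAlg n G} {γ : ℝ → G} {Z : LieAlg n G} (hγ : IsOneParam γ Z)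
    (hZ : ∀ W : LieAlg n G, F ⁅Z, W⁆ = 0) (t : ℝ) : γ t ∈ stab F := by
  have hfix : ∀ t, Ad (γ t) Z = Z := by
    intro t
    have hd : ∀ s, HasDerivAt (fun t => AdL n (1 * γ t) Z) 0 s := by
      intro s
      have h := hγ.hasDerivAt_leftDeriv (contMDiff_Ad Z) 1 s
      have h2 : leftDeriv n (fun x : G => AdL n x Z) (1 * γ s) Z = 0 := by
        rw [leftDeriv_Ad, lie_self]; exact _root_.map_zero (AdL n (1 * γ s))
      rwa [h2] at h
    have h3 := is_const_of_deriv_eq_zero (fun s => (hd s).differentiableAt)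
      (fun s => (hd s).deriv) t 0
    simp only [one_mul, hγ.map_zero] at h3
    exact h3.trans (by rw [AdL_apply, Ad_one]; rfl)
  have hF : ∀ t W, F (Ad (γ t) W) = F W := by
    intro t W
    have hd : ∀ s, HasDerivAt (fun t => F (Ad (1 * γ t) W)) 0 s := by
      intro s
      have h := hγ.hasDerivAt_leftDeriv (contMDiff_Ad_apply F W) 1 s
      rwa [leftDeriv_functional_Ad, one_mul, Ad_lie, hfix, hZ] at h
    have h3 := is_const_of_deriv_eq_zero (fun s => (hd s).differentiableAt)
      (fun s => (hd s).deriv) t 0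
    simp only [one_mul, hγ.map_zero, Ad_one] at h3
    exact h3
  change F ∘ₗ Ad (γ t)⁻¹ = F
  ext1 W
  rw [← hγ.map_neg]
  exact hF (-t) W

/-! ### Functions and vector fields on the orbit -/

instance : FiniteDimensional ℝ (LieAlg n G) := inferInstanceAs (FiniteDimensional ℝ 𝔼)

theorem adStar_apply (y : CoAlg n G) (X W : LieAlg n G) : adStar y X W = y ⁅X, W⁆ := rfl

theorem orbitMap_surjective (F : CoAlg n G) : Function.Surjective (orbitMap F) := by
  rintro ⟨y, g, rfl⟩
  exact ⟨g⁻¹, Subtype.ext (by simp [orbitMap])⟩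

theorem orbitMap_act_inv (F : CoAlg n G) (x g : G) :
    (orbitMap F x).act g⁻¹ = orbitMap F (x * g) := by
  apply Subtype.ext
  change coadj g⁻¹ (coadj x⁻¹ F) = coadj (x * g)⁻¹ F
  rw [mul_inv_rev, coadj_mul]

theorem orbitMap_lie (F : CoAlg n G) (x : G) (X Y : LieAlg n G) :
    (orbitMap F x).1 ⁅X, Y⁆ = F ⁅Ad x X, Ad x Y⁆ := by
  rw [orbitMap_apply, Ad_lie]

theorem lie_Ad_eq_zero {F : CoAlg n G} {x : G} {Z : LieAlg n G}
    (hZ : adStar (orbitMap F x).1 Z = 0) (W : LieAlg n G) : F ⁅Ad x Z, W⁆ = 0 := by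
  have h := congrArg (fun f : CoAlg n G => f (Ad x⁻¹ W)) hZ
  change (orbitMap F x).1 ⁅Z, Ad x⁻¹ W⁆ = 0 at h
  rwa [orbitMap_lie, Ad_Ad_inv] at h

theorem contMDiff_pullback {F : CoAlg n G} {u : Orbit F → ℝ} (hu : u ∈ smoothFn F) :
    ContMDiff (𝓡 n) 𝓘(ℝ, ℝ) ∞ (fun x => u (orbitMap F x)) := hu

/-- The pullback to `G` of a function on the orbit is constant along the stabilizer directions. -/
theorem leftDeriv_pullback_eq_zero {F : CoAlg n G} {u : Orbit F → ℝ} (hu : u ∈ smoothFn F) {x : G}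
    {Z : LieAlg n G} (hZ : adStar (orbitMap F x).1 Z = 0) :
    leftDeriv n (fun x => u (orbitMap F x)) x Z = 0 := by
  obtain ⟨γ, hγ⟩ := exists_isOneParam (Ad x Z)
  rw [leftDeriv_eq_rightDeriv (contMDiff_pullback hu)]
  refine (hγ.hasDerivAt_rightDeriv (contMDiff_pullback hu) x).unique ?_
  have h : (fun t => u (orbitMap F (γ t * x))) = fun _ => u (orbitMap F x) := by
    funext t
    rw [orbitMap_mul_left F (hγ.mem_stab (lie_Ad_eq_zero hZ) t)]
  rw [h]
  exact hasDerivAt_const _ _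

theorem leftDeriv_pullback_congr {F : CoAlg n G} {u : Orbit F → ℝ} (hu : u ∈ smoothFn F) {x : G}
    {Z Z' : LieAlg n G} (h : adStar (orbitMap F x).1 Z = adStar (orbitMap F x).1 Z') :
    leftDeriv n (fun x => u (orbitMap F x)) x Z = leftDeriv n (fun x => u (orbitMap F x)) x Z' := by
  have h1 := leftDeriv_pullback_eq_zero hu (x := x) (Z := Z - Z') (by rw [map_sub, h, sub_self])
  have h2 := (leftDeriv n (fun x => u (orbitMap F x)) x).map_sub Z Z'
  exact sub_eq_zero.1 (h2.symm.trans h1)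

theorem adStar_tangentLift {y η : CoAlg n G} (h : η ∈ tangent y) :
    adStar y (tangentLift y η) = η :=
  Classical.epsilon_spec (p := fun Z => adStar y Z = η) h

theorem dOrbit_eq {F : CoAlg n G} {u : Orbit F → ℝ} (hu : u ∈ smoothFn F) {x : G} {η : CoAlg n G}
    {Z : LieAlg n G} (h : adStar (orbitMap F x).1 Z = η) :
    dOrbit u (orbitMap F x) η = leftDeriv n (fun x => u (orbitMap F x)) x Z := by
  have h1 : adStar (orbitMap F x).1 (tangentLift (orbitMap F x).1 η) = adStar (orbitMap F x).1 Z := by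
    rw [adStar_tangentLift ⟨Z, h⟩, h]
  rw [← leftDeriv_pullback_congr hu h1]
  have h2 : (fun g : G => u ((orbitMap F x).act g⁻¹)) = fun g => u (orbitMap F (x * g)) := by
    funext g; rw [orbitMap_act_inv]
  let D : (G → ℝ) → (𝔼 →L[ℝ] ℝ) := fun f => mfderiv (𝓡 n) 𝓘(ℝ, ℝ) f 1
  exact congrArg (fun f => D f (tangentLift (orbitMap F x).1 η)) h2

theorem derivAlong_eq {F : CoAlg n G} {u : Orbit F → ℝ} (hu : u ∈ smoothFn F) {ξ : vecField F}
    {x : G} {Z : LieAlg n G} (h : adStar (orbitMap F x).1 Z = ξ.1 (orbitMap F x)) :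
    derivAlong ξ u (orbitMap F x) = leftDeriv n (fun x => u (orbitMap F x)) x Z :=
  dOrbit_eq hu h

theorem omega_eq {F : CoAlg n G} (h : ℝ) {y : Orbit F} {a b : CoAlg n G} {X Y : LieAlg n G}
    (ha : adStar y.1 X = a) (hb : adStar y.1 Y = b) : omega h y a b = h * y.1 ⁅X, Y⁆ := by
  have h1 : adStar y.1 (tangentLift y.1 a) = adStar y.1 X := by
    rw [adStar_tangentLift ⟨X, ha⟩, ha]
  have h2 : adStar y.1 (tangentLift y.1 b) = adStar y.1 Y := by
    rw [adStar_tangentLift ⟨Y, hb⟩, hb]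
  unfold omega
  rw [← adStar_apply, h1, adStar_apply, ← lie_skew, map_neg, ← adStar_apply, h2, adStar_apply,
    ← map_neg, lie_skew]

/-! ### Hamiltonian fields -/

theorem isHamiltonianField_iff {F : CoAlg n G} {h : ℝ} (hh : h ≠ 0) {u : Orbit F → ℝ}
    (hu : u ∈ smoothFn F) (ξ : vecField F) :
    IsHamiltonianField h u ξ ↔ ∀ (x : G) (W : LieAlg n G),
      ξ.1 (orbitMap F x) W = -h⁻¹ * leftDeriv n (fun x => u (orbitMap F x)) x W := by
  have key : ∀ (x : G) (W : LieAlg n G),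
      omega h (orbitMap F x) (ξ.1 (orbitMap F x)) (adStar (orbitMap F x).1 W) +
        dOrbit u (orbitMap F x) (adStar (orbitMap F x).1 W) =
      h * ξ.1 (orbitMap F x) W + leftDeriv n (fun x => u (orbitMap F x)) x W := by
    intro x W
    obtain ⟨Z, hZ⟩ := ξ.2.1 (orbitMap F x)
    rw [omega_eq h hZ rfl, dOrbit_eq hu rfl, ← adStar_apply, hZ]
  constructor
  · intro H x W
    have h1 := H (orbitMap F x) _ ⟨W, rfl⟩
    rw [key] at h1
    field_simp
    linarith
  · intro H y η hη
    obtain ⟨x, rfl⟩ := orbitMap_surjective F y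
    obtain ⟨W, rfl⟩ := hη
    rw [key, H]
    field_simp
    ring

/-- The image of the skew map `adStar y` is the annihilator of its kernel. -/
theorem mem_tangent_of_ker {y f : CoAlg n G} (hf : ∀ Z, adStar y Z = 0 → f Z = 0) :
    f ∈ tangent y := by
  have h1 : f ∈ LinearMap.range (adStar y).dualMap := by
    rw [LinearMap.range_dualMap_eq_dualAnnihilator_ker, Submodule.mem_dualAnnihilator]
    exact fun Z hZ => hf Z hZ
  obtain ⟨φ, rfl⟩ := h1
  obtain ⟨X, rfl⟩ := (Module.evalEquiv ℝ (LieAlg n G)).surjective φ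
  refine ⟨-X, ?_⟩
  ext Z
  change y ⁅-X, Z⁆ = y ⁅Z, X⁆
  rw [neg_lie, lie_skew]

/-- The Hamiltonian field of `u`, as a field of covectors on `𝔤`: at `y` it is `-h⁻¹` times the
derivative of `u` along the action. It is tangent to the orbit because that derivative kills the
stabilizer algebra of `y`. -/
def symplGradient {F : CoAlg n G} (h : ℝ) (u : smoothFn F) : vecField F :=
  ⟨fun y => (-h⁻¹) • ((mfderiv (𝓡 n) 𝓘(ℝ, ℝ) (fun g : G => u.1 (y.act g⁻¹)) 1 :
      𝔼 →L[ℝ] ℝ).toLinearMap : LieAlg n G →ₗ[ℝ] ℝ), by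
    have key : ∀ x : G, (mfderiv (𝓡 n) 𝓘(ℝ, ℝ) (fun g : G => u.1 ((orbitMap F x).act g⁻¹)) 1 :
        𝔼 →L[ℝ] ℝ) = leftDeriv n (fun x => u.1 (orbitMap F x)) x := by
      intro x
      have h2 : (fun g : G => u.1 ((orbitMap F x).act g⁻¹)) = fun g => u.1 (orbitMap F (x * g)) := by
        funext g; rw [orbitMap_act_inv]
      let D : (G → ℝ) → (𝔼 →L[ℝ] ℝ) := fun f => mfderiv (𝓡 n) 𝓘(ℝ, ℝ) f 1
      exact congrArg D h2
    constructor
    · intro y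
      obtain ⟨x, rfl⟩ := orbitMap_surjective F y
      refine Submodule.smul_mem _ _ (mem_tangent_of_ker fun Z hZ => ?_)
      have h1 := congrArg (fun L : 𝔼 →L[ℝ] ℝ => L Z) (key x)
      exact h1.trans (leftDeriv_pullback_eq_zero u.2 hZ)
    · intro Z
      have h1 := (contMDiff_leftDeriv_apply (contMDiff_pullback u.2) Z)
      have h2 : ContMDiff (𝓡 n) 𝓘(ℝ, ℝ) ∞
          (fun x => -h⁻¹ * leftDeriv n (fun x => u.1 (orbitMap F x)) x Z) :=
        contMDiff_const.mul h1
      refine ContMDiff.congr h2 fun x => ?_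
      exact congrArg (fun L : 𝔼 →L[ℝ] ℝ => -h⁻¹ * L Z) (key x)⟩

theorem symplGradient_apply {F : CoAlg n G} (h : ℝ) (u : smoothFn F) (x : G) (W : LieAlg n G) :
    (symplGradient h u).1 (orbitMap F x) W =
      -h⁻¹ * leftDeriv n (fun x => u.1 (orbitMap F x)) x W := by
  have h2 : (fun g : G => u.1 ((orbitMap F x).act g⁻¹)) = fun g => u.1 (orbitMap F (x * g)) := by
    funext g; rw [orbitMap_act_inv]
  let D : (G → ℝ) → (𝔼 →L[ℝ] ℝ) := fun f => mfderiv (𝓡 n) 𝓘(ℝ, ℝ) f 1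
  exact congrArg (fun f => -h⁻¹ * D f W) h2

theorem vecField_ext {F : CoAlg n G} {ξ η : vecField F}
    (h : ∀ (x : G) (W : LieAlg n G), ξ.1 (orbitMap F x) W = η.1 (orbitMap F x) W) : ξ = η := by
  apply Subtype.ext
  funext y
  obtain ⟨x, rfl⟩ := orbitMap_surjective F y
  exact LinearMap.ext (h x)

theorem existsUnique_isHamiltonianField {F : CoAlg n G} {h : ℝ} (hh : h ≠ 0) (u : smoothFn F) :
    ∃! ξ : vecField F, IsHamiltonianField h u.1 ξ := by
  refine ⟨symplGradient h u, (isHamiltonianField_iff hh u.2 _).2 (symplGradient_apply h u),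
    fun η hη => vecField_ext fun x W => ?_⟩
  rw [(isHamiltonianField_iff hh u.2 _).1 hη, symplGradient_apply]

theorem hamField_apply {F : CoAlg n G} {h : ℝ} (hh : h ≠ 0) {u : Orbit F → ℝ} (hu : u ∈ smoothFn F)
    (x : G) (W : LieAlg n G) : (hamField h u).1 (orbitMap F x) W =
      -h⁻¹ * leftDeriv n (fun x => u (orbitMap F x)) x W :=
  (isHamiltonianField_iff hh hu _).1 (Classical.epsilon_spec (p := fun ξ => IsHamiltonianField h u ξ)
    (existsUnique_isHamiltonianField hh ⟨u, hu⟩).exists) x W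

theorem leftDeriv_coord (F : CoAlg n G) (x : G) (X Y : LieAlg n G) :
    leftDeriv n (fun x => (orbitMap F x).1 Y) x X = (orbitMap F x).1 ⁅X, Y⁆ := by
  simp only [orbitMap_apply]
  exact leftDeriv_functional_Ad F x X Y

theorem contMDiff_coord (F : CoAlg n G) (X : LieAlg n G) :
    ContMDiff (𝓡 n) 𝓘(ℝ, ℝ) ∞ (fun x : G => (orbitMap F x).1 X) := by
  simp only [orbitMap_apply]
  exact contMDiff_Ad_apply F X

theorem leftDeriv_momentFn (F : CoAlg n G) (h : ℝ) (x : G) (X Y : LieAlg n G) :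
    leftDeriv n (fun x => (momentFn F h Y).1 (orbitMap F x)) x X = h * (orbitMap F x).1 ⁅X, Y⁆ := by
  have h1 := leftDeriv_clm (ContinuousLinearMap.mul ℝ ℝ h) (contMDiff_coord F Y) x X
  rw [leftDeriv_coord] at h1
  exact h1

theorem hamField_momentFn (F : CoAlg n G) {h : ℝ} (hh : h ≠ 0) (X : LieAlg n G) :
    hamField h (momentFn F h X).1 = fundField F X := by
  refine vecField_ext fun x W => ?_
  rw [hamField_apply hh (momentFn F h X).2, leftDeriv_momentFn]
  change _ = (orbitMap F x).1 ⁅X, W⁆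
  rw [← lie_skew, map_neg]
  field_simp

/-! ### Smooth lifts of vector fields to `G` -/

theorem exists_linear_section {K V₁ V₂ : Type*} [Field K] [AddCommGroup V₁] [Module K V₁]
    [AddCommGroup V₂] [Module K V₂] (A : V₁ →ₗ[K] V₂) :
    ∃ S : V₂ →ₗ[K] V₁, ∀ f ∈ LinearMap.range A, A (S f) = f := by
  obtain ⟨g, hg⟩ := A.rangeRestrict.exists_rightInverse_of_surjective
    (LinearMap.range_rangeRestrict _)
  obtain ⟨S, hS⟩ := LinearMap.exists_extend g
  refine ⟨S, fun f hf => ?_⟩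
  have h1 : S f = g ⟨f, hf⟩ := congrArg (fun L => L ⟨f, hf⟩) hS
  have h2 : A.rangeRestrict (g ⟨f, hf⟩) = ⟨f, hf⟩ := congrArg (fun L => L ⟨f, hf⟩) hg
  rw [h1]
  exact congrArg Subtype.val h2

theorem exists_section_adStar (F : CoAlg n G) : ∃ S : CoAlg n G →ₗ[ℝ] LieAlg n G,
    ∀ f ∈ tangent F, adStar F (S f) = f :=
  exists_linear_section (adStar F)

/-- Every smooth vector field on the orbit lifts to a smooth `𝔤`-valued function on `G`. The rank
of `adStar` is constant along the orbit, because `Ad x` is an automorphism, so that a linear section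
of `adStar F` can be transported to every point. -/
theorem exists_lift {F : CoAlg n G} (ξ : vecField F) : ∃ a : G → LieAlg n G,
    ContMDiff (M' := 𝔼) (𝓡 n) 𝓘(ℝ, 𝔼) ∞ a ∧
    ∀ x, adStar (orbitMap F x).1 (a x) = ξ.1 (orbitMap F x) := by
  obtain ⟨S, hS⟩ := exists_section_adStar F
  refine ⟨fun x => Ad x⁻¹ (S (ξ.1 (orbitMap F x) ∘ₗ Ad x⁻¹)), ?_, fun x => ?_⟩
  · let S' : (𝔼 →L[ℝ] ℝ) →ₗ[ℝ] 𝔼 :=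
      { toFun := fun L => S (L.toLinearMap : 𝔼 →ₗ[ℝ] ℝ)
        map_add' := fun L L' => S.map_add (L.toLinearMap : 𝔼 →ₗ[ℝ] ℝ) (L'.toLinearMap : 𝔼 →ₗ[ℝ] ℝ)
        map_smul' := fun c L => S.map_smul c (L.toLinearMap : 𝔼 →ₗ[ℝ] ℝ) }
    let ξ' : G → 𝔼 →L[ℝ] ℝ := fun x =>
      LinearMap.toContinuousLinearMap (ξ.1 (orbitMap F x) : 𝔼 →ₗ[ℝ] ℝ)
    have h1 : ContMDiff (𝓡 n) 𝓘(ℝ, 𝔼 →L[ℝ] ℝ) ∞ ξ' :=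
      contMDiff_clm_of_apply fun v => contMDiff_pullback (ξ.2.2 v)
    have h2 : ContMDiff (𝓡 n) 𝓘(ℝ, 𝔼 →L[ℝ] 𝔼) ∞ (fun x : G => AdL n x⁻¹) :=
      contMDiff_AdL.comp (contMDiff_inv (𝓡 n) ∞)
    exact h2.clm_apply
      ((LinearMap.toContinuousLinearMap S').contMDiff.comp (h1.clm_comp h2))
  · obtain ⟨Z, hZ⟩ := ξ.2.1 (orbitMap F x)
    have h1 : ξ.1 (orbitMap F x) ∘ₗ Ad x⁻¹ = adStar F (Ad x Z) := by
      rw [← hZ]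
      ext1 V
      change (orbitMap F x).1 ⁅Z, Ad x⁻¹ V⁆ = F ⁅Ad x Z, V⁆
      rw [orbitMap_lie, Ad_Ad_inv]
    have h2 := hS (ξ.1 (orbitMap F x) ∘ₗ Ad x⁻¹) (by rw [h1]; exact ⟨_, rfl⟩)
    ext1 W
    have h3 := congrArg (fun f : CoAlg n G => f (Ad x W)) h2
    change F ⁅S (ξ.1 (orbitMap F x) ∘ₗ Ad x⁻¹), Ad x W⁆ = ξ.1 (orbitMap F x) (Ad x⁻¹ (Ad x W)) at h3
    rw [Ad_inv_Ad] at h3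
    rw [adStar_apply, orbitMap_lie, Ad_Ad_inv]
    exact h3

/-- A chosen smooth lift of a vector field on the orbit to a `𝔤`-valued function on `G`. Lifts are
unique only up to functions with values in the Lie algebras of the stabilizers. -/
def lift {F : CoAlg n G} (ξ : vecField F) : G → LieAlg n G := (exists_lift ξ).choose

theorem contMDiff_lift {F : CoAlg n G} (ξ : vecField F) :
    ContMDiff (M' := 𝔼) (𝓡 n) 𝓘(ℝ, 𝔼) ∞ (lift ξ) := (exists_lift ξ).choose_spec.1

theorem adStar_lift {F : CoAlg n G} (ξ : vecField F) (x : G) :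
    adStar (orbitMap F x).1 (lift ξ x) = ξ.1 (orbitMap F x) := (exists_lift ξ).choose_spec.2 x

/-! ### Brackets of vector fields on the orbit -/

/-- The covector `orbitMap F x` as a smooth function of `x`. -/
def orbitCovector (F : CoAlg n G) (x : G) : 𝔼 →L[ℝ] ℝ :=
  LinearMap.toContinuousLinearMap ((orbitMap F x).1 : 𝔼 →ₗ[ℝ] ℝ)

theorem contMDiff_orbitCovector (F : CoAlg n G) :
    ContMDiff (𝓡 n) 𝓘(ℝ, 𝔼 →L[ℝ] ℝ) ∞ (orbitCovector F : G → 𝔼 →L[ℝ] ℝ) :=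
  contMDiff_clm_of_apply fun v => contMDiff_coord F v

theorem contMDiff_coord_apply (F : CoAlg n G) {a : G → LieAlg n G}
    (ha : ContMDiff (M' := 𝔼) (𝓡 n) 𝓘(ℝ, 𝔼) ∞ a) :
    ContMDiff (𝓡 n) 𝓘(ℝ, ℝ) ∞ (fun x => (orbitMap F x).1 (a x)) :=
  (contMDiff_orbitCovector F).clm_apply ha

/-- `leftDeriv` of a `𝔤`-valued function, with values in `𝔤`. -/
def algDeriv (a : G → LieAlg n G) (x : G) (X : LieAlg n G) : LieAlg n G :=
  leftDeriv n (B := 𝔼) a x X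

theorem leftDeriv_coord_apply (F : CoAlg n G) {a : G → LieAlg n G}
    (ha : ContMDiff (M' := 𝔼) (𝓡 n) 𝓘(ℝ, 𝔼) ∞ a) (x : G) (X : LieAlg n G) :
    leftDeriv n (fun x => (orbitMap F x).1 (a x)) x X =
      (orbitMap F x).1 ⁅X, a x⁆ + (orbitMap F x).1 (algDeriv a x X) := by
  have h1 := leftDeriv_clm_apply (contMDiff_orbitCovector F) ha x X
  have h2 : leftDeriv n (fun y => orbitCovector F y (a x)) x X =
      leftDeriv n (orbitCovector F) x X (a x) :=
    leftDeriv_clm (ContinuousLinearMap.apply ℝ ℝ (E := 𝔼) (a x)) (contMDiff_orbitCovector F) x X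
  rw [← h2] at h1
  have h3 := leftDeriv_coord F x X (a x)
  exact h1.trans (congrArg (· + _) h3)

/-- `X ↦ [X, W]` as a continuous linear map. -/
def lieRight (W : LieAlg n G) : 𝔼 →L[ℝ] 𝔼 :=
  LinearMap.toContinuousLinearMap
    (-(LieAlgebra.ad ℝ (LieAlg n G) W : LieAlg n G →ₗ[ℝ] LieAlg n G) : 𝔼 →ₗ[ℝ] 𝔼)

theorem lieRight_apply (W X : LieAlg n G) : lieRight W X = (⁅X, W⁆ : LieAlg n G) :=
  lie_skew X W

/-- If `a` and `b` lift the fields `ξ` and `η` to `G`, this is the lift of `[ξ, η]` given by the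
bracket of the corresponding vector fields on `G`. -/
def bracketLift (a b : G → LieAlg n G) (x : G) : LieAlg n G :=
  ⁅a x, b x⁆ + (algDeriv b x (a x) - algDeriv a x (b x))

/-- The derivative along `X` of the derivative of `φ` along the field `b`. -/
theorem leftDeriv_along {φ : G → B} (hφ : ContMDiff (𝓡 n) 𝓘(ℝ, B) ∞ φ) {b : G → LieAlg n G}
    (hb : ContMDiff (M' := 𝔼) (𝓡 n) 𝓘(ℝ, 𝔼) ∞ b) (x : G) (X : LieAlg n G) :
    leftDeriv n (fun x => leftDeriv n φ x (b x)) x X =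
      leftDeriv n (leftDeriv n φ) x X (b x) + leftDeriv n φ x (algDeriv b x X) :=
  leftDeriv_clm_apply (contMDiff_leftDeriv hφ) hb x X

theorem contMDiff_leftDeriv_along {φ : G → B} (hφ : ContMDiff (𝓡 n) 𝓘(ℝ, B) ∞ φ)
    {b : G → LieAlg n G} (hb : ContMDiff (M' := 𝔼) (𝓡 n) 𝓘(ℝ, 𝔼) ∞ b) :
    ContMDiff (𝓡 n) 𝓘(ℝ, B) ∞ (fun x => leftDeriv n φ x (b x)) :=
  (contMDiff_leftDeriv hφ).clm_apply hb

/-- The commutator of the derivatives along `a` and `b` is the derivative along their bracket. -/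
theorem leftDeriv_bracketLift {φ : G → B} (hφ : ContMDiff (𝓡 n) 𝓘(ℝ, B) ∞ φ) {a b : G → LieAlg n G}
    (ha : ContMDiff (M' := 𝔼) (𝓡 n) 𝓘(ℝ, 𝔼) ∞ a) (hb : ContMDiff (M' := 𝔼) (𝓡 n) 𝓘(ℝ, 𝔼) ∞ b)
    (x : G) :
    leftDeriv n (fun x => leftDeriv n φ x (b x)) x (a x) -
      leftDeriv n (fun x => leftDeriv n φ x (a x)) x (b x) =
      leftDeriv n φ x (bracketLift a b x) := by
  have h1 : leftDeriv n φ x (bracketLift a b x) = leftDeriv n φ x (⁅a x, b x⁆ : LieAlg n G) +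
      (leftDeriv n φ x (algDeriv b x (a x)) -
        leftDeriv n φ x (algDeriv a x (b x))) := by
    refine Eq.trans ?_ (congrArg _
      ((leftDeriv n φ x).map_sub (algDeriv b x (a x)) (algDeriv a x (b x))))
    exact (leftDeriv n φ x).map_add (⁅a x, b x⁆ : LieAlg n G) (algDeriv b x (a x) - algDeriv a x (b x))
  rw [h1, leftDeriv_along hφ hb, leftDeriv_along hφ ha, ← leftDeriv_leftDeriv_sub hφ]
  abel

theorem derivAlong_pullback {F : CoAlg n G} {u : Orbit F → ℝ} (hu : u ∈ smoothFn F) (ξ : vecField F)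
    {a : G → LieAlg n G} (h : ∀ x, adStar (orbitMap F x).1 (a x) = ξ.1 (orbitMap F x)) :
    (fun x => derivAlong ξ u (orbitMap F x)) =
      fun x => leftDeriv n (fun x => u (orbitMap F x)) x (a x) := by
  funext x
  exact derivAlong_eq hu (h x)

theorem derivAlong_mem {F : CoAlg n G} {u : Orbit F → ℝ} (hu : u ∈ smoothFn F) (ξ : vecField F) :
    derivAlong ξ u ∈ smoothFn F := by
  change ContMDiff _ _ _ (fun x => derivAlong ξ u (orbitMap F x))
  rw [derivAlong_pullback hu ξ (adStar_lift ξ)]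
  exact contMDiff_leftDeriv_along (contMDiff_pullback hu) (contMDiff_lift ξ)

/-- The commutator of derivations is the derivative along the bracket of the lifts. -/
theorem derivAlong_commutator {F : CoAlg n G} {u : Orbit F → ℝ} (hu : u ∈ smoothFn F)
    (ξ η : vecField F) (x : G) :
    derivAlong ξ (derivAlong η u) (orbitMap F x) - derivAlong η (derivAlong ξ u) (orbitMap F x) =
      leftDeriv n (fun x => u (orbitMap F x)) x (bracketLift (lift ξ) (lift η) x) := by
  rw [← leftDeriv_bracketLift (contMDiff_pullback hu) (contMDiff_lift ξ) (contMDiff_lift η),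
    derivAlong_eq (derivAlong_mem hu η) (adStar_lift ξ x),
    derivAlong_eq (derivAlong_mem hu ξ) (adStar_lift η x),
    derivAlong_pullback hu ξ (adStar_lift ξ), derivAlong_pullback hu η (adStar_lift η)]

theorem coord_mem_smoothFn (F : CoAlg n G) (W : LieAlg n G) :
    (fun y : Orbit F => y.1 W) ∈ smoothFn F := contMDiff_coord F W

theorem adStar_bracketLift {F : CoAlg n G} {ξ η ζ : vecField F} (h : IsFieldBracket ξ η ζ) (x : G) :
    adStar (orbitMap F x).1 (bracketLift (lift ξ) (lift η) x) = ζ.1 (orbitMap F x) := by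
  ext1 W
  have h1 := h _ (coord_mem_smoothFn F W) (orbitMap F x)
  rw [derivAlong_commutator (coord_mem_smoothFn F W), leftDeriv_coord,
    derivAlong_eq (coord_mem_smoothFn F W) (adStar_lift ζ x), leftDeriv_coord, ← adStar_apply,
    adStar_lift] at h1
  exact h1.symm

theorem isFieldBracket_of_adStar {F : CoAlg n G} {ξ η ζ : vecField F}
    (h : ∀ x, adStar (orbitMap F x).1 (bracketLift (lift ξ) (lift η) x) = ζ.1 (orbitMap F x)) :
    IsFieldBracket ξ η ζ := by
  intro u hu y
  obtain ⟨x, rfl⟩ := orbitMap_surjective F y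
  rw [derivAlong_commutator hu, derivAlong_eq hu (h x)]

/-! ### Poisson brackets -/

section Poisson

variable {F : CoAlg n G} {h : ℝ}

theorem leftDeriv_eq_of_hamField (hh : h ≠ 0) {u : Orbit F → ℝ} (hu : u ∈ smoothFn F) {a : LieAlg n G}
    {x : G} (ha : adStar (orbitMap F x).1 a = (hamField h u).1 (orbitMap F x)) (W : LieAlg n G) :
    leftDeriv n (fun x => u (orbitMap F x)) x W = -h * (orbitMap F x).1 ⁅a, W⁆ := by
  have h1 := congrArg (fun f : CoAlg n G => f W) ha
  rw [hamField_apply hh hu] at h1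
  change (orbitMap F x).1 ⁅a, W⁆ = _ at h1
  rw [h1]
  field_simp

theorem poisson_eq (hh : h ≠ 0) {u v : Orbit F → ℝ} (hv : v ∈ smoothFn F)
    (x : G) : poisson h u v (orbitMap F x) =
      h * (orbitMap F x).1 ⁅lift (hamField h u) x, lift (hamField h v) x⁆ := by
  unfold poisson
  rw [derivAlong_eq hv (adStar_lift _ x), leftDeriv_eq_of_hamField hh hv (adStar_lift _ x),
    ← lie_skew, map_neg]
  ring

/-- The derivative along `X` of the identity `W u = -h ⟨y, [a, W]⟩` that defines the Hamiltonian
field of `u`, with `a` its lift. -/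
theorem leftDeriv_leftDeriv_of_hamField (hh : h ≠ 0) {u : Orbit F → ℝ} (hu : u ∈ smoothFn F)
    (x : G) (X W : LieAlg n G) :
    leftDeriv n (leftDeriv n (fun x => u (orbitMap F x))) x X W =
      -h * ((orbitMap F x).1 ⁅X, ⁅lift (hamField h u) x, W⁆⁆ +
        (orbitMap F x).1 ⁅algDeriv (lift (hamField h u)) x X, W⁆) := by
  have h1 : (fun x => leftDeriv n (fun x => u (orbitMap F x)) x W) =
      fun x => -h * (orbitMap F x).1 ⁅lift (hamField h u) x, W⁆ := by
    funext x
    exact leftDeriv_eq_of_hamField hh hu (adStar_lift _ x) W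
  have h2 : leftDeriv n (fun x => leftDeriv n (fun x => u (orbitMap F x)) x W) x X =
      leftDeriv n (leftDeriv n (fun x => u (orbitMap F x))) x X W :=
    leftDeriv_clm (ContinuousLinearMap.apply ℝ ℝ (E := 𝔼) W)
      (contMDiff_leftDeriv (contMDiff_pullback hu)) x X
  have hl := contMDiff_lift (hamField h u)
  have hb : ContMDiff (M' := 𝔼) (𝓡 n) 𝓘(ℝ, 𝔼) ∞
      (fun x => (⁅lift (hamField h u) x, W⁆ : LieAlg n G)) := by
    have := (lieRight W).contMDiff.comp hl
    refine this.congr fun x => ?_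
    exact (lieRight_apply W _).symm
  have h3 := leftDeriv_clm (ContinuousLinearMap.mul ℝ ℝ (-h)) (contMDiff_coord_apply F hb) x X
  have h4 : algDeriv (fun x => ⁅lift (hamField h u) x, W⁆) x X =
      (⁅algDeriv (lift (hamField h u)) x X, W⁆ : LieAlg n G) := by
    have h5 := leftDeriv_clm (lieRight W) hl x X
    have h6 : (fun y => lieRight W (lift (hamField h u) y)) =
        fun x => (⁅lift (hamField h u) x, W⁆ : LieAlg n G) := by
      funext y; exact lieRight_apply W _
    rw [h6] at h5
    exact h5.trans (lieRight_apply W _)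
  rw [leftDeriv_coord_apply F hb] at h3
  change _ = -h * ((orbitMap F x).1 ⁅X, ⁅lift (hamField h u) x, W⁆⁆ +
    (orbitMap F x).1 (algDeriv (fun x => ⁅lift (hamField h u) x, W⁆) x X)) at h3
  rw [h4] at h3
  rw [← h2, h1]
  exact h3

/-- The Hamiltonian field of `{u, v}` is the commutator of those of `u` and `v`. -/
theorem isFieldBracket_hamField (hh : h ≠ 0) {u v : Orbit F → ℝ} (hu : u ∈ smoothFn F)
    (hv : v ∈ smoothFn F) :
    IsFieldBracket (hamField h u) (hamField h v) (hamField h (poisson h u v)) := by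
  have hw : poisson h u v ∈ smoothFn F := derivAlong_mem hv _
  refine isFieldBracket_of_adStar fun x => ?_
  ext1 W
  rw [hamField_apply hh hw]
  have e1 : (fun x => poisson h u v (orbitMap F x)) =
      fun x => leftDeriv n (fun x => v (orbitMap F x)) x (lift (hamField h u) x) :=
    derivAlong_pullback hv _ (adStar_lift _)
  rw [e1, leftDeriv_along (contMDiff_pullback hv) (contMDiff_lift _)]
  set a := lift (hamField h u) with ha
  set b := lift (hamField h v) with hb
  set y := (orbitMap F x).1 with hy
  have hV := leftDeriv_eq_of_hamField hh hv (adStar_lift (hamField h v) x)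
  have hU := leftDeriv_eq_of_hamField hh hu (adStar_lift (hamField h u) x)
  rw [← hb, ← hy] at hV
  rw [← ha, ← hy] at hU
  -- The right-hand side contains `W (a v)`. The commutator rule for `v` turns it into `a (W v)`,
  -- which is known from the differentiated Hamiltonian identity of `v`; that of `u`, in the two
  -- orders of `b` and `W`, controls the derivatives of the lift `a`.
  have cU := leftDeriv_leftDeriv_sub (contMDiff_pullback hu) x (b x) W
  have cV := leftDeriv_leftDeriv_sub (contMDiff_pullback hv) x W (a x)
  have uU1 := leftDeriv_leftDeriv_of_hamField hh hu x (b x) W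
  have uU2 := leftDeriv_leftDeriv_of_hamField hh hu x W (b x)
  have uV := leftDeriv_leftDeriv_of_hamField hh hv x (a x) W
  rw [← ha, ← hy] at uU1 uU2
  rw [← hb, ← hy] at uV
  rw [hU] at cU
  rw [hV] at cV
  have hVr := hV (algDeriv a x W)
  have l1 : y ⁅bracketLift a b x, W⁆ = y ⁅⁅a x, b x⁆, W⁆ +
      (y ⁅algDeriv b x (a x), W⁆ -
        y ⁅algDeriv a x (b x), W⁆) := by
    rw [← map_sub, ← map_add, ← sub_lie, ← add_lie]
    rfl
  rw [adStar_apply, l1]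
  change _ = -h⁻¹ * (leftDeriv n (leftDeriv n (fun x => v (orbitMap F x))) x W (a x) +
    leftDeriv n (fun x => v (orbitMap F x)) x (algDeriv a x W))
  rw [hVr]
  set p : LieAlg n G := algDeriv b x (a x)
  set q : LieAlg n G := algDeriv a x (b x)
  set r : LieAlg n G := algDeriv a x W
  -- What remains is linear in values of `y` on brackets, once the Jacobi identity is applied.
  have j1 : y ⁅⁅a x, b x⁆, W⁆ = y ⁅a x, ⁅b x, W⁆⁆ - y ⁅b x, ⁅a x, W⁆⁆ := by
    rw [lie_lie, map_sub]
  have j2 : y ⁅W, ⁅a x, b x⁆⁆ = -y ⁅⁅a x, b x⁆, W⁆ := by rw [← lie_skew, map_neg]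
  have j3 : y ⁅b x, ⁅W, a x⁆⁆ = -y ⁅b x, ⁅a x, W⁆⁆ := by rw [← lie_skew W, lie_neg, map_neg]
  have j4 : y ⁅r, b x⁆ = -y ⁅b x, r⁆ := by rw [← lie_skew, map_neg]
  rw [j3] at cV
  rw [j2, j4] at uU2
  have hi : h⁻¹ * h = 1 := inv_mul_cancel₀ hh
  rw [uU1, uU2] at cU
  rw [uV] at cV
  have k1 : leftDeriv n (leftDeriv n (fun x => v (orbitMap F x))) x W (a x) =
      -h * (y ⁅a x, ⁅b x, W⁆⁆ + y ⁅p, W⁆) + h * y ⁅b x, ⁅a x, W⁆⁆ := by linarith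
  rw [k1]
  have k2 : y ⁅b x, ⁅a x, W⁆⁆ + y ⁅q, W⁆ + y ⁅⁅a x, b x⁆, W⁆ + y ⁅b x, r⁆ = y ⁅a x, ⁅b x, W⁆⁆ := by
    have := mul_left_cancel₀ hh (a := h)
      (b := y ⁅b x, ⁅a x, W⁆⁆ + y ⁅q, W⁆ + y ⁅⁅a x, b x⁆, W⁆ + y ⁅b x, r⁆)
      (c := y ⁅a x, ⁅b x, W⁆⁆) (by linarith)
    exact this
  field_simp
  linarith

end Poisson

/-! ### The connection -/

section Connection

variable {V : Type v} [NormedAddCommGroup V] [InnerProductSpace ℂ V] {F : CoAlg n G}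
  {τ : stab F →* (V ≃ₗᵢ[ℂ] V)}

/-- The representation `τ` of `G_F` is scalar on one-parameter subgroups, with
`exp X` acting by `exp (2πi ⟨F, X⟩)`. -/
def HasOrbitCharacter (F : CoAlg n G) (τ : stab F →* (V ≃ₗᵢ[ℂ] V)) : Prop :=
  ∀ (X : LieAlg n G) (γ : ℝ → G), IsOneParam γ X → ∀ hγ : ∀ t, γ t ∈ stab F,
    ∀ t v, τ ⟨γ t, hγ t⟩ v = Complex.exp (2 * Real.pi * Complex.I * (t * F X)) • v

theorem leftDeriv_const_smul (c : ℂ) {φ : G → V} (hφ : ContMDiff (𝓡 n) 𝓘(ℝ, V) ∞ φ) (x : G)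
    (X : LieAlg n G) : leftDeriv n (fun y => c • φ y) x X = c • leftDeriv n φ x X :=
  leftDeriv_clm (c • ContinuousLinearMap.id ℝ V : V →L[ℝ] V) hφ x X

theorem contMDiff_const_smul (c : ℂ) {φ : G → V} (hφ : ContMDiff (𝓡 n) 𝓘(ℝ, V) ∞ φ) :
    ContMDiff (𝓡 n) 𝓘(ℝ, V) ∞ (fun y => c • φ y) :=
  (c • ContinuousLinearMap.id ℝ V : V →L[ℝ] V).contMDiff.comp hφ

theorem contMDiff_ofReal_smul {r : G → ℝ} (hr : ContMDiff (𝓡 n) 𝓘(ℝ, ℝ) ∞ r) {φ : G → V}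
    (hφ : ContMDiff (𝓡 n) 𝓘(ℝ, V) ∞ φ) :
    ContMDiff (𝓡 n) 𝓘(ℝ, V) ∞ (fun y => (r y : ℂ) • φ y) :=
  (hr.smul hφ).congr fun _ => Complex.coe_smul _ _

theorem leftDeriv_ofReal_smul {r : G → ℝ} (hr : ContMDiff (𝓡 n) 𝓘(ℝ, ℝ) ∞ r) {φ : G → V}
    (hφ : ContMDiff (𝓡 n) 𝓘(ℝ, V) ∞ φ) (x : G) (X : LieAlg n G) :
    leftDeriv n (fun y => (r y : ℂ) • φ y) x X =
      (r x : ℂ) • leftDeriv n φ x X + (leftDeriv n r x X : ℂ) • φ x := by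
  have h := leftDeriv_smul hr hφ x X
  simp only [← Complex.coe_smul] at h
  exact h

theorem leftDeriv_sub {φ ψ : G → B} (hφ : ContMDiff (𝓡 n) 𝓘(ℝ, B) ∞ φ)
    (hψ : ContMDiff (𝓡 n) 𝓘(ℝ, B) ∞ ψ) (x : G) (X : LieAlg n G) :
    leftDeriv n (fun y => φ y - ψ y) x X = leftDeriv n φ x X - leftDeriv n ψ x X := by
  obtain ⟨γ, hγ⟩ := exists_isOneParam X
  exact leftDeriv_eq_of_hasDerivAt (hφ.sub hψ) hγ
    ((hγ.hasDerivAt_leftDeriv_zero hφ x).sub (hγ.hasDerivAt_leftDeriv_zero hψ x))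

/-- The derivative of an equivariant function in the direction of the stabilizer. -/
theorem rightDeriv_section (hτ : HasOrbitCharacter F τ) (φ : sections F τ) (x : G) {Z : LieAlg n G}
    (hZ : ∀ W : LieAlg n G, F ⁅Z, W⁆ = 0) :
    rightDeriv n φ.1 x Z = (2 * Real.pi * Complex.I * F Z : ℂ) • φ.1 x := by
  obtain ⟨γ, hγ⟩ := exists_isOneParam Z
  have hs := hγ.mem_stab hZ
  refine (hγ.hasDerivAt_rightDeriv φ.2.1 x).unique ?_
  have h : (fun t => φ.1 (γ t * x)) =
      fun t : ℝ => Complex.exp (2 * Real.pi * Complex.I * (t * F Z)) • φ.1 x := by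
    funext t
    exact (φ.2.2 ⟨γ t, hs t⟩ x).trans (hτ Z γ hγ hs t _)
  rw [h]
  have h1 : HasDerivAt (fun t : ℝ => Complex.exp (2 * Real.pi * Complex.I * (t * F Z)))
      (2 * Real.pi * Complex.I * F Z) 0 := by
    have h2 : HasDerivAt (fun t : ℝ => 2 * Real.pi * Complex.I * ((t : ℂ) * F Z))
        (2 * Real.pi * Complex.I * F Z) 0 := by
      simpa using (((hasDerivAt_id (0 : ℝ)).ofReal_comp.mul_const (F Z : ℂ)).const_mul
        (2 * Real.pi * Complex.I))
    simpa using h2.cexp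
  exact h1.smul_const _

/-- The covariant derivative of `φ` at `x` in the direction of the projection to the orbit of the
left-invariant vector field of `Z`. -/
def covAt (F : CoAlg n G) (φ : G → V) (x : G) (Z : LieAlg n G) : V :=
  leftDeriv n φ x Z - (2 * Real.pi * Complex.I) • (((orbitMap F x).1 Z : ℝ) : ℂ) • φ x

theorem covAt_sub (φ : G → V) (x : G) (Z Z' : LieAlg n G) :
    covAt F φ x (Z - Z') = covAt F φ x Z - covAt F φ x Z' := by
  unfold covAt
  have h : leftDeriv n φ x (Z - Z') = leftDeriv n φ x Z - leftDeriv n φ x Z' :=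
    (leftDeriv n φ x).map_sub Z Z'
  rw [h, map_sub]
  push_cast
  module

theorem covAt_add (φ : G → V) (x : G) (Z Z' : LieAlg n G) :
    covAt F φ x (Z + Z') = covAt F φ x Z + covAt F φ x Z' := by
  unfold covAt
  have h : leftDeriv n φ x (Z + Z') = leftDeriv n φ x Z + leftDeriv n φ x Z' :=
    (leftDeriv n φ x).map_add Z Z'
  rw [h, map_add]
  push_cast
  module

theorem covAt_smul (φ : G → V) (x : G) (c : ℝ) (Z : LieAlg n G) :
    covAt F φ x (c • Z) = (c : ℂ) • covAt F φ x Z := by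
  unfold covAt
  have h : leftDeriv n φ x (c • Z) = (c : ℂ) • leftDeriv n φ x Z :=
    ((leftDeriv n φ x).map_smul c Z).trans (Complex.coe_smul _ _).symm
  rw [h, map_smul, smul_eq_mul]
  push_cast
  module

/-- The covariant derivative depends only on the tangent vector to the orbit. -/
theorem covAt_congr (hτ : HasOrbitCharacter F τ) (φ : sections F τ) {x : G} {Z Z' : LieAlg n G}
    (h : adStar (orbitMap F x).1 Z = adStar (orbitMap F x).1 Z') :
    covAt F φ.1 x Z = covAt F φ.1 x Z' := by
  rw [← sub_eq_zero, ← covAt_sub]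
  have h1 : adStar (orbitMap F x).1 (Z - Z') = 0 := by rw [map_sub, h, sub_self]
  unfold covAt
  rw [leftDeriv_eq_rightDeriv φ.2.1, rightDeriv_section hτ φ x (lie_Ad_eq_zero h1), orbitMap_apply,
    smul_smul, sub_self]

theorem contMDiff_covAt {φ : G → V} (hφ : ContMDiff (𝓡 n) 𝓘(ℝ, V) ∞ φ) {a : G → LieAlg n G}
    (ha : ContMDiff (M' := 𝔼) (𝓡 n) 𝓘(ℝ, 𝔼) ∞ a) :
    ContMDiff (𝓡 n) 𝓘(ℝ, V) ∞ (fun x => covAt F φ x (a x)) :=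
  (contMDiff_leftDeriv_along hφ ha).sub
    (contMDiff_const_smul _ (contMDiff_ofReal_smul (contMDiff_coord_apply F ha) hφ))

theorem leftDeriv_section_mul_left (φ : sections F τ) (k : stab F) (x : G) (Z : LieAlg n G) :
    leftDeriv n φ.1 (k * x) Z = τ k (leftDeriv n φ.1 x Z) := by
  rw [← leftDeriv_translate]
  have h : (fun g : G => φ.1 (k * g)) = fun g => τ k (φ.1 g) := by
    funext g; exact φ.2.2 k g
  rw [h]
  let L : V →L[ℝ] V := ((τ k).toContinuousLinearEquiv : V →L[ℂ] V).restrictScalars ℝ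
  exact leftDeriv_clm L φ.2.1 x Z

theorem covAt_mul_left (φ : sections F τ) (k : stab F) (x : G) (Z : LieAlg n G) :
    covAt F φ.1 (k * x) Z = τ k (covAt F φ.1 x Z) := by
  unfold covAt
  rw [leftDeriv_section_mul_left, orbitMap_mul_left F k.2, φ.2.2, map_sub, map_smul, map_smul]

theorem covAt_add_section {φ ψ : G → V} (hφ : ContMDiff (𝓡 n) 𝓘(ℝ, V) ∞ φ)
    (hψ : ContMDiff (𝓡 n) 𝓘(ℝ, V) ∞ ψ) (x : G) (Z : LieAlg n G) :
    covAt F (φ + ψ) x Z = covAt F φ x Z + covAt F ψ x Z := by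
  have h : leftDeriv n (φ + ψ) x Z = _ := leftDeriv_add hφ hψ x Z
  unfold covAt
  rw [h, Pi.add_apply]
  module

theorem covAt_smul_section (c : ℂ) {φ : G → V} (hφ : ContMDiff (𝓡 n) 𝓘(ℝ, V) ∞ φ)
    (x : G) (Z : LieAlg n G) : covAt F (c • φ) x Z = c • covAt F φ x Z := by
  have h : leftDeriv n (c • φ) x Z = _ := leftDeriv_const_smul c hφ x Z
  unfold covAt
  rw [h, Pi.smul_apply]
  module

/-- The covariant derivative along a vector field. -/
def covLinear (hτ : HasOrbitCharacter F τ) (ξ : vecField F) : sections F τ →ₗ[ℂ] sections F τ where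
  toFun φ := ⟨fun x => covAt F φ.1 x (lift ξ x), contMDiff_covAt φ.2.1 (contMDiff_lift ξ),
    fun k x => by
      have h : adStar (orbitMap F (k * x)).1 (lift ξ (k * x)) =
          adStar (orbitMap F (k * x)).1 (lift ξ x) := by
        rw [adStar_lift, orbitMap_mul_left F k.2, adStar_lift]
      exact (covAt_congr hτ φ h).trans (covAt_mul_left φ k x _)⟩
  map_add' φ ψ := Subtype.ext (funext fun x => covAt_add_section φ.2.1 ψ.2.1 x _)
  map_smul' c φ := Subtype.ext (funext fun x => covAt_smul_section c φ.2.1 x _)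

theorem covLinear_apply (hτ : HasOrbitCharacter F τ) (ξ : vecField F) (φ : sections F τ) {x : G}
    {Z : LieAlg n G} (h : adStar (orbitMap F x).1 Z = ξ.1 (orbitMap F x)) :
    (covLinear hτ ξ φ).1 x = covAt F φ.1 x Z :=
  covAt_congr hτ φ (by rw [adStar_lift, h])

/-- The connection on the bundle over the orbit: the covariant derivative of a section along the
projection of the left-invariant field of `Z` is `φ ↦ Zφ - 2πi y(Z) φ`. -/
def orbitConnection (hτ : HasOrbitCharacter F τ) : Connection F τ where
  cov := covLinear hτ
  cov_add ξ η φ := Subtype.ext <| funext fun x => by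
    have h : adStar (orbitMap F x).1 (lift ξ x + lift η x) = (ξ + η).1 (orbitMap F x) := by
      rw [map_add, adStar_lift, adStar_lift]; rfl
    rw [covLinear_apply hτ _ φ h, covAt_add]
    rfl
  cov_mul u ξ φ := Subtype.ext <| funext fun x => by
    have h : adStar (orbitMap F x).1 (u.1 (orbitMap F x) • lift ξ x) =
        (mulField u ξ).1 (orbitMap F x) := by
      rw [map_smul, adStar_lift]; rfl
    rw [covLinear_apply hτ _ φ h, covAt_smul]
    rfl
  leibniz u ξ φ x := by
    rw [derivAlong_eq u.2 (adStar_lift ξ x), covLinear_apply hτ ξ _ (adStar_lift ξ x),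
      covLinear_apply hτ ξ _ (adStar_lift ξ x)]
    have h : leftDeriv n (mulSec τ u φ).1 x (lift ξ x) = _ :=
      leftDeriv_ofReal_smul (contMDiff_pullback u.2) φ.2.1 x (lift ξ x)
    have h2 : (mulSec τ u φ).1 x = (u.1 (orbitMap F x) : ℂ) • φ.1 x := rfl
    unfold covAt
    rw [h, h2]
    module

/-- The correction term `2πi ⟨y, Z⟩` is purely imaginary and cancels. -/
theorem orbitConnection_isHermitian (hτ : HasOrbitCharacter F τ) :
    (orbitConnection hτ).IsHermitian := by
  intro ξ φ ψ x Z hZ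
  change _ = inner ℂ ((covLinear hτ ξ φ).1 x) (ψ.1 x) + inner ℂ (φ.1 x) ((covLinear hτ ξ ψ).1 x)
  rw [covLinear_apply hτ ξ _ hZ.symm, covLinear_apply hτ ξ _ hZ.symm]
  obtain ⟨γ, hγ⟩ := exists_isOneParam Z
  have hs : ContMDiff (𝓡 n) 𝓘(ℝ, ℂ) ∞ (fun g => inner ℂ (φ.1 g) (ψ.1 g)) :=
    (contDiff_inner (𝕜 := ℂ)).contMDiff.comp (φ.2.1.prodMk_space ψ.2.1)
  have h := (hγ.hasDerivAt_leftDeriv_zero φ.2.1 x).inner ℂ (hγ.hasDerivAt_leftDeriv_zero ψ.2.1 x)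
  rw [hγ.map_zero, mul_one] at h
  refine (leftDeriv_eq_of_hasDerivAt hs hγ h).trans ?_
  unfold covAt
  simp only [inner_sub_left, inner_sub_right, inner_smul_left, inner_smul_right, map_mul,
    Complex.conj_ofReal, Complex.conj_I, map_ofNat]
  ring

theorem leftDeriv_covAt {φ : G → V} (hφ : ContMDiff (𝓡 n) 𝓘(ℝ, V) ∞ φ) {b : G → LieAlg n G}
    (hb : ContMDiff (M' := 𝔼) (𝓡 n) 𝓘(ℝ, 𝔼) ∞ b) (x : G) (X : LieAlg n G) :
    leftDeriv n (fun x => covAt F φ x (b x)) x X =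
      leftDeriv n (fun x => leftDeriv n φ x (b x)) x X - (2 * Real.pi * Complex.I) •
        ((((orbitMap F x).1 (b x) : ℝ) : ℂ) • leftDeriv n φ x X +
          (((orbitMap F x).1 ⁅X, b x⁆ + (orbitMap F x).1 (algDeriv b x X) : ℝ) : ℂ) • φ x) := by
  have h1 := contMDiff_ofReal_smul (contMDiff_coord_apply F hb) hφ
  unfold covAt
  rw [leftDeriv_sub (contMDiff_leftDeriv_along hφ hb) (contMDiff_const_smul _ h1),
    leftDeriv_const_smul _ h1, leftDeriv_ofReal_smul (contMDiff_coord_apply F hb) hφ,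
    leftDeriv_coord_apply F hb]

/-- The second derivatives of `φ` combine to the derivative along the bracket of the lifts; the
derivative of `⟨y, Z⟩` contributes `⟨y, [a, b]⟩` twice, and the bracket of the lifts takes it away
once. -/
theorem orbitConnection_hasCurvature (hτ : HasOrbitCharacter F τ) {h : ℝ} (hh : h ≠ 0) :
    (orbitConnection hτ).HasCurvature h := by
  intro ξ η ζ hζ φ x
  change (covLinear hτ ξ (covLinear hτ η φ)).1 x - (covLinear hτ η (covLinear hτ ξ φ)).1 x -
    (covLinear hτ ζ φ).1 x = _
  rw [covLinear_apply hτ ζ φ (adStar_bracketLift hζ x),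
    omega_eq h (adStar_lift ξ x) (adStar_lift η x)]
  have ha := contMDiff_lift ξ
  have hb := contMDiff_lift η
  change covAt F (fun x => covAt F φ.1 x (lift η x)) x (lift ξ x) -
    covAt F (fun x => covAt F φ.1 x (lift ξ x)) x (lift η x) - _ = _
  have h1 := leftDeriv_bracketLift φ.2.1 ha hb x
  have h2 : (orbitMap F x).1 (bracketLift (lift ξ) (lift η) x) =
      (orbitMap F x).1 ⁅lift ξ x, lift η x⁆ + ((orbitMap F x).1 (algDeriv (lift η) x (lift ξ x)) -
        (orbitMap F x).1 (algDeriv (lift ξ) x (lift η x))) := by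
    unfold bracketLift
    rw [map_add, map_sub]
  have h3 : (orbitMap F x).1 ⁅lift η x, lift ξ x⁆ = -(orbitMap F x).1 ⁅lift ξ x, lift η x⁆ := by
    rw [← lie_skew, map_neg]
  have h4 : Complex.I / hbar h = 2 * Real.pi * Complex.I / h := by
    have := Real.pi_ne_zero
    unfold hbar
    push_cast
    field_simp
  have hc : (h : ℂ) ≠ 0 := by exact_mod_cast hh
  have h5 : ∀ r : ℝ, -(Complex.I / hbar h) * ((h * r : ℝ) : ℂ) = -(2 * Real.pi * Complex.I * r) := by
    intro r
    rw [h4]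
    push_cast
    field_simp
  rw [h5]
  unfold covAt at *
  rw [h2, ← h1]
  have e1 := leftDeriv_covAt (F := F) φ.2.1 hb x (lift ξ x)
  have e2 := leftDeriv_covAt (F := F) φ.2.1 ha x (lift η x)
  unfold covAt at e1 e2
  rw [e1, e2, h3]
  push_cast
  module

end Connection

/-! ### The quantization rules -/

section Quantization

variable {V : Type v} [NormedAddCommGroup V] [InnerProductSpace ℂ V] {F : CoAlg n G}
  {τ : stab F →* (V ≃ₗᵢ[ℂ] V)}

theorem hamField_add {h : ℝ} (hh : h ≠ 0) (u v : smoothFn F) :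
    hamField h (u + v : smoothFn F).1 = hamField h u.1 + hamField h v.1 := by
  refine vecField_ext fun x W => ?_
  change _ = (hamField h u.1).1 (orbitMap F x) W + (hamField h v.1).1 (orbitMap F x) W
  rw [hamField_apply hh (u + v).2, hamField_apply hh u.2, hamField_apply hh v.2, ← mul_add]
  exact congrArg _ (leftDeriv_add (contMDiff_pullback u.2) (contMDiff_pullback v.2) x W)

theorem hamField_smul {h : ℝ} (hh : h ≠ 0) (c : ℝ) (u : smoothFn F) :
    hamField h (c • u : smoothFn F).1 = mulField (algebraMap ℝ (smoothFn F) c) (hamField h u.1) := by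
  refine vecField_ext fun x W => ?_
  change _ = c * (hamField h u.1).1 (orbitMap F x) W
  rw [hamField_apply hh (c • u).2, hamField_apply hh u.2]
  have h1 : leftDeriv n (fun x => (c • u : smoothFn F).1 (orbitMap F x)) x W =
      c * leftDeriv n (fun x => u.1 (orbitMap F x)) x W :=
    leftDeriv_clm (ContinuousLinearMap.mul ℝ ℝ c) (contMDiff_pullback u.2) x W
  rw [h1]
  ring

theorem hamField_one {h : ℝ} (hh : h ≠ 0) : hamField h (1 : smoothFn F).1 = 0 := by
  refine vecField_ext fun x W => ?_
  rw [hamField_apply hh (1 : smoothFn F).2]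
  have h1 : leftDeriv n (fun x => (1 : smoothFn F).1 (orbitMap F x)) x W = 0 :=
    leftDeriv_const (1 : ℝ) x W
  rw [h1, mul_zero]
  rfl

theorem Connection.cov_zero (C : Connection F τ) (φ : sections F τ) : C.cov 0 φ = 0 := by
  have h := C.cov_add 0 0 φ
  rw [add_zero] at h
  exact left_eq_add.1 h

theorem Connection.Q_apply (C : Connection F τ) (h : ℝ) (u : smoothFn F) (φ : sections F τ) (x : G) :
    (C.Q h u φ).1 x = (u.1 (orbitMap F x) : ℂ) • φ.1 x +
      ((hbar h : ℂ) / Complex.I) • (C.cov (hamField h u.1) φ).1 x := rfl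

theorem poisson_skew {h : ℝ} (hh : h ≠ 0) (u v : smoothFn F) (x : G) :
    poisson h v.1 u.1 (orbitMap F x) = -poisson h u.1 v.1 (orbitMap F x) := by
  rw [poisson_eq hh u.2, poisson_eq hh v.2, ← lie_skew, map_neg]
  ring

/-- The curvature condition implies the quantization rules. -/
theorem Connection.HasCurvature.isQuantization {C : Connection F τ} {h : ℝ} (hh : h ≠ 0)
    (hC : C.HasCurvature h) : C.IsQuantization h := by
  have hb : (hbar h : ℂ) ≠ 0 := by
    have := Real.pi_ne_zero
    unfold hbar
    exact_mod_cast div_ne_zero hh (by positivity)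
  refine ⟨fun u v => ?_, fun c u => ?_, ?_, fun u v w hw => ?_⟩
  · refine LinearMap.ext fun φ => Subtype.ext <| funext fun x => ?_
    change (C.Q h (u + v) φ).1 x = (C.Q h u φ).1 x + (C.Q h v φ).1 x
    rw [C.Q_apply, C.Q_apply, C.Q_apply, hamField_add hh, C.cov_add]
    change ((u.1 (orbitMap F x) + v.1 (orbitMap F x) : ℝ) : ℂ) • φ.1 x + ((hbar h : ℂ) / Complex.I) •
      ((C.cov (hamField h u.1) φ).1 x + (C.cov (hamField h v.1) φ).1 x) = _
    push_cast
    module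
  · refine LinearMap.ext fun φ => Subtype.ext <| funext fun x => ?_
    change (C.Q h (c • u) φ).1 x = (c : ℂ) • (C.Q h u φ).1 x
    rw [C.Q_apply, C.Q_apply, hamField_smul hh, C.cov_mul]
    change ((c * u.1 (orbitMap F x) : ℝ) : ℂ) • φ.1 x + ((hbar h : ℂ) / Complex.I) •
      ((c : ℂ) • (C.cov (hamField h u.1) φ).1 x) = _
    push_cast
    module
  · refine LinearMap.ext fun φ => Subtype.ext <| funext fun x => ?_
    change (C.Q h 1 φ).1 x = φ.1 x
    rw [C.Q_apply, hamField_one hh, C.cov_zero]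
    change ((1 : ℝ) : ℂ) • φ.1 x + _ • (0 : V) = φ.1 x
    simp
  · refine LinearMap.ext fun φ => Subtype.ext <| funext fun x => ?_
    change (C.Q h w φ).1 x =
      (Complex.I / hbar h) • ((C.Q h u (C.Q h v φ)).1 x - (C.Q h v (C.Q h u φ)).1 x)
    have key : ∀ u v : smoothFn F, (C.Q h u (C.Q h v φ)).1 x =
        (u.1 (orbitMap F x) : ℂ) • ((v.1 (orbitMap F x) : ℂ) • φ.1 x +
          ((hbar h : ℂ) / Complex.I) • (C.cov (hamField h v.1) φ).1 x) +
        ((hbar h : ℂ) / Complex.I) • ((poisson h u.1 v.1 (orbitMap F x) : ℂ) • φ.1 x +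
          (v.1 (orbitMap F x) : ℂ) • (C.cov (hamField h u.1) φ).1 x +
          ((hbar h : ℂ) / Complex.I) • (C.cov (hamField h u.1) (C.cov (hamField h v.1) φ)).1 x) := by
      intro u v
      rw [C.Q_apply, C.Q_apply]
      have h1 : C.cov (hamField h u.1) (C.Q h v φ) = C.cov (hamField h u.1) (mulSec τ v φ) +
          ((hbar h : ℂ) / Complex.I) • C.cov (hamField h u.1) (C.cov (hamField h v.1) φ) := by
        rw [← map_smul, ← map_add]
        rfl
      rw [h1]
      change _ + _ • ((C.cov (hamField h u.1) (mulSec τ v φ)).1 x + ((hbar h : ℂ) / Complex.I) •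
        (C.cov (hamField h u.1) (C.cov (hamField h v.1) φ)).1 x) = _
      rw [C.leibniz]
      rfl
    have hc := hC _ _ _ (isFieldBracket_hamField hh u.2 v.2) φ x
    rw [omega_eq h (adStar_lift _ x) (adStar_lift _ x), ← poisson_eq hh v.2] at hc
    have hc2 : (C.cov (hamField h u.1) (C.cov (hamField h v.1) φ)).1 x =
        (C.cov (hamField h v.1) (C.cov (hamField h u.1) φ)).1 x +
        (C.cov (hamField h (poisson h u.1 v.1)) φ).1 x +
        (-(Complex.I / hbar h) * poisson h u.1 v.1 (orbitMap F x)) • φ.1 x := by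
      rw [← hc]; abel
    rw [key, key, hc2, poisson_skew hh u v, C.Q_apply, hw]
    push_cast
    set A := (C.cov (hamField h u.1) φ).1 x
    set A' := (C.cov (hamField h v.1) φ).1 x
    set D := (C.cov (hamField h v.1) (C.cov (hamField h u.1) φ)).1 x
    set E := (C.cov (hamField h (poisson h u.1 v.1)) φ).1 x
    match_scalars <;> field_simp <;> ring

/-- On all smooth sections, `(i/ħ) Q(f_X)` is the derivative of right translation by `exp X`. -/
theorem orbitConnection_Q_momentFn (hτ : HasOrbitCharacter F τ) {h : ℝ} (hh : h ≠ 0)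
    (X : LieAlg n G) (φ : sections F τ) (x : G) :
    (Complex.I / hbar h) • ((orbitConnection hτ).Q h (momentFn F h X) φ).1 x =
      leftDeriv n φ.1 x X := by
  have hb : (hbar h : ℂ) = h / (2 * Real.pi) := by
    unfold hbar; push_cast; rfl
  have hc : (h : ℂ) ≠ 0 := by exact_mod_cast hh
  have hp : (Real.pi : ℂ) ≠ 0 := by exact_mod_cast Real.pi_ne_zero
  rw [Connection.Q_apply, hamField_momentFn F hh]
  change _ • (((h * (orbitMap F x).1 X : ℝ) : ℂ) • φ.1 x + _ • (covLinear hτ (fundField F X) φ).1 x) = _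
  rw [covLinear_apply hτ (fundField F X) φ (Z := X) rfl, hb]
  unfold covAt
  push_cast
  match_scalars
  · field_simp
    ring
  · field_simp

end Quantization

/-! ### Convergence in `L²` -/

theorem enorm_sub_sq_le {V : Type*} [SeminormedAddCommGroup V] (a b : V) :
    ‖a - b‖ₑ ^ 2 ≤ 2 * ‖a‖ₑ ^ 2 + 2 * ‖b‖ₑ ^ 2 := by
  have h : ‖a - b‖ ^ 2 ≤ 2 * ‖a‖ ^ 2 + 2 * ‖b‖ ^ 2 := by
    have h1 := norm_sub_le a b
    have h2 := pow_le_pow_left₀ (norm_nonneg _) h1 2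
    nlinarith [sq_nonneg (‖a‖ - ‖b‖)]
  have h2 := ENNReal.ofReal_le_ofReal h
  rw [ENNReal.ofReal_add (by positivity) (by positivity), ENNReal.ofReal_mul (by norm_num),
    ENNReal.ofReal_mul (by norm_num), ENNReal.ofReal_pow (norm_nonneg _),
    ENNReal.ofReal_pow (norm_nonneg _), ENNReal.ofReal_pow (norm_nonneg _), ofReal_norm, ofReal_norm,
    ofReal_norm, ENNReal.ofReal_ofNat] at h2
  exact h2

/-- Pointwise convergence together with an upper bound for the norms implies convergence in norm:
here `a` stands for `‖f_t‖²`, `b` for `‖f‖²` and `c` for `‖f_t - f‖²`. -/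
theorem tendsto_lintegral_zero_of_le {α ι : Type*} [MeasurableSpace α] {μ : Measure α} {l : Filter ι}
    [l.IsCountablyGenerated] {a c : ι → α → ENNReal} {b : α → ENNReal}
    (ha : ∀ i, Measurable (a i)) (hb : Measurable b) (hc : ∀ i, Measurable (c i))
    (hcab : ∀ i x, c i x ≤ 2 * a i x + 2 * b x) (hfin : ∫⁻ x, b x ∂μ ≠ ⊤)
    (hab : ∀ᶠ i in l, ∫⁻ x, a i x ∂μ ≤ ∫⁻ x, b x ∂μ)
    (hlim : ∀ x, Tendsto (fun i => a i x) l (𝓝 (b x)))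
    (hclim : ∀ x, Tendsto (fun i => c i x) l (𝓝 0)) :
    Tendsto (fun i => ∫⁻ x, c i x ∂μ) l (𝓝 0) := by
  have h1 : Tendsto (fun i => ∫⁻ x, min (a i x) (b x) ∂μ) l (𝓝 (∫⁻ x, b x ∂μ)) := by
    refine tendsto_lintegral_filter_of_dominated_convergence b
      (Eventually.of_forall fun i => (ha i).min hb)
      (Eventually.of_forall fun i => Eventually.of_forall fun x => min_le_right _ _) hfin
      (Eventually.of_forall fun x => ?_)
    simpa using (hlim x).min (tendsto_const_nhds (x := b x))
  have h2 : Tendsto (fun i => ∫⁻ x, min (c i x) (4 * b x) ∂μ) l (𝓝 0) := by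
    have h := tendsto_lintegral_filter_of_dominated_convergence (μ := μ) (l := l)
      (F := fun i x => min (c i x) (4 * b x)) (f := fun _ => 0) (fun x => 4 * b x)
      (Eventually.of_forall fun i => (hc i).min (hb.const_mul 4))
      (Eventually.of_forall fun i => Eventually.of_forall fun x => min_le_right _ _)
      (by rw [lintegral_const_mul 4 hb]; exact ENNReal.mul_ne_top (by simp) hfin)
      (Eventually.of_forall fun x => by
        simpa using (hclim x).min (tendsto_const_nhds (x := 4 * b x)))
    simpa using h
  have h3 : Tendsto (fun i => ∫⁻ x, min (c i x) (4 * b x) ∂μ +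
      2 * (∫⁻ x, b x ∂μ - ∫⁻ x, min (a i x) (b x) ∂μ)) l (𝓝 0) := by
    have h := h2.add (ENNReal.Tendsto.const_mul
      (ENNReal.Tendsto.sub (tendsto_const_nhds (x := ∫⁻ x, b x ∂μ)) h1 (Or.inl hfin))
      (Or.inr (ENNReal.ofNat_ne_top (n := 2))))
    simpa using h
  refine tendsto_of_tendsto_of_tendsto_of_le_of_le' tendsto_const_nhds h3
    (Eventually.of_forall fun _ => zero_le) ?_
  filter_upwards [hab] with i hi
  -- `c ≤ min c (4 b) + 2 (a - b)⁺`, and the integral of `(a - b)⁺` is at most `∫ b - ∫ min a b`.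
  have hp : ∀ x, c i x ≤ min (c i x) (4 * b x) + 2 * (a i x - b x) := by
    intro x
    rcases le_total (c i x) (4 * b x) with h | h
    · rw [min_eq_left h]; exact le_self_add
    · rw [min_eq_right h]
      calc c i x ≤ 2 * a i x + 2 * b x := hcab i x
        _ ≤ 2 * (b x + (a i x - b x)) + 2 * b x := by gcongr; exact le_add_tsub
        _ = 4 * b x + 2 * (a i x - b x) := by ring
  have hm : ∫⁻ x, min (a i x) (b x) ∂μ ≠ ⊤ :=
    ne_top_of_le_ne_top hfin (lintegral_mono fun x => min_le_right _ _)
  have hab' : Measurable fun x => a i x - b x := (ha i).sub hb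
  have hd : ∫⁻ x, (a i x - b x) ∂μ ≤ ∫⁻ x, b x ∂μ - ∫⁻ x, min (a i x) (b x) ∂μ := by
    refine ENNReal.le_sub_of_add_le_right hm ?_
    rw [← lintegral_add_left hab']
    simpa only [tsub_add_min] using hi
  calc ∫⁻ x, c i x ∂μ ≤ ∫⁻ x, (min (c i x) (4 * b x) + 2 * (a i x - b x)) ∂μ := lintegral_mono hp
    _ = ∫⁻ x, min (c i x) (4 * b x) ∂μ + 2 * ∫⁻ x, (a i x - b x) ∂μ := by
      rw [lintegral_add_left ((hc i).min (hb.const_mul 4)), lintegral_const_mul 2 hab']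
    _ ≤ _ := by gcongr

/-- Jensen's inequality for the square. -/
theorem sq_lintegral_le {α : Type*} [MeasurableSpace α] {μ : Measure α} [IsProbabilityMeasure μ]
    {f : α → ENNReal} (hf : AEMeasurable f μ) : (∫⁻ x, f x ∂μ) ^ 2 ≤ ∫⁻ x, f x ^ 2 ∂μ := by
  have h := ENNReal.lintegral_mul_le_Lp_mul_Lq μ (p := 2) (q := 2)
    Real.HolderConjugate.two_two hf (aemeasurable_const (b := (1 : ENNReal)))
  simp only [Pi.mul_apply, mul_one, ENNReal.one_rpow, lintegral_const, measure_univ] at h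
  have h2 := pow_le_pow_left' h 2
  refine h2.trans (le_of_eq ?_)
  rw [← ENNReal.rpow_natCast, ← ENNReal.rpow_mul]
  norm_num

/-! ### The derivative of the induced representation -/

section Ind

variable {F : CoAlg n G} {χ : stab F →* Circle} {W : Type w}
  [NormedAddCommGroup W] [InnerProductSpace ℂ W] {σt : stab F →* (W ≃ₗᵢ[ℂ] W)}
  {V : Type v} [NormedAddCommGroup V] [InnerProductSpace ℂ V] [CompleteSpace V]
  {P : Polarization F χ σt V}

/-- The factor that is trivial on the identity component drops out on one-parameter subgroups. -/
theorem Extension.hasOrbitCharacter (σ : Extension P) (hχ : IsOrbitCharacter F χ)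
    (hσt : IsTypicalRep F σt) : HasOrbitCharacter F σ.onStab := by
  intro X γ hγ hs t v
  obtain ⟨ι, U, hU⟩ := σ.multiple
  have hc : σt ⟨γ t, hs t⟩ = 1 := by
    refine hσt.2 _ ?_
    have h1 : Continuous (fun s => (⟨γ s, hs s⟩ : stab F)) := hγ.smooth.continuous.subtype_mk _
    have h2 := (isPreconnected_range h1).subset_connectedComponent
      (x := (1 : stab F)) ⟨0, Subtype.ext hγ.map_zero⟩
    exact h2 ⟨t, rfl⟩
  apply U.injective
  ext1
  funext i
  have h3 := hU ⟨γ t, hs t⟩ v i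
  rw [hc, hχ.2 X γ hγ hs t, Circle.coe_exp] at h3
  rw [map_smul]
  refine h3.trans ?_
  change Complex.exp _ • U v i = Complex.exp _ • U v i
  congr 2
  push_cast
  ring

theorem lieLeftC_tmul (φ : G → V) (x : G) (z : ℂ) (Y : LieAlg n G) :
    lieLeftC φ x (z ⊗ₜ[ℝ] Y) = -(z • rightDeriv n φ x Y) := by
  unfold lieLeftC
  rw [LinearMap.liftBaseChange_tmul, lieLeft_apply, smul_neg]

/-- Left-invariant fields commute with the operators `L_Z`. -/
theorem leftDeriv_lieLeftC {φ : G → V} (hφ : ContMDiff (𝓡 n) 𝓘(ℝ, V) ∞ φ) (X : LieAlg n G)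
    (Z : LieAlgC n G) : ContMDiff (𝓡 n) 𝓘(ℝ, V) ∞ (fun x => lieLeftC φ x Z) ∧ ∀ x,
      leftDeriv n (fun x => lieLeftC φ x Z) x X = lieLeftC (fun x => leftDeriv n φ x X) x Z := by
  induction Z using TensorProduct.induction_on with
  | zero =>
    simp only [_root_.map_zero]
    exact ⟨contMDiff_const, fun x => leftDeriv_const 0 x X⟩
  | tmul z Y =>
    simp only [lieLeftC_tmul, ← neg_smul]
    refine ⟨contMDiff_const_smul _ (contMDiff_rightDeriv_apply hφ Y), fun x => ?_⟩
    rw [leftDeriv_const_smul _ (contMDiff_rightDeriv_apply hφ Y), leftDeriv_rightDeriv_comm hφ]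
  | add Z Z' h h' =>
    simp only [_root_.map_add]
    refine ⟨h.1.add h'.1, fun x => ?_⟩
    rw [leftDeriv_add h.1 h'.1, h.2, h'.2]

theorem leftDeriv_inner {φ : G → V} (hφ : ContMDiff (𝓡 n) 𝓘(ℝ, V) ∞ φ) (v : V) (x : G)
    (X : LieAlg n G) :
    leftDeriv n (fun x => inner ℂ v (φ x)) x X = inner ℂ v (leftDeriv n φ x X) :=
  leftDeriv_clm ((innerSL ℂ v).restrictScalars ℝ) hφ x X

/-- The derivative of an element of the induced space along a left-invariant vector field. -/
def indDeriv (σ : Extension P) (X : LieAlg n G) (φ : indSpace σ) : indSpace σ :=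
  ⟨fun x => leftDeriv n φ.1 x X, contMDiff_leftDeriv_apply φ.2.1 X, fun k x => by
    change leftDeriv n φ.1 (k * x) X = σ.rep k (leftDeriv n φ.1 x X)
    rw [← leftDeriv_translate]
    have h : (fun g : G => φ.1 (k * g)) = fun g => σ.rep k (φ.1 g) := by
      funext g; exact φ.2.2.1 k g
    rw [h]
    let L : V →L[ℝ] V := ((σ.rep k).toContinuousLinearEquiv : V →L[ℂ] V).restrictScalars ℝ
    exact leftDeriv_clm L φ.2.1 x X, fun Z v x => by
    have h := leftDeriv_lieLeftC φ.2.1 X (conjC (Z : LieAlgC n G))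
    change inner ℂ (v : V) (lieLeftC (fun x => leftDeriv n φ.1 x X) x _) =
      inner ℂ (P.ρ Z v : V) (leftDeriv n φ.1 x X)
    rw [← h.2, ← leftDeriv_inner h.1, ← leftDeriv_inner φ.2.1]
    have h3 : (fun x => inner ℂ (v : V) (lieLeftC φ.1 x (conjC (Z : LieAlgC n G)))) =
        fun x => inner ℂ (P.ρ Z v : V) (φ.1 x) := by
      funext x; exact φ.2.2.2 Z v x
    rw [h3]⟩

theorem indDeriv_apply (σ : Extension P) (X : LieAlg n G) (φ : indSpace σ) (x : G) :
    (indDeriv σ X φ).1 x = leftDeriv n φ.1 x X := rfl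

/-! ### The difference quotients of the induced representation -/

variable (σ : Extension P) {K : Subgroup G} (hK : K ≤ P.H)

theorem fibreNormSq_mk (φ : indSpace σ) (x : G) :
    fibreNormSq σ hK φ (Quotient.mk _ x) = ‖φ.1 x‖ₑ ^ 2 := rfl

theorem continuous_fibreNormSq (φ : indSpace σ) : Continuous (fibreNormSq σ hK φ) :=
  Continuous.quotient_lift ((ENNReal.continuous_pow 2).comp φ.2.1.continuous.enorm) _

theorem measurable_fibreNormSq (φ : indSpace σ) : Measurable (fibreNormSq σ hK φ) :=
  (continuous_fibreNormSq σ hK φ).measurable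

theorem fibreNormSq_Ind (g : G) (φ : indSpace σ) (q : CosetSpace K) :
    fibreNormSq σ hK (Ind σ g φ) q = fibreNormSq σ hK φ (CosetSpace.mulRight K g q) := by
  induction q using Quotient.inductionOn with
  | h x => rfl

theorem measurable_mulRight (n : ℕ) {G : Type u} [TopologicalSpace G]
    [ChartedSpace (EuclideanSpace ℝ (Fin n)) G] [Group G] [LieGroup (𝓡 n) ∞ G] (K : Subgroup G)
    (g : G) : Measurable (CosetSpace.mulRight K g) := by
  have : IsTopologicalGroup G := topologicalGroup_of_lieGroup (𝓡 n) ∞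
  have h : Continuous (CosetSpace.mulRight K g) :=
    continuous_quot_lift _ (continuous_quot_mk.comp (continuous_mul_const g))
  exact h.measurable

theorem l2Sq_Ind {ν : Measure (CosetSpace K)}
    (hν : ∀ g : G, ν.map (CosetSpace.mulRight K g) = ν) (g : G) (φ : indSpace σ) :
    l2Sq σ hK ν (Ind σ g φ) = l2Sq σ hK ν φ := by
  unfold l2Sq
  simp only [fibreNormSq_Ind]
  rw [← lintegral_map (measurable_fibreNormSq σ hK φ) (measurable_mulRight n K g), hν]

theorem fibreNormSq_sub_le (φ ψ : indSpace σ) (q : CosetSpace K) :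
    fibreNormSq σ hK (φ - ψ) q ≤ 2 * fibreNormSq σ hK φ q + 2 * fibreNormSq σ hK ψ q := by
  induction q using Quotient.inductionOn with
  | h x => exact enorm_sub_sq_le (φ.1 x) (ψ.1 x)

theorem l2Sq_sub_le (ν : Measure (CosetSpace K)) (φ ψ : indSpace σ) :
    l2Sq σ hK ν (φ - ψ) ≤ 2 * l2Sq σ hK ν φ + 2 * l2Sq σ hK ν ψ := by
  unfold l2Sq
  rw [← lintegral_const_mul 2 (measurable_fibreNormSq σ hK φ),
    ← lintegral_const_mul 2 (measurable_fibreNormSq σ hK ψ),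
    ← lintegral_add_left ((measurable_fibreNormSq σ hK φ).const_mul 2)]
  exact lintegral_mono (fibreNormSq_sub_le σ hK φ ψ)

theorem l2Sq_smul (ν : Measure (CosetSpace K)) (c : ℂ) (φ : indSpace σ) :
    l2Sq σ hK ν (c • φ) = ‖c‖ₑ ^ 2 * l2Sq σ hK ν φ := by
  unfold l2Sq
  rw [← lintegral_const_mul _ (measurable_fibreNormSq σ hK φ)]
  congr 1
  funext q
  induction q using Quotient.inductionOn with
  | h x =>
    change ‖c • φ.1 x‖ₑ ^ 2 = ‖c‖ₑ ^ 2 * ‖φ.1 x‖ₑ ^ 2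
    rw [enorm_smul, mul_pow]

variable {γ : ℝ → G} {X : LieAlg n G}

theorem diffQuot_apply (t : ℝ) (φ : indSpace σ) (x : G) :
    (diffQuot σ γ t φ).1 x = t⁻¹ • (φ.1 (x * γ t) - φ.1 x) :=
  Complex.coe_smul _ _

theorem tendsto_diffQuot (hγ : IsOneParam γ X) (φ : indSpace σ) (x : G) :
    Tendsto (fun t => (diffQuot σ γ t φ).1 x) (𝓝[≠] 0) (𝓝 ((indDeriv σ X φ).1 x)) := by
  have h := hasDerivAt_iff_tendsto_slope_zero.1 (hγ.hasDerivAt_leftDeriv_zero φ.2.1 x)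
  simp only [zero_add, hγ.map_zero, mul_one] at h
  simp only [diffQuot_apply, indDeriv_apply]
  exact h

theorem diffQuot_eq_integral (hγ : IsOneParam γ X) (φ : indSpace σ) {t : ℝ} (ht : t ≠ 0) (x : G) :
    (diffQuot σ γ t φ).1 x = ∫ s in (0 : ℝ)..1, (indDeriv σ X φ).1 (x * γ (t * s)) := by
  have hd : ∀ s : ℝ, HasDerivAt (fun s => φ.1 (x * γ (t * s)))
      (t • (indDeriv σ X φ).1 (x * γ (t * s))) s := by
    intro s
    have h1 : HasDerivAt (fun s : ℝ => t * s) t s := by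
      simpa using (hasDerivAt_id s).const_mul t
    exact (hγ.hasDerivAt_leftDeriv φ.2.1 x (t * s)).scomp s h1
  have : IsTopologicalGroup G := topologicalGroup_of_lieGroup (𝓡 n) ∞
  have hcont : Continuous (fun s : ℝ => (indDeriv σ X φ).1 (x * γ (t * s))) :=
    (indDeriv σ X φ).2.1.continuous.comp
      (continuous_const.mul (hγ.smooth.continuous.comp (continuous_const.mul continuous_id)))
  have h2 := intervalIntegral.integral_eq_sub_of_hasDerivAt (a := 0) (b := 1) (fun s _ => hd s)
    ((hcont.const_smul t).intervalIntegrable 0 1)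
  rw [intervalIntegral.integral_smul, mul_one, mul_zero, hγ.map_zero, mul_one] at h2
  rw [diffQuot_apply, ← h2, smul_smul, inv_mul_cancel₀ ht, one_smul]

/-- The difference quotients are averages of translates of the derivative. Hence, by Jensen's
inequality, Tonelli's theorem and the invariance of `ν`, their norms are at most that of the
derivative. -/
theorem l2Sq_diffQuot_le (hγ : IsOneParam γ X) (φ : indSpace σ) {ν : Measure (CosetSpace K)}
    [SigmaFinite ν] (hν : ∀ g : G, ν.map (CosetSpace.mulRight K g) = ν) {t : ℝ} (ht : t ≠ 0) :
    l2Sq σ hK ν (diffQuot σ γ t φ) ≤ l2Sq σ hK ν (indDeriv σ X φ) := by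
  have : IsTopologicalGroup G := topologicalGroup_of_lieGroup (𝓡 n) ∞
  set ψ := indDeriv σ X φ with hψ
  let μ : Measure ℝ := volume.restrict (Ioc 0 1)
  have hμ : IsProbabilityMeasure μ := ⟨by simp [μ]⟩
  have hcont : ∀ x, Continuous (fun s : ℝ => ψ.1 (x * γ (t * s))) := fun x =>
    ψ.2.1.continuous.comp
      (continuous_const.mul (hγ.smooth.continuous.comp (continuous_const.mul continuous_id)))
  have h1 : ∀ q : CosetSpace K, fibreNormSq σ hK (diffQuot σ γ t φ) q ≤
      ∫⁻ s, fibreNormSq σ hK (Ind σ (γ (t * s)) ψ) q ∂μ := by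
    intro q
    induction q using Quotient.inductionOn with
    | h x =>
      rw [fibreNormSq_mk, diffQuot_eq_integral σ hγ φ ht,
        intervalIntegral.integral_of_le zero_le_one]
      refine (pow_le_pow_left' (enorm_integral_le_lintegral_enorm _) 2).trans ?_
      exact sq_lintegral_le (μ := μ) (hcont x).enorm.measurable.aemeasurable
  have h2 : Measurable (Function.uncurry fun (s : ℝ) (q : CosetSpace K) =>
      fibreNormSq σ hK (Ind σ (γ (t * s)) ψ) q) := by
    refine measurable_uncurry_of_continuous_of_measurable (fun q => ?_)
      fun s => measurable_fibreNormSq σ hK _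
    induction q using Quotient.inductionOn with
    | h x => exact (ENNReal.continuous_pow 2).comp (hcont x).enorm
  calc l2Sq σ hK ν (diffQuot σ γ t φ)
      ≤ ∫⁻ q, ∫⁻ s, fibreNormSq σ hK (Ind σ (γ (t * s)) ψ) q ∂μ ∂ν := lintegral_mono h1
    _ = ∫⁻ s, ∫⁻ q, fibreNormSq σ hK (Ind σ (γ (t * s)) ψ) q ∂ν ∂μ :=
        (lintegral_lintegral_swap h2.aemeasurable).symm
    _ = ∫⁻ _, l2Sq σ hK ν ψ ∂μ := lintegral_congr fun s => l2Sq_Ind σ hK hν _ ψ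
    _ = l2Sq σ hK ν ψ := by simp

theorem tendsto_l2Sq_diffQuot_sub (hγ : IsOneParam γ X) (φ : indSpace σ)
    {ν : Measure (CosetSpace K)} [SigmaFinite ν]
    (hν : ∀ g : G, ν.map (CosetSpace.mulRight K g) = ν)
    (hfin : l2Sq σ hK ν (indDeriv σ X φ) < ⊤) :
    Tendsto (fun t : ℝ => l2Sq σ hK ν (diffQuot σ γ t φ - indDeriv σ X φ)) (𝓝[≠] 0) (𝓝 0) := by
  refine tendsto_lintegral_zero_of_le (fun t => measurable_fibreNormSq σ hK (diffQuot σ γ t φ))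
    (measurable_fibreNormSq σ hK (indDeriv σ X φ)) (fun t => measurable_fibreNormSq σ hK _)
    (fun t => fibreNormSq_sub_le σ hK _ _) hfin.ne ?_ (fun q => ?_) (fun q => ?_)
  · filter_upwards [self_mem_nhdsWithin] with t ht
    exact l2Sq_diffQuot_le σ hK hγ φ hν ht
  · induction q using Quotient.inductionOn with
    | h x =>
      exact ((ENNReal.continuous_pow 2).tendsto _).comp (tendsto_diffQuot σ hγ φ x).enorm
  · induction q using Quotient.inductionOn with
    | h x =>
      have h := (tendsto_diffQuot σ hγ φ x).sub_const ((indDeriv σ X φ).1 x)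
      have h2 := ((ENNReal.continuous_pow 2).tendsto _).comp h.enorm
      rw [sub_self, enorm_zero, zero_pow two_ne_zero] at h2
      exact h2

/-- Convergence in norm implies the Cauchy condition. -/
theorem tendsto_l2Sq_diffQuot_sub_diffQuot (φ ψ : indSpace σ) {ν : Measure (CosetSpace K)}
    (h : Tendsto (fun t : ℝ => l2Sq σ hK ν (diffQuot σ γ t φ - ψ)) (𝓝[≠] 0) (𝓝 0)) :
    Tendsto (fun q : ℝ × ℝ => l2Sq σ hK ν (diffQuot σ γ q.1 φ - diffQuot σ γ q.2 φ))
      (𝓝[≠] 0 ×ˢ 𝓝[≠] 0) (𝓝 0) := by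
  have h1 : Tendsto (fun q : ℝ × ℝ => 2 * l2Sq σ hK ν (diffQuot σ γ q.1 φ - ψ) +
      2 * l2Sq σ hK ν (diffQuot σ γ q.2 φ - ψ)) (𝓝[≠] 0 ×ˢ 𝓝[≠] 0) (𝓝 0) := by
    have h2 := (ENNReal.Tendsto.const_mul (h.comp tendsto_fst) (Or.inr (ENNReal.ofNat_ne_top (n := 2)))).add
      (ENNReal.Tendsto.const_mul (h.comp tendsto_snd) (Or.inr (ENNReal.ofNat_ne_top (n := 2))))
    simpa using h2
  refine tendsto_of_tendsto_of_tendsto_of_le_of_le tendsto_const_nhds h1 (fun _ => zero_le)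
    fun q => ?_
  have h3 : diffQuot σ γ q.1 φ - diffQuot σ γ q.2 φ =
      (diffQuot σ γ q.1 φ - ψ) - (diffQuot σ γ q.2 φ - ψ) := by abel
  change l2Sq σ hK ν _ ≤ _
  rw [h3]
  exact l2Sq_sub_le σ hK ν _ _

/-- If the difference quotients are Cauchy in norm, their pointwise limit has finite norm, by Fatou's
lemma. -/
theorem l2Sq_indDeriv_lt_top (hγ : IsOneParam γ X) (φ : indSpace σ) {ν : Measure (CosetSpace K)}
    (hν : ∀ g : G, ν.map (CosetSpace.mulRight K g) = ν) (hφ : l2Sq σ hK ν φ < ⊤)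
    (h : Tendsto (fun q : ℝ × ℝ => l2Sq σ hK ν (diffQuot σ γ q.1 φ - diffQuot σ γ q.2 φ))
      (𝓝[≠] 0 ×ˢ 𝓝[≠] 0) (𝓝 0)) : l2Sq σ hK ν (indDeriv σ X φ) < ⊤ := by
  obtain ⟨s, hs⟩ := ((ENNReal.tendsto_nhds_zero.1 h 1 one_pos).curry).exists
  have h1 : l2Sq σ hK ν (diffQuot σ γ s φ - indDeriv σ X φ) ≤ 1 := by
    have h2 : ∀ q : CosetSpace K, fibreNormSq σ hK (diffQuot σ γ s φ - indDeriv σ X φ) q =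
        liminf (fun t => fibreNormSq σ hK (diffQuot σ γ s φ - diffQuot σ γ t φ) q) (𝓝[≠] 0) := by
      intro q
      refine (Tendsto.liminf_eq ?_).symm
      induction q using Quotient.inductionOn with
      | h x =>
        exact ((ENNReal.continuous_pow 2).tendsto _).comp
          ((tendsto_diffQuot σ hγ φ x).const_sub ((diffQuot σ γ s φ).1 x)).enorm
    unfold l2Sq
    simp only [h2]
    refine (lintegral_liminf_le fun t => measurable_fibreNormSq σ hK _).trans ?_
    exact liminf_le_of_frequently_le' hs.frequently
  have h2 : l2Sq σ hK ν (diffQuot σ γ s φ) < ⊤ := by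
    unfold diffQuot
    rw [l2Sq_smul]
    refine ENNReal.mul_lt_top (by simp) ((l2Sq_sub_le σ hK ν _ _).trans_lt ?_)
    rw [l2Sq_Ind σ hK hν]
    exact ENNReal.add_lt_top.2 ⟨ENNReal.mul_lt_top (by simp) hφ, ENNReal.mul_lt_top (by simp) hφ⟩
  have h3 : indDeriv σ X φ = diffQuot σ γ s φ - (diffQuot σ γ s φ - indDeriv σ X φ) := by abel
  rw [h3]
  refine (l2Sq_sub_le σ hK ν _ _).trans_lt (ENNReal.add_lt_top.2
    ⟨ENNReal.mul_lt_top (by simp) h2, ENNReal.mul_lt_top (by simp) (h1.trans_lt (by simp))⟩)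

end Ind

end OrbitMethod

end

theorem mainTheorem9 {n : ℕ} {G : Type*} [TopologicalSpace G]
    [ChartedSpace (EuclideanSpace ℝ (Fin n)) G] [Group G] [LieGroup (𝓡 n) ∞ G] [ConnectedSpace G]
    {W : Type*} [NormedAddCommGroup W] [InnerProductSpace ℂ W] [CompleteSpace W]
    {V : Type*} [NormedAddCommGroup V] [InnerProductSpace ℂ V] [CompleteSpace V]
    (F : CoAlg n G)
    (χ : stab F →* Circle) (_hχ : IsOrbitCharacter F χ)
    (σt : stab F →* (W ≃ₗᵢ[ℂ] W)) (_hσt : IsTypicalRep F σt)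
    (P : Polarization F χ σt V) (σ : Extension P) (h : ℝ) (_hh : 0 < h) :
    -- every smooth function on the orbit has a unique Hamiltonian field, and that of `f_X` is `ξ_X`
    (∀ u : smoothFn F, ∃! ξ : vecField F, IsHamiltonianField h u.1 ξ) ∧
    (∀ X : LieAlg n G, hamField h (momentFn F h X).1 = fundField F X) ∧
    ∃ C : Connection F σ.onStab,
      C.IsHermitian ∧ C.HasCurvature h ∧ C.IsQuantization h ∧
      -- `γ` is the one-parameter subgroup `exp (t X)`
      ∀ X : LieAlg n G, ∃ γ : ℝ → G, IsOneParam γ X ∧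
        -- the identity on all smooth sections of the bundle
        (∀ (φ : sections F σ.onStab) (x : G),
          HasDerivAt (fun t : ℝ => φ.1 (x * γ t))
            ((Complex.I / hbar h) • (C.Q h (momentFn F h X) φ).1 x) 0) ∧
        -- the identity on the space of the induced representation
        ∀ φ : indSpace σ, ∃ ψ : indSpace σ,
          indToSections σ ψ =
            (Complex.I / hbar h) • C.Q h (momentFn F h X) (indToSections σ φ) ∧
          (∀ x : G, HasDerivAt (fun t : ℝ => (Ind σ (γ t) φ).1 x) (ψ.1 x) 0) ∧
          -- the identity for the unitarized representation on square-integrable sections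
          ∀ (K : Subgroup G) (_hF : stab F ≤ K) (hK : K ≤ P.H)
            (ν : MeasureTheory.Measure (CosetSpace K)) [MeasureTheory.SigmaFinite ν],
            (∀ g : G, ν.map (CosetSpace.mulRight K g) = ν) → l2Sq σ hK ν φ < ⊤ →
            (l2Sq σ hK ν ψ < ⊤ ↔
              Filter.Tendsto
                (fun q : ℝ × ℝ => l2Sq σ hK ν (diffQuot σ γ q.1 φ - diffQuot σ γ q.2 φ))
                (𝓝[≠] 0 ×ˢ 𝓝[≠] 0) (𝓝 0)) ∧
            (l2Sq σ hK ν ψ < ⊤ →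
              Filter.Tendsto (fun t : ℝ => l2Sq σ hK ν (diffQuot σ γ t φ - ψ))
                (𝓝[≠] 0) (𝓝 0)) := by
  have hτ := σ.hasOrbitCharacter _hχ _hσt
  have hh := _hh.ne'
  refine ⟨existsUnique_isHamiltonianField hh, hamField_momentFn F hh, orbitConnection hτ,
    orbitConnection_isHermitian hτ, orbitConnection_hasCurvature hτ hh,
    (orbitConnection_hasCurvature hτ hh).isQuantization hh, fun X => ?_⟩
  obtain ⟨γ, hγ⟩ := exists_isOneParam X
  refine ⟨γ, hγ, fun φ x => ?_, fun φ => ⟨indDeriv σ X φ, ?_, fun x => ?_, ?_⟩⟩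
  · rw [orbitConnection_Q_momentFn hτ hh]
    exact hγ.hasDerivAt_leftDeriv_zero φ.2.1 x
  · exact Subtype.ext <| funext fun x =>
      (orbitConnection_Q_momentFn hτ hh X (indToSections σ φ) x).symm
  · exact hγ.hasDerivAt_leftDeriv_zero φ.2.1 x
  · intro K _ hK ν _ hν hφ
    exact ⟨⟨fun hfin => tendsto_l2Sq_diffQuot_sub_diffQuot σ hK φ _
        (tendsto_l2Sq_diffQuot_sub σ hK hγ φ hν hfin), l2Sq_indDeriv_lt_top σ hK hγ φ hν hφ⟩,
      tendsto_l2Sq_diffQuot_sub σ hK hγ φ hν⟩
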